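/- Let $G=(V,E)$ be a finite simple graph with cardinal preferences, i.e. a function $\mathsf{sat}\colon V\times V\to\mathbb{R}_{\ge 0}$ with $\mathsf{sat}(u,u)=0$ and $\{u,v\}\in E$ iff $\mathsf{sat}(u,v)>0$ or $\mathsf{sat}(v,u)>0$. Ties $\mathsf{sat}(v,x)=\mathsf{sat}(v,y)$ between distinct neighbours $x,y$ of $v$ are allowed; $\mathsf{sat}$ is strict if there are none. A fractional matching is a map $M\colon E\to\mathbb{R}_{\ge0}$ with $\sum_{u\in N(v)}M(v,u)\le 1$ for all $v$; $v$ is matched if this sum is positive and fully matched if it is $1$; $M$ is half-integral if all its values are in $\{0,\tfrac12,1\}$. Write $M(x,\succeq y)=\sum_{w\in N(x),\,\mathsf{sat}(x,w)\ge\mathsf{sat}(x,y)}M(x,w)$. $M$ is ordinally stable if no edge $\{u,v\}$ has $M(u,\succeq v)<1$ and $M(v,\succeq u)<1$, and cardinally stable if no edge $\{u,v\}$ has $\sum_{w\in N(u)}\mathsf{sat}(u,w)M(u,w)<\mathsf{sat}(u,v)$ and $\sum_{w\in N(v)}\mathsf{sat}(v,w)M(v,w)<\mathsf{sat}(v,u)$.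 A tie-breaking of $\mathsf{sat}$ is a strict satisfaction function $\widehat{\mathsf{sat}}$ of the same graph such that $\mathsf{sat}(x,y)>\mathsf{sat}(x,z)$ implies $\widehat{\mathsf{sat}}(x,y)>\widehat{\mathsf{sat}}(x,z)$ for all neighbours $y,z$ of $x$. A stable partition of $(G,\widehat{\mathsf{sat}})$ is a permutation $\pi$ of $V$ such that for every $v\in V$: (0) if $\pi(v)\ne v$ then $\{v,\pi(v)\}\in E$; (1) if $\pi(v)\neq\pi^{-1}(v)$ then $\widehat{\mathsf{sat}}(v,\pi(v))>\widehat{\mathsf{sat}}(v,\pi^{-1}(v))$; (2) for each neighbour $w\ne\pi(v)$ of $v$, if $\pi(v)=v$ or $\widehat{\mathsf{sat}}(v,w)>\widehat{\mathsf{sat}}(v,\pi^{-1}(v))$, then $\widehat{\mathsf{sat}}(w,\pi^{-1}(w))>\widehat{\mathsf{sat}}(w,v)$. Its matching $M^\pi$ has the value $1$ on $\{v,\pi(v)\}$ if $\pi(v)=\pi^{-1}(v)\ne v$, the value $\tfrac12$ on $\{v,\pi(v)\}$ if $\pi(v)\ne\pi^{-1}(v)$, and $0$ on all other edges. **Lemma.**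 (a) Every $(G,\mathsf{sat})$ admits a half-integral fractional matching that is ordinally stable and cardinally stable and under which every matched agent is fully matched. More precisely: $\mathsf{sat}$ has a tie-breaking; for every tie-breaking $\widehat{\mathsf{sat}}$, $(G,\widehat{\mathsf{sat}})$ has a stable partition; and for every stable partition $\pi$ of $(G,\widehat{\mathsf{sat}})$, $M^\pi$ is such a matching of $(G,\mathsf{sat})$. (b) Such a matching $M^\pi$, for a stable partition $\pi$ of $(G,\widehat{\mathsf{sat}})$ with some tie-breaking $\widehat{\mathsf{sat}}$, can be computed in $O(n^2)$ steps, $n=|V|\ge1$, on a word RAM with words of $O(\log n)$ bits and unit-cost operations $+$, truncated $-$, $\times$, integer division, comparison, and indirect addressing. This holds for both of the following input formats. (i) The input is the matrix of the values $\mathsf{sat}(u,v)$, each a fraction of two non-negative integers of at most $(n+1)^k$ (so that a value fits into a constant number of words), for any fixed $k$; the program and the constants may depend on $k$. (ii) $\mathsf{sat}$ is arbitrary, and the input is the preference lists: for each agent her neighbours in order of non-increasing satisfaction, ties in any order; $\widehat{\mathsf{sat}}$ then breaks the ties as the lists do. -/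

import Mathlib

namespace FracRoommates

noncomputable section

open scoped Classical in
/-- The neighbourhood of `v` as a finite set. -/
def nbrs {V : Type*} [Fintype V] (G : SimpleGraph V) (v : V) : Finset V :=
  Finset.univ.filter (fun u => G.Adj v u)

/-- `sat` is a satisfaction function (cardinal preferences) of the graph `G`. -/
structure IsSatisfaction {V : Type*} (G : SimpleGraph V) (sat : V → V → ℝ) : Prop where
  nonneg : ∀ u v, 0 ≤ sat u v
  self : ∀ u, sat u u = 0
  adj_iff : ∀ u v, G.Adj u v ↔ 0 < sat u v ∨ 0 < sat v u

/-- The preferences derived from `sat` have no ties. -/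
def IsStrict {V : Type*} (G : SimpleGraph V) (sat : V → V → ℝ) : Prop :=
  ∀ v x y, G.Adj v x → G.Adj v y → x ≠ y → sat v x ≠ sat v y

/-- `sat'` is a satisfaction function of the same graph, without ties, obtained from `sat` by
breaking ties: strict preferences between neighbours are kept. -/
structure IsTieBreaking {V : Type*} (G : SimpleGraph V) (sat sat' : V → V → ℝ) : Prop where
  isSatisfaction : IsSatisfaction G sat'
  strict : IsStrict G sat'
  keeps : ∀ x y z, G.Adj x y → G.Adj x z → sat x z < sat x y → sat' x z < sat' x y

/-- A fractional matching: non-negative weights on the edges, written as a symmetric function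
`M u v` of the two endpoints that is `0` off the edges, with total weight at most one at every
agent. -/
structure IsFractionalMatching {V : Type*} [Fintype V] (G : SimpleGraph V)
    (M : V → V → ℝ) : Prop where
  symm : ∀ u v, M u v = M v u
  off_edge : ∀ u v, ¬ G.Adj u v → M u v = 0
  nonneg : ∀ u v, 0 ≤ M u v
  sum_le_one : ∀ v, ∑ u ∈ nbrs G v, M v u ≤ 1

def IsMatched {V : Type*} [Fintype V] (G : SimpleGraph V) (M : V → V → ℝ) (v : V) : Prop :=
  0 < ∑ u ∈ nbrs G v, M v u

def IsFullyMatched {V : Type*} [Fintype V] (G : SimpleGraph V) (M : V → V → ℝ) (v : V) : Prop :=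
  ∑ u ∈ nbrs G v, M v u = 1

def IsHalfIntegral {V : Type*} (G : SimpleGraph V) (M : V → V → ℝ) : Prop :=
  ∀ u v, G.Adj u v → M u v = 0 ∨ M u v = 1 / 2 ∨ M u v = 1

/-- `M(x, ⪰ y)`: the total weight between `x` and the neighbours that `x` weakly prefers
to `y`. -/
def weightAtLeast {V : Type*} [Fintype V] (G : SimpleGraph V) (sat M : V → V → ℝ)
    (x y : V) : ℝ :=
  ∑ w ∈ (nbrs G x).filter (fun w => sat x y ≤ sat x w), M x w

/-- The utility of `v` under `M`. -/
def utility {V : Type*} [Fintype V] (G : SimpleGraph V) (sat M : V → V → ℝ) (v : V) : ℝ :=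
  ∑ u ∈ nbrs G v, sat v u * M v u

/-- No edge is an ordinally blocking pair. -/
def IsOrdinallyStable {V : Type*} [Fintype V] (G : SimpleGraph V) (sat M : V → V → ℝ) : Prop :=
  ∀ u v, G.Adj u v → ¬ (weightAtLeast G sat M u v < 1 ∧ weightAtLeast G sat M v u < 1)

/-- No edge is a cardinally blocking pair. -/
def IsCardinallyStable {V : Type*} [Fintype V] (G : SimpleGraph V) (sat M : V → V → ℝ) : Prop :=
  ∀ u v, G.Adj u v → ¬ (utility G sat M u < sat u v ∧ utility G sat M v < sat v u)

/-- A stable partition of `(G, sat)`, for `sat` without ties, in the sense of Tan. In the last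
condition `v = π u` is excepted: on a cycle of length at least three `u` prefers `π u` to
`π⁻¹ u` by `prefers`, while `π⁻¹ (π u) = u`. -/
structure IsStablePartition {V : Type*} (G : SimpleGraph V) (sat : V → V → ℝ)
    (π : Equiv.Perm V) : Prop where
  edge : ∀ v, π v ≠ v → G.Adj v (π v)
  prefers : ∀ v, π v ≠ π⁻¹ v → sat v (π⁻¹ v) < sat v (π v)
  stable : ∀ u v, G.Adj u v → v ≠ π u → (π u = u ∨ sat u (π⁻¹ u) < sat u v) →
    sat v u < sat v (π⁻¹ v)

open scoped Classical in
/-- The matching that corresponds to a stable partition: weight `1` on the transpositions, `1/2`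
along the longer cycles, `0` elsewhere. -/
def partitionMatching {V : Type*} (π : Equiv.Perm V) (u v : V) : ℝ :=
  if u = v then 0
  else if π u = v ∧ π v = u then 1
  else if π u = v ∨ π v = u then 1 / 2
  else 0

/-- `M` is a fractional matching of `(G, sat)` that is ordinally and cardinally stable and
half-integral, and under which every matched agent is fully matched. -/
structure IsHalfIntegralStable {V : Type*} [Fintype V] (G : SimpleGraph V)
    (sat M : V → V → ℝ) : Prop where
  matching : IsFractionalMatching G M
  ordinallyStable : IsOrdinallyStable G sat M
  cardinallyStable : IsCardinallyStable G sat M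
  halfIntegral : IsHalfIntegral G M
  full : ∀ v, IsMatched G M v → IsFullyMatched G M v

/-- `L u` lists the neighbours of `u`, each once, from most to least preferred; tied neighbours
may come in any order. -/
structure IsPreferenceLists {V : Type*} (G : SimpleGraph V) (sat : V → V → ℝ)
    (L : V → List V) : Prop where
  nodup : ∀ u, (L u).Nodup
  mem_iff : ∀ u v, v ∈ L u ↔ G.Adj u v
  sorted : ∀ u, (L u).Pairwise (fun v w => sat u w ≤ sat u v)

end

/-! Word RAM programs with a step count. The memory consists of registers `0, 1, 2, …` and arrays
`0, 1, 2, …` of words; a program names finitely many of them. -/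

structure Mem where
  reg : ℕ → ℕ
  arr : ℕ → ℕ → ℕ

/-- Word operations; subtraction is truncated and division rounds down. -/
inductive WordOp where
  | add | sub | mul | div

def WordOp.eval : WordOp → ℕ → ℕ → ℕ
  | .add, x, y => x + y
  | .sub, x, y => x - y
  | .mul, x, y => x * y
  | .div, x, y => x / y

inductive WordTerm where
  | const (c : ℕ)
  | reg (r : ℕ)
  | read (a : ℕ) (i : WordTerm)
  | bin (o : WordOp) (e f : WordTerm)

def WordTerm.eval (s : Mem) : WordTerm → ℕ
  | .const c => c
  | .reg r => s.reg r
  | .read a i => s.arr a (i.eval s)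
  | .bin o e f => o.eval (e.eval s) (f.eval s)

/-- The number of unit-cost operations in the evaluation of a term. -/
def WordTerm.cost : WordTerm → ℕ
  | .const _ => 1
  | .reg _ => 1
  | .read _ i => 1 + i.cost
  | .bin _ e f => 1 + e.cost + f.cost

/-- All values that occur in the evaluation of a term are smaller than `W`. -/
def WordTerm.Fits (W : ℕ) (s : Mem) : WordTerm → Prop
  | .const c => c < W
  | .reg r => s.reg r < W
  | .read a i => i.Fits W s ∧ s.arr a (i.eval s) < W
  | .bin o e f => e.Fits W s ∧ f.Fits W s ∧ o.eval (e.eval s) (f.eval s) < W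

inductive Program where
  | skip
  | set (r : ℕ) (e : WordTerm)
  | write (a : ℕ) (i e : WordTerm)
  | seq (p q : Program)
  | ifLt (e f : WordTerm) (p q : Program)
  | whileLt (e f : WordTerm) (p : Program)

/-- `Exec W p s s' t`: started in memory `s`, the program `p` halts after exactly `t` steps in
memory `s'`, and all words that it handles are smaller than `W`. -/
inductive Exec (W : ℕ) : Program → Mem → Mem → ℕ → Prop
  | skip (s : Mem) : Exec W .skip s s 1
  | set (s : Mem) (r : ℕ) (e : WordTerm) (he : e.Fits W s) :
      Exec W (.set r e) s ⟨Function.update s.reg r (e.eval s), s.arr⟩ (1 + e.cost)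
  | write (s : Mem) (a : ℕ) (i e : WordTerm) (hi : i.Fits W s) (he : e.Fits W s) :
      Exec W (.write a i e) s
        ⟨s.reg, Function.update s.arr a (Function.update (s.arr a) (i.eval s) (e.eval s))⟩
        (1 + i.cost + e.cost)
  | seq {p q : Program} {s s₁ s₂ : Mem} {t₁ t₂ : ℕ} (hp : Exec W p s s₁ t₁)
      (hq : Exec W q s₁ s₂ t₂) : Exec W (.seq p q) s s₂ (t₁ + t₂)
  | ifTrue {e f : WordTerm} {p q : Program} {s s' : Mem} {t : ℕ} (he : e.Fits W s)
      (hf : f.Fits W s) (h : e.eval s < f.eval s) (hp : Exec W p s s' t) :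
      Exec W (.ifLt e f p q) s s' (1 + e.cost + f.cost + t)
  | ifFalse {e f : WordTerm} {p q : Program} {s s' : Mem} {t : ℕ} (he : e.Fits W s)
      (hf : f.Fits W s) (h : ¬ e.eval s < f.eval s) (hq : Exec W q s s' t) :
      Exec W (.ifLt e f p q) s s' (1 + e.cost + f.cost + t)
  | whileTrue {e f : WordTerm} {p : Program} {s s₁ s₂ : Mem} {t₁ t₂ : ℕ} (he : e.Fits W s)
      (hf : f.Fits W s) (h : e.eval s < f.eval s) (hp : Exec W p s s₁ t₁)
      (hw : Exec W (.whileLt e f p) s₁ s₂ t₂) :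
      Exec W (.whileLt e f p) s s₂ (1 + e.cost + f.cost + t₁ + t₂)
  | whileFalse {e f : WordTerm} {p : Program} {s : Mem} (he : e.Fits W s)
      (hf : f.Fits W s) (h : ¬ e.eval s < f.eval s) :
      Exec W (.whileLt e f p) s s (1 + e.cost + f.cost)

/-- The array that holds `A u v` in cell `u * n + v`, and `0` in all cells from `n * n` on. -/
def matrixArray (n : ℕ) (A : Fin n → Fin n → ℕ) (k : ℕ) : ℕ :=
  if h : k < n * n then
    A ⟨k / n, Nat.div_lt_of_lt_mul h⟩ ⟨k % n, Nat.mod_lt _ (Nat.pos_of_mul_pos_right (Nat.zero_lt_of_lt h))⟩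
  else 0

/-- Initial memory for an instance given by the satisfaction values `p u v / q u v`: register `0`
holds `n`, array `0` the numerators, array `1` the denominators; all else is `0`. -/
def satInput (n : ℕ) (p q : Fin n → Fin n → ℕ) : Mem where
  reg r := if r = 0 then n else 0
  arr a := if a = 0 then matrixArray n p else if a = 1 then matrixArray n q else fun _ => 0

/-- Initial memory for an instance given by preference lists: register `0` holds `n`, array `0`
holds the `i`-th entry of the list of `u` (`i = 0, 1, …`) in cell `u * n + i`, array `1` holds the
length of the list of `u` in cell `u`; all else is `0`. -/
def listInput (n : ℕ) (L : Fin n → List (Fin n)) : Mem where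
  reg r := if r = 0 then n else 0
  arr a :=
    if a = 0 then matrixArray n (fun u i => ((L u).map Fin.val).getD i.val 0)
    else if a = 1 then (fun k => if h : k < n then (L ⟨k, h⟩).length else 0)
    else fun _ => 0

/-- Array `2` of the memory holds twice the matching weights: `2 * M u v` is stored in cell
`u * n + v`. -/
def HoldsMatching (n : ℕ) (s : Mem) (M : Fin n → Fin n → ℝ) : Prop :=
  ∀ u v : Fin n, (s.arr 2 (u.val * n + v.val) : ℝ) = 2 * M u v

end FracRoommates

/-!
The existence of a stable partition is proved by running a program, so that existence and running
time have the same proof. The program is Irving's algorithm in the variant of Tan, on preference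
lists whose entries are deleted only implicitly: for each agent `u`, a cursor `fst u` moves forward
and a length `lim u` shrinks. The pair of `u` and `v` is dead once `u` has position
`lim v` or higher in the list of `v`, or the other way round.

* In the proposal phase every agent proposes along her list, and every agent cuts her list off after
  the best proposal so far. In the resulting table (`Prefs.IsTable`) each agent with a non-empty
  list is the last entry of her first entry.
* As long as the list of some agent `o` has three live entries, the walk starting at `o` along
  "the last entry of the second entry" (`Prefs.succ`) runs into a cycle, a rotation. Moving its
  agents to their second entries gives a table again (`Prefs.Eliminated.isTable`). The critical
  point is that no agent of the rotation loses the entry she moves to. If she did, two agents of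
  the walk would be first and second entry of each other, and this pattern could be pushed back
  along the walk to its start, whose list would then have two entries only
  (`Prefs.Lasso.no_crossing`). The three live entries of `o` thus exclude the odd cycles of a stable
  partition, which cannot be eliminated.
* When all lists have at most two live entries, `u ↦` first entry of `u` is a stable partition, and
  its inverse is `u ↦` last entry of `u` (`Prefs.Represents.exists_stablePartition`).

The time bound rests on potentials (`Prefs.ProposalInv.potential`, `SearchState.potential`) that
decrease in every round of a loop; the part of the walk outside the eliminated cycle is kept on a
stack, so that the walk is not started anew after an elimination. All programs store only words that
exceed the largest word in memory by at most one (`Program.Slow`), so that a bound on the time gives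
a bound on the words (`FreeExec.exec`), and the programs can be analysed without word bounds
(`FreeExec`, `Reaches`).

A stable partition `π` for a tie-breaking gives a stable matching for the original preferences: on
each edge one of the two agents is matched and weakly prefers both `π v` and `π⁻¹ v` to the other
endpoint (`IsStablePartition.exists_content`), and these two partners carry her whole weight, so
that she blocks neither ordinally nor cardinally.

If the input consists of fractions `p / q` of numbers up to `(n + 1) ^ k`, the preference lists
are found by radix sort, base `n + 1`, of all pairs at once, by the keys
`⌊p (n + 1) ^ (2 k) / q⌋`. The factor is at least every product of two denominators, so that different
fractions have different keys (`scaled_div_lt`), and a fixed number of digits suffices.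
-/

namespace FracRoommates

open Finset

/-! ### Word RAM programs without a word bound -/

instance : Add WordTerm := ⟨.bin .add⟩
instance : Sub WordTerm := ⟨.bin .sub⟩
instance : Mul WordTerm := ⟨.bin .mul⟩
instance : Div WordTerm := ⟨.bin .div⟩

@[simp] theorem WordTerm.eval_add (s : Mem) (e f : WordTerm) :
    (e + f).eval s = e.eval s + f.eval s := rfl

@[simp] theorem WordTerm.eval_sub (s : Mem) (e f : WordTerm) :
    (e - f).eval s = e.eval s - f.eval s := rfl

@[simp] theorem WordTerm.eval_mul (s : Mem) (e f : WordTerm) :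
    (e * f).eval s = e.eval s * f.eval s := rfl

@[simp] theorem WordTerm.eval_div (s : Mem) (e f : WordTerm) :
    (e / f).eval s = e.eval s / f.eval s := rfl

@[simp] theorem WordTerm.eval_const (s : Mem) (c : ℕ) : (WordTerm.const c).eval s = c := rfl

@[simp] theorem WordTerm.eval_reg (s : Mem) (r : ℕ) : (WordTerm.reg r).eval s = s.reg r := rfl

@[simp] theorem WordTerm.eval_read (s : Mem) (a : ℕ) (i : WordTerm) :
    (WordTerm.read a i).eval s = s.arr a (i.eval s) := rfl

/-- `Exec` without the bound on the words. -/
inductive FreeExec : Program → Mem → Mem → ℕ → Prop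
  | skip (s : Mem) : FreeExec .skip s s 1
  | set (s : Mem) (r : ℕ) (e : WordTerm) :
      FreeExec (.set r e) s ⟨Function.update s.reg r (e.eval s), s.arr⟩ (1 + e.cost)
  | write (s : Mem) (a : ℕ) (i e : WordTerm) :
      FreeExec (.write a i e) s
        ⟨s.reg, Function.update s.arr a (Function.update (s.arr a) (i.eval s) (e.eval s))⟩
        (1 + i.cost + e.cost)
  | seq {p q : Program} {s s₁ s₂ : Mem} {t₁ t₂ : ℕ} (hp : FreeExec p s s₁ t₁)
      (hq : FreeExec q s₁ s₂ t₂) : FreeExec (.seq p q) s s₂ (t₁ + t₂)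
  | ifTrue {e f : WordTerm} {p q : Program} {s s' : Mem} {t : ℕ}
      (h : e.eval s < f.eval s) (hp : FreeExec p s s' t) :
      FreeExec (.ifLt e f p q) s s' (1 + e.cost + f.cost + t)
  | ifFalse {e f : WordTerm} {p q : Program} {s s' : Mem} {t : ℕ}
      (h : ¬ e.eval s < f.eval s) (hq : FreeExec q s s' t) :
      FreeExec (.ifLt e f p q) s s' (1 + e.cost + f.cost + t)
  | whileTrue {e f : WordTerm} {p : Program} {s s₁ s₂ : Mem} {t₁ t₂ : ℕ}
      (h : e.eval s < f.eval s) (hp : FreeExec p s s₁ t₁)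
      (hw : FreeExec (.whileLt e f p) s₁ s₂ t₂) :
      FreeExec (.whileLt e f p) s s₂ (1 + e.cost + f.cost + t₁ + t₂)
  | whileFalse {e f : WordTerm} {p : Program} {s : Mem}
      (h : ¬ e.eval s < f.eval s) :
      FreeExec (.whileLt e f p) s s (1 + e.cost + f.cost)

/-! ### Loop-free programs and loops over them -/

/-- No loops occur in the program. -/
def Program.LoopFree : Program → Prop
  | .skip => True
  | .set _ _ => True
  | .write _ _ _ => True
  | .seq p q => p.LoopFree ∧ q.LoopFree
  | .ifLt _ _ p q => p.LoopFree ∧ q.LoopFree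
  | .whileLt _ _ _ => False

/-- The effect of a loop-free program on the memory; loops are ignored. -/
def Program.eval : Program → Mem → Mem
  | .skip, s => s
  | .set r e, s => ⟨Function.update s.reg r (e.eval s), s.arr⟩
  | .write a i e, s =>
    ⟨s.reg, Function.update s.arr a (Function.update (s.arr a) (i.eval s) (e.eval s))⟩
  | .seq p q, s => q.eval (p.eval s)
  | .ifLt e f p q, s => if e.eval s < f.eval s then p.eval s else q.eval s
  | .whileLt _ _ _, s => s

/-- An upper bound for the number of steps of a loop-free program; for a loop, for one round. -/
def Program.maxCost : Program → ℕ
  | .skip => 1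
  | .set _ e => 1 + e.cost
  | .write _ i e => 1 + i.cost + e.cost
  | .seq p q => p.maxCost + q.maxCost
  | .ifLt e f p q => 1 + e.cost + f.cost + max p.maxCost q.maxCost
  | .whileLt e f p => 1 + e.cost + f.cost + p.maxCost

theorem FreeExec.of_loopFree {p : Program} (hp : p.LoopFree) (s : Mem) :
    ∃ t ≤ p.maxCost, FreeExec p s (p.eval s) t := by
  induction p generalizing s with
  | skip => exact ⟨1, le_rfl, .skip s⟩
  | set r e => exact ⟨_, le_rfl, .set s r e⟩
  | write a i e => exact ⟨_, le_rfl, .write s a i e⟩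
  | seq p q ihp ihq =>
    obtain ⟨t₁, h₁, hp'⟩ := ihp hp.1 s
    obtain ⟨t₂, h₂, hq'⟩ := ihq hp.2 (p.eval s)
    exact ⟨_, Nat.add_le_add h₁ h₂, .seq hp' hq'⟩
  | ifLt e f p q ihp ihq =>
    obtain ⟨t₁, h₁, hp'⟩ := ihp hp.1 s
    obtain ⟨t₂, h₂, hq'⟩ := ihq hp.2 s
    by_cases h : e.eval s < f.eval s
    · refine ⟨_, ?_, by simpa only [Program.eval, if_pos h] using .ifTrue h hp'⟩
      simp only [Program.maxCost]; omega
    · refine ⟨_, ?_, by simpa only [Program.eval, if_neg h] using .ifFalse h hq'⟩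
      simp only [Program.maxCost]; omega
  | whileLt e f p => exact hp.elim

/-- `Reaches p s T Q`: started in `s`, the program `p` halts within `T` steps in a memory
satisfying `Q`. -/
def Reaches (p : Program) (s : Mem) (T : ℕ) (Q : Mem → Prop) : Prop :=
  ∃ s' t, FreeExec p s s' t ∧ t ≤ T ∧ Q s'

theorem Reaches.of_loopFree {p : Program} (hp : p.LoopFree) {s : Mem} {Q : Mem → Prop}
    (h : Q (p.eval s)) : Reaches p s p.maxCost Q := by
  obtain ⟨t, ht, he⟩ := FreeExec.of_loopFree hp s
  exact ⟨_, t, he, ht, h⟩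

theorem Reaches.seq {p q : Program} {s : Mem} {T₁ T₂ : ℕ} {Q R : Mem → Prop}
    (hp : Reaches p s T₁ Q) (hq : ∀ s', Q s' → Reaches q s' T₂ R) :
    Reaches (.seq p q) s (T₁ + T₂) R := by
  obtain ⟨s₁, t₁, h₁, l₁, hQ⟩ := hp
  obtain ⟨s₂, t₂, h₂, l₂, hR⟩ := hq s₁ hQ
  exact ⟨s₂, _, .seq h₁ h₂, Nat.add_le_add l₁ l₂, hR⟩

theorem Reaches.mono {p : Program} {s : Mem} {T T' : ℕ} {Q R : Mem → Prop}
    (h : Reaches p s T Q) (hT : T ≤ T') (hQ : ∀ s', Q s' → R s') : Reaches p s T' R := by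
  obtain ⟨s₁, t₁, h₁, l₁, hQ'⟩ := h
  exact ⟨s₁, t₁, h₁, l₁.trans hT, hQ s₁ hQ'⟩

/-- The rule for loops: an invariant, and a potential that decreases in every round. -/
theorem Reaches.whileLt {e f : WordTerm} {p : Program} (hp : p.LoopFree) (Inv : Mem → Prop)
    (Φ : Mem → ℕ)
    (hstep : ∀ s, Inv s → e.eval s < f.eval s → Inv (p.eval s) ∧ Φ (p.eval s) < Φ s)
    {s : Mem} (hs : Inv s) :
    Reaches (.whileLt e f p) s ((Φ s + 1) * (1 + e.cost + f.cost + p.maxCost))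
      (fun s' => Inv s' ∧ ¬ e.eval s' < f.eval s') := by
  induction hk : Φ s using Nat.strong_induction_on generalizing s with
  | _ k ih =>
    by_cases h : e.eval s < f.eval s
    · obtain ⟨h₁, h₂⟩ := hstep s hs h
      obtain ⟨s', t, he, ht, hQ⟩ := ih _ (hk ▸ h₂) h₁ rfl
      obtain ⟨t₁, ht₁, he₁⟩ := FreeExec.of_loopFree hp s
      refine ⟨s', _, .whileTrue h he₁ he, ?_, hQ⟩
      have h₃ : Φ (p.eval s) + 1 ≤ k := by omega
      have := Nat.mul_le_mul_right (1 + e.cost + f.cost + p.maxCost) h₃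
      rw [Nat.add_mul k]
      omega
    · refine ⟨s, _, .whileFalse h, ?_, hs, h⟩
      nlinarith [Nat.zero_le (k * (1 + e.cost + f.cost + p.maxCost))]

/-! ### Frame conditions -/

/-- Some instruction of the program writes to array `a`. -/
def Program.WritesArr (a : ℕ) : Program → Prop
  | .skip => False
  | .set _ _ => False
  | .write b _ _ => a = b
  | .seq p q => p.WritesArr a ∨ q.WritesArr a
  | .ifLt _ _ p q => p.WritesArr a ∨ q.WritesArr a
  | .whileLt _ _ p => p.WritesArr a

/-- Some instruction of the program sets register `r`. -/
def Program.SetsReg (r : ℕ) : Program → Prop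
  | .skip => False
  | .set r' _ => r = r'
  | .write _ _ _ => False
  | .seq p q => p.SetsReg r ∨ q.SetsReg r
  | .ifLt _ _ p q => p.SetsReg r ∨ q.SetsReg r
  | .whileLt _ _ p => p.SetsReg r

theorem FreeExec.arr_eq {p : Program} {s s' : Mem} {t a : ℕ} (h : FreeExec p s s' t)
    (ha : ¬ p.WritesArr a) : s'.arr a = s.arr a := by
  induction h with
  | skip => rfl
  | set => rfl
  | write s b i e => exact Function.update_of_ne ha _ _
  | seq _ _ ih₁ ih₂ =>
    rw [ih₂ fun h => ha (Or.inr h), ih₁ fun h => ha (Or.inl h)]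
  | ifTrue _ _ ih => exact ih fun h => ha (Or.inl h)
  | ifFalse _ _ ih => exact ih fun h => ha (Or.inr h)
  | whileTrue _ _ _ ih₁ ih₂ => rw [ih₂ ha, ih₁ ha]
  | whileFalse => rfl

theorem FreeExec.reg_eq {p : Program} {s s' : Mem} {t r : ℕ} (h : FreeExec p s s' t)
    (hr : ¬ p.SetsReg r) : s'.reg r = s.reg r := by
  induction h with
  | skip => rfl
  | set s r' e => exact Function.update_of_ne hr _ _
  | write => rfl
  | seq _ _ ih₁ ih₂ =>
    rw [ih₂ fun h => hr (Or.inr h), ih₁ fun h => hr (Or.inl h)]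
  | ifTrue _ _ ih => exact ih fun h => hr (Or.inl h)
  | ifFalse _ _ ih => exact ih fun h => hr (Or.inr h)
  | whileTrue _ _ _ ih₁ ih₂ => rw [ih₂ hr, ih₁ hr]
  | whileFalse => rfl

/-- What `p` reaches, it reaches with all arrays and registers unchanged that it does not name
as targets. -/
theorem Reaches.frame {p : Program} {s : Mem} {T : ℕ} {Q : Mem → Prop} (h : Reaches p s T Q) :
    Reaches p s T (fun s' => Q s' ∧ (∀ a, ¬ p.WritesArr a → s'.arr a = s.arr a) ∧
      ∀ r, ¬ p.SetsReg r → s'.reg r = s.reg r) := by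
  obtain ⟨s', t, h₁, h₂, h₃⟩ := h
  exact ⟨s', t, h₁, h₂, h₃, fun _ => h₁.arr_eq, fun _ => h₁.reg_eq⟩

/-! ### Word bounds from running times -/

/-- All words in memory are at most `B`. -/
def Mem.Bounded (B : ℕ) (s : Mem) : Prop :=
  (∀ r, s.reg r ≤ B) ∧ ∀ a i, s.arr a i ≤ B

/-- Terms whose value exceeds the largest word in memory by at most one. -/
def WordTerm.Slow : WordTerm → Prop
  | .const c => c ≤ 1
  | .reg _ => True
  | .read _ _ => True
  | .bin .add (.reg _) (.const c) => c ≤ 1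
  | .bin .add (.read _ _) (.const c) => c ≤ 1
  | .bin .add _ _ => False
  | .bin .sub e _ => e.Slow
  | .bin .mul _ _ => False
  | .bin .div e _ => e.Slow

theorem WordTerm.Slow.eval_le {e : WordTerm} (he : e.Slow) {B : ℕ} {s : Mem}
    (hs : s.Bounded B) : e.eval s ≤ B + 1 := by
  induction e with
  | const c => exact le_trans he (Nat.le_add_left 1 B)
  | reg r => exact (hs.1 r).trans (Nat.le_succ B)
  | read a i => exact (hs.2 a _).trans (Nat.le_succ B)
  | bin o e f ihe _ =>
    cases o with
    | add =>
      cases f with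
      | const c =>
        cases e with
        | reg r => exact Nat.add_le_add (hs.1 r) he
        | read a i => exact Nat.add_le_add (hs.2 a _) he
        | const => exact he.elim
        | bin => exact he.elim
      | reg => cases e <;> exact he.elim
      | read => cases e <;> exact he.elim
      | bin => cases e <;> exact he.elim
    | sub => exact (Nat.sub_le _ _).trans (ihe he)
    | mul => exact he.elim
    | div => exact (Nat.div_le_self _ _).trans (ihe he)

/-- A degree bound for the values that occur in the evaluation of a term: see
`WordTerm.fits_of_bounded`. -/
def WordTerm.deg : WordTerm → ℕ
  | .const c => c + 1
  | .reg _ => 1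
  | .read _ i => i.deg + 1
  | .bin _ e f => e.deg + f.deg + 1

theorem WordTerm.Fits.mono {e : WordTerm} {W W' : ℕ} {s : Mem} (h : W ≤ W')
    (he : e.Fits W s) : e.Fits W' s := by
  induction e with
  | const c => exact lt_of_lt_of_le he h
  | reg r => exact lt_of_lt_of_le he h
  | read a i ih => exact ⟨ih he.1, lt_of_lt_of_le he.2 h⟩
  | bin o e f ihe ihf => exact ⟨ihe he.1, ihf he.2.1, lt_of_lt_of_le he.2.2 h⟩

theorem WordTerm.fits_of_bounded (e : WordTerm) {B : ℕ} {s : Mem} (hs : s.Bounded B) :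
    e.Fits ((B + 2) ^ e.deg) s ∧ e.eval s < (B + 2) ^ e.deg := by
  have hpos : 0 < B + 2 := by omega
  induction e with
  | const c =>
    have : c < (B + 2) ^ (c + 1) :=
      (Nat.lt_pow_self (by omega : 1 < B + 2)).trans_le (Nat.pow_le_pow_right hpos (Nat.le_succ c))
    exact ⟨this, this⟩
  | reg r =>
    have : s.reg r < (B + 2) ^ 1 := by have := hs.1 r; rw [pow_one]; omega
    exact ⟨this, this⟩
  | read a i ih =>
    have h₁ : s.arr a (i.eval s) < (B + 2) ^ (i.deg + 1) :=
      lt_of_lt_of_le (by have := hs.2 a (i.eval s); rw [pow_one]; omega : _ < (B + 2) ^ 1)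
        (Nat.pow_le_pow_right hpos (by omega))
    exact ⟨⟨ih.1.mono (Nat.pow_le_pow_right hpos (Nat.le_succ _)), h₁⟩, h₁⟩
  | bin o e f ihe ihf =>
    have he : (B + 2) ^ e.deg ≤ (B + 2) ^ (e.deg + f.deg + 1) :=
      Nat.pow_le_pow_right hpos (by omega)
    have hf : (B + 2) ^ f.deg ≤ (B + 2) ^ (e.deg + f.deg + 1) :=
      Nat.pow_le_pow_right hpos (by omega)
    have key : o.eval (e.eval s) (f.eval s) < (B + 2) ^ (e.deg + f.deg + 1) := by
      cases o with
      | add =>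
        have h₁ : (B + 2) ^ e.deg ≤ (B + 2) ^ (e.deg + f.deg) :=
          Nat.pow_le_pow_right hpos (by omega)
        have h₂ : (B + 2) ^ f.deg ≤ (B + 2) ^ (e.deg + f.deg) :=
          Nat.pow_le_pow_right hpos (by omega)
        have h₃ : (B + 2) ^ (e.deg + f.deg + 1) = (B + 2) ^ (e.deg + f.deg) * (B + 2) :=
          pow_succ _ _
        have h₄ : (B + 2) ^ (e.deg + f.deg) * 2 ≤ (B + 2) ^ (e.deg + f.deg) * (B + 2) :=
          Nat.mul_le_mul_left _ (by omega)
        have := ihe.2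
        have := ihf.2
        simp only [WordOp.eval]
        omega
      | sub => exact lt_of_le_of_lt (Nat.sub_le _ _) (ihe.2.trans_le he)
      | mul =>
        have h₁ : e.eval s * f.eval s < (B + 2) ^ e.deg * (B + 2) ^ f.deg :=
          Nat.mul_lt_mul'' ihe.2 ihf.2
        rw [← pow_add] at h₁
        exact h₁.trans_le (Nat.pow_le_pow_right hpos (Nat.le_succ _))
      | div => exact lt_of_le_of_lt (Nat.div_le_self _ _) (ihe.2.trans_le he)
    exact ⟨⟨ihe.1.mono he, ihf.1.mono hf, key⟩, key⟩

/-- Only slow terms are stored; terms that serve as addresses or in tests are arbitrary. -/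
def Program.Slow : Program → Prop
  | .skip => True
  | .set _ e => e.Slow
  | .write _ _ e => e.Slow
  | .seq p q => p.Slow ∧ q.Slow
  | .ifLt _ _ p q => p.Slow ∧ q.Slow
  | .whileLt _ _ p => p.Slow

/-- The largest degree of a term in the program. -/
def Program.deg : Program → ℕ
  | .skip => 0
  | .set _ e => e.deg
  | .write _ i e => max i.deg e.deg
  | .seq p q => max p.deg q.deg
  | .ifLt e f p q => max (max e.deg f.deg) (max p.deg q.deg)
  | .whileLt e f p => max (max e.deg f.deg) p.deg

theorem Mem.Bounded.mono {B B' : ℕ} {s : Mem} (hs : s.Bounded B) (h : B ≤ B') : s.Bounded B' :=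
  ⟨fun r => (hs.1 r).trans h, fun a i => (hs.2 a i).trans h⟩

/-- A slow program that runs for `t` steps needs only words polynomial in `t` and in the words of
the initial memory, since each step raises the largest word in memory by at most one. -/
theorem FreeExec.exec {p : Program} {s s' : Mem} {t : ℕ} (h : FreeExec p s s' t)
    (hp : p.Slow) {B D d W : ℕ} (hs : s.Bounded B) (hD : B + t ≤ D) (hd : p.deg ≤ d)
    (hW : (D + 2) ^ d ≤ W) : Exec W p s s' t ∧ s'.Bounded (B + t) := by
  have fits : ∀ (e : WordTerm) (s : Mem), e.deg ≤ d → s.Bounded D → e.Fits W s :=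
    fun e s he hb => (e.fits_of_bounded hb).1.mono
      ((Nat.pow_le_pow_right (by omega) he).trans hW)
  induction h generalizing B with
  | skip s => exact ⟨.skip s, hs.mono (by omega)⟩
  | set s r e =>
    refine ⟨.set s r e (fits e s hd (hs.mono (by omega))), fun r' => ?_, fun a i => ?_⟩
    · have h₁ := hp.eval_le hs
      have h₂ := hs.1 r'
      by_cases hr : r' = r
      · subst hr; simp only [Function.update_self]; omega
      · simp only [Function.update_of_ne hr]; omega
    · have := hs.2 a i; simp only; omega
  | write s a i e =>
    have hd' : max i.deg e.deg ≤ d := hd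
    refine ⟨.write s a i e (fits i s (by omega) (hs.mono (by omega)))
      (fits e s (by omega) (hs.mono (by omega))), fun r => ?_, fun b j => ?_⟩
    · have := hs.1 r; simp only; omega
    · have h₁ := hp.eval_le hs
      have h₂ := hs.2 b j
      have h₃ := hs.2 a j
      by_cases hb : b = a
      · subst hb
        by_cases hj : j = i.eval s
        · subst hj; simp only [Function.update_self]; omega
        · simp only [Function.update_self, Function.update_of_ne hj]; omega
      · simp only [Function.update_of_ne hb]; omega
  | @seq p q _ _ _ _ _ _ _ ih₁ ih₂ =>
    have hd' : max p.deg q.deg ≤ d := hd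
    obtain ⟨h₁, b₁⟩ := ih₁ hp.1 hs (by omega) (by omega)
    obtain ⟨h₂, b₂⟩ := ih₂ hp.2 b₁ (by omega) (by omega)
    exact ⟨.seq h₁ h₂, b₂.mono (by omega)⟩
  | @ifTrue e f p q s _ _ h _ ih =>
    have hd' : max (max e.deg f.deg) (max p.deg q.deg) ≤ d := hd
    obtain ⟨h₁, b₁⟩ := ih hp.1 hs (by omega) (by omega)
    exact ⟨.ifTrue (fits e s (by omega) (hs.mono (by omega)))
      (fits f s (by omega) (hs.mono (by omega))) h h₁, b₁.mono (by omega)⟩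
  | @ifFalse e f p q s _ _ h _ ih =>
    have hd' : max (max e.deg f.deg) (max p.deg q.deg) ≤ d := hd
    obtain ⟨h₁, b₁⟩ := ih hp.2 hs (by omega) (by omega)
    exact ⟨.ifFalse (fits e s (by omega) (hs.mono (by omega)))
      (fits f s (by omega) (hs.mono (by omega))) h h₁, b₁.mono (by omega)⟩
  | @whileTrue e f p s _ _ _ _ h _ _ ih₁ ih₂ =>
    have hd' : max (max e.deg f.deg) p.deg ≤ d := hd
    obtain ⟨h₁, b₁⟩ := ih₁ hp hs (by omega) (by omega)
    obtain ⟨h₂, b₂⟩ := ih₂ hp b₁ (by omega) hd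
    exact ⟨.whileTrue (fits e s (by omega) (hs.mono (by omega)))
      (fits f s (by omega) (hs.mono (by omega))) h h₁ h₂, b₂.mono (by omega)⟩
  | @whileFalse e f p s h =>
    have hd' : max (max e.deg f.deg) p.deg ≤ d := hd
    exact ⟨.whileFalse (fits e s (by omega) (hs.mono (by omega)))
      (fits f s (by omega) (hs.mono (by omega))) h, hs.mono (by omega)⟩

/-- A slow program with quadratic running time needs only words of polynomial size. -/
theorem Reaches.exists_exec {p : Program} (hp : p.Slow) {n a b : ℕ} (hn : 0 < n) {s : Mem}
    {T : ℕ} {Q : Mem → Prop} (h : Reaches p s T Q) (hs : s.Bounded ((n + 1) ^ a))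
    (hT : T ≤ b * n ^ 2) {C : ℕ} (hC : (a + b + 5) * p.deg + b ≤ C) :
    ∃ s' t, Exec ((n + 1) ^ C) p s s' t ∧ t ≤ C * n ^ 2 ∧ Q s' := by
  obtain ⟨s', t, h₁, h₂, h₃⟩ := h
  have ht : t ≤ b * n ^ 2 := h₂.trans hT
  refine ⟨s', t, (h₁.exec hp hs le_rfl le_rfl ?_).1,
    ht.trans (Nat.mul_le_mul_right _ (by omega)), h₃⟩
  have h₄ : (n + 1) ^ a + t + 2 ≤ (n + 1) ^ (a + b + 5) := by
    have e₁ : (n + 1) ^ a ≤ (n + 1) ^ (a + b + 2) := Nat.pow_le_pow_right (by omega) (by omega)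
    have e₂ : t ≤ (n + 1) ^ (a + b + 2) := calc
      t ≤ b * n ^ 2 := ht
      _ ≤ (n + 1) ^ b * (n + 1) ^ 2 := Nat.mul_le_mul
        ((Nat.lt_pow_self (by omega)).le) (Nat.pow_le_pow_left (by omega) 2)
      _ = (n + 1) ^ (b + 2) := (pow_add _ _ _).symm
      _ ≤ _ := Nat.pow_le_pow_right (by omega) (by omega)
    have e₃ : 1 ≤ (n + 1) ^ (a + b + 2) := Nat.one_le_pow _ _ (by omega)
    have e₄ : 2 ^ 3 ≤ (n + 1) ^ 3 := Nat.pow_le_pow_left (by omega) 3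
    have e₅ : (n + 1) ^ (a + b + 5) = (n + 1) ^ (a + b + 2) * (n + 1) ^ 3 := by rw [← pow_add]
    nlinarith
  calc ((n + 1) ^ a + t + 2) ^ p.deg ≤ ((n + 1) ^ (a + b + 5)) ^ p.deg := Nat.pow_le_pow_left h₄ _
    _ = (n + 1) ^ ((a + b + 5) * p.deg) := (pow_mul _ _ _).symm
    _ ≤ _ := Nat.pow_le_pow_right (by omega) (by omega)

/-! ### Preference lists as tables of numbers -/

/-- Preference lists of the agents `0, …, n - 1`, as an algorithm sees them: `ent u i` is the
`i`-th entry of the list of `u`, for `i < len u`, and `rk u v` is the position of `v` in it. -/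
structure Prefs where
  n : ℕ
  len : ℕ → ℕ
  ent : ℕ → ℕ → ℕ
  rk : ℕ → ℕ → ℕ

/-- The lists have no repetitions, positions are correct, and acceptability is mutual. -/
structure Prefs.Valid (P : Prefs) : Prop where
  ent_lt : ∀ {u i}, u < P.n → i < P.len u → P.ent u i < P.n
  len_le : ∀ {u}, u < P.n → P.len u ≤ P.n
  rk_ent : ∀ {u i}, u < P.n → i < P.len u → P.rk u (P.ent u i) = i
  rk_lt : ∀ {u i}, u < P.n → i < P.len u → P.rk (P.ent u i) u < P.len (P.ent u i)
  ent_rk : ∀ {u i}, u < P.n → i < P.len u → P.ent (P.ent u i) (P.rk (P.ent u i) u) = u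

section Tables

variable {P : Prefs}

theorem Prefs.Valid.ent_inj (hP : P.Valid) {u i j : ℕ} (hu : u < P.n) (hi : i < P.len u)
    (hj : j < P.len u) (h : P.ent u i = P.ent u j) : i = j := by
  rw [← hP.rk_ent hu hi, h, hP.rk_ent hu hj]

/-- The first entry of the list of `u` that the cursor `fst` points at. -/
abbrev Prefs.first (P : Prefs) (fst : ℕ → ℕ) (u : ℕ) : ℕ := P.ent u (fst u)

/-- The last entry of the list of `u` when it is cut off at length `lim u`. -/
abbrev Prefs.last (P : Prefs) (lim : ℕ → ℕ) (u : ℕ) : ℕ := P.ent u (lim u - 1)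

/-- With the list of each `v` cut off at length `lim v`, the entry `i` of `u` is dead if `u` is
missing in the list of that entry. -/
abbrev Prefs.Dead (P : Prefs) (lim : ℕ → ℕ) (u i : ℕ) : Prop :=
  lim (P.ent u i) ≤ P.rk (P.ent u i) u

/-- The state of the table when all proposals are settled: every list is either exhausted, and
then has never been cut off, or it has a first live entry, who has `u` as her last entry. -/
structure Prefs.IsTable (P : Prefs) (fst lim : ℕ → ℕ) : Prop where
  lim_le : ∀ {u}, u < P.n → lim u ≤ P.len u
  dead_before : ∀ {u i}, u < P.n → i < fst u → i < P.len u → P.Dead lim u i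
  settled : ∀ {u}, u < P.n → (lim u ≤ fst u ∧ lim u = P.len u) ∨
    (fst u < lim u ∧ P.rk (P.first fst u) u + 1 = lim (P.first fst u))

namespace Prefs.IsTable

variable {fst lim : ℕ → ℕ}

theorem rk_first (hT : P.IsTable fst lim) {u : ℕ} (hu : u < P.n) (h : fst u < lim u) :
    P.rk (P.first fst u) u + 1 = lim (P.first fst u) :=
  (hT.settled hu).elim (fun h' => absurd h (not_lt.2 h'.1)) And.right

theorem lt_len (hT : P.IsTable fst lim) {u i : ℕ} (hu : u < P.n) (h : i < lim u) : i < P.len u :=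
  h.trans_le (hT.lim_le hu)

theorem first_lt (hT : P.IsTable fst lim) (hP : P.Valid) {u : ℕ} (hu : u < P.n)
    (h : fst u < lim u) : P.first fst u < P.n :=
  hP.ent_lt hu (hT.lt_len hu h)

/-- The entry of a live pair is at or after the cursor, on either side. -/
theorem fst_le_rk (hT : P.IsTable fst lim) (hP : P.Valid) {u i : ℕ} (hu : u < P.n)
    (hi : i < lim u) : fst (P.ent u i) ≤ P.rk (P.ent u i) u := by
  by_contra! h
  have hi' := hT.lt_len hu hi
  have := hT.dead_before (hP.ent_lt hu hi') h (hP.rk_lt hu hi')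
  rw [Prefs.Dead, hP.ent_rk hu hi', hP.rk_ent hu hi'] at this
  omega

theorem fst_le (hT : P.IsTable fst lim) {u i : ℕ} (hu : u < P.n)
    (hi : i < lim u) (h : ¬ P.Dead lim u i) : fst u ≤ i := by
  by_contra! h'
  exact h (hT.dead_before hu h' (hT.lt_len hu hi))

theorem first_active (hT : P.IsTable fst lim) (hP : P.Valid) {u : ℕ} (hu : u < P.n)
    (h : fst u < lim u) : fst (P.first fst u) < lim (P.first fst u) := by
  have := hT.fst_le_rk hP hu h
  have := hT.rk_first hu h
  simp only [Prefs.first] at *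
  omega

theorem last_first (hT : P.IsTable fst lim) (hP : P.Valid) {u : ℕ} (hu : u < P.n)
    (h : fst u < lim u) : P.last lim (P.first fst u) = u := by
  have h₁ := hP.ent_rk hu (hT.lt_len hu h)
  have h₂ := hT.rk_first hu h
  rw [Prefs.last, ← h₂]
  exact h₁

theorem first_inj (hT : P.IsTable fst lim) (hP : P.Valid) {u v : ℕ} (hu : u < P.n)
    (hv : v < P.n) (h : fst u < lim u) (h' : fst v < lim v)
    (he : P.first fst u = P.first fst v) : u = v := by
  rw [← hT.last_first hP hu h, he, hT.last_first hP hv h']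

/-- Among the agents with non-empty lists, `first` is injective, hence surjective. -/
theorem exists_first (hT : P.IsTable fst lim) (hP : P.Valid) {v : ℕ} (hv : v < P.n)
    (h : fst v < lim v) : ∃ u, u < P.n ∧ fst u < lim u ∧ P.first fst u = v := by
  have hmaps : ∀ u ∈ (range P.n).filter (fun u => fst u < lim u),
      P.first fst u ∈ (range P.n).filter (fun u => fst u < lim u) := by
    intro u hu
    simp only [mem_filter, mem_range] at hu ⊢
    exact ⟨hT.first_lt hP hu.1 hu.2, hT.first_active hP hu.1 hu.2⟩
  have hinj : Set.InjOn (P.first fst) ((range P.n).filter (fun u => fst u < lim u)) := by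
    intro u hu w hw he
    simp only [coe_filter, mem_range, Set.mem_ofPred_eq] at hu hw
    exact hT.first_inj hP hu.1 hw.1 hu.2 hw.2 he
  obtain ⟨u, hu, rfl⟩ := surjOn_of_injOn_of_card_le _ hmaps hinj le_rfl
    (by simpa using ⟨hv, h⟩ : v ∈ ((range P.n).filter (fun u => fst u < lim u) : Set ℕ))
  simp only [coe_filter, mem_range, Set.mem_ofPred_eq] at hu
  exact ⟨u, hu.1, hu.2, rfl⟩

theorem last_spec (hT : P.IsTable fst lim) (hP : P.Valid) {v : ℕ} (hv : v < P.n)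
    (h : fst v < lim v) : P.last lim v < P.n ∧ fst (P.last lim v) < lim (P.last lim v) ∧
      P.first fst (P.last lim v) = v := by
  obtain ⟨u, hu, hu', rfl⟩ := hT.exists_first hP hv h
  rw [hT.last_first hP hu hu']
  exact ⟨hu, hu', rfl⟩

theorem not_dead_first (hT : P.IsTable fst lim) {u : ℕ} (hu : u < P.n)
    (h : fst u < lim u) : ¬ P.Dead lim u (fst u) := by
  have := hT.rk_first hu h
  simp only [Prefs.Dead, Prefs.first] at *
  omega

theorem not_dead_last (hT : P.IsTable fst lim) (hP : P.Valid) {u : ℕ} (hu : u < P.n)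
    (h : fst u < lim u) : ¬ P.Dead lim u (lim u - 1) := by
  obtain ⟨h₁, h₂, h₃⟩ := hT.last_spec hP hu h
  have h₄ := hP.rk_ent h₁ (hT.lt_len h₁ h₂)
  change P.rk _ (P.first fst _) = _ at h₄
  rw [h₃] at h₄
  change ¬ lim (P.last lim u) ≤ P.rk (P.last lim u) u
  omega

end Prefs.IsTable

/-! ### Proposals -/

/-- The invariant of the proposal phase: all agents below `nx` other than `cur` are settled. An
agent `y` whose list has been cut off holds a proposal of her last entry. -/
structure Prefs.ProposalInv (P : Prefs) (fst lim : ℕ → ℕ) (cur nx : ℕ) : Prop where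
  lim_le : ∀ {u}, u < P.n → lim u ≤ P.len u
  dead_before : ∀ {u i}, u < P.n → i < fst u → i < P.len u → P.Dead lim u i
  held : ∀ {y}, y < P.n → lim y = P.len y ∨ (0 < lim y ∧
    fst (P.last lim y) < lim (P.last lim y) ∧ P.first fst (P.last lim y) = y)
  settled : ∀ {u}, u < P.n → u < nx → u ≠ cur → fst u < lim u →
    P.rk (P.first fst u) u + 1 = lim (P.first fst u)
  cur_lt : cur < P.n → nx ≤ P.n
  le_of_cur : P.n ≤ cur → P.n ≤ nx

namespace Prefs.ProposalInv

variable {fst lim : ℕ → ℕ} {cur nx : ℕ}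

theorem init : P.ProposalInv (fun _ => 0) P.len 0 1 where
  lim_le _ := le_rfl
  dead_before _ h := absurd h (Nat.not_lt_zero _)
  held _ := Or.inl rfl
  settled _ h₁ h₂ := absurd h₁ (by omega)
  cur_lt := id
  le_of_cur h := by omega

theorem next (h : P.ProposalInv fst lim cur nx) (hc : cur < P.n)
    (hs : fst cur < lim cur → P.rk (P.first fst cur) cur + 1 = lim (P.first fst cur)) :
    P.ProposalInv fst lim nx (nx + 1) where
  lim_le := h.lim_le
  dead_before := h.dead_before
  held := h.held
  settled {u} hu hn hne hf := by
    rcases eq_or_ne u cur with rfl | hu'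
    · exact hs hf
    · exact h.settled hu (by omega) hu' hf
  cur_lt h' := h'
  le_of_cur h' := by omega

theorem reject (h : P.ProposalInv fst lim cur nx) (hP : P.Valid) (hc : cur < P.n)
    (hf : fst cur < lim cur) (hd : P.Dead lim cur (fst cur)) :
    P.ProposalInv (Function.update fst cur (fst cur + 1)) lim cur nx where
  lim_le := h.lim_le
  dead_before {u i} hu hi hl := by
    rcases eq_or_ne u cur with rfl | hu'
    · rw [Function.update_self] at hi
      rcases Nat.lt_succ_iff_lt_or_eq.1 hi with hi | rfl
      · exact h.dead_before hu hi hl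
      · exact hd
    · rw [Function.update_of_ne hu'] at hi
      exact h.dead_before hu hi hl
  held {y} hy := by
    rcases h.held hy with h₁ | ⟨h₁, h₂, h₃⟩
    · exact Or.inl h₁
    · refine Or.inr ⟨h₁, ?_⟩
      have hne : P.last lim y ≠ cur := by
        intro he
        have hlt : lim y - 1 < P.len y := by have := h.lim_le hy; omega
        have h₄ : P.rk y (P.last lim y) = lim y - 1 := hP.rk_ent hy hlt
        rw [he] at h₃ h₄
        simp only [Prefs.Dead, Prefs.first] at hd h₃
        rw [h₃, h₄] at hd
        omega
      simp only [Prefs.first, Function.update_of_ne hne]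
      exact ⟨h₂, h₃⟩
  settled {u} hu hn hne := by
    simp only [Prefs.first, Function.update_of_ne hne]
    exact h.settled hu hn hne
  cur_lt := h.cur_lt
  le_of_cur := h.le_of_cur

theorem accept (h : P.ProposalInv fst lim cur nx) (hP : P.Valid) (hc : cur < P.n)
    (hf : fst cur < lim cur) (hr : P.rk (P.first fst cur) cur + 1 < lim (P.first fst cur)) :
    P.ProposalInv fst
      (Function.update lim (P.first fst cur) (P.rk (P.first fst cur) cur + 1))
      (P.last lim (P.first fst cur)) nx := by
  obtain ⟨y, hy⟩ : ∃ y, y = P.first fst cur := ⟨_, rfl⟩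
  rw [← hy] at hr ⊢
  have hlen : fst cur < P.len cur := hf.trans_le (h.lim_le hc)
  have hyn : y < P.n := hy ▸ hP.ent_lt hc hlen
  have hyl : lim y ≤ P.len y := h.lim_le hyn
  have hyc : P.ent y (P.rk y cur) = cur := hy ▸ hP.ent_rk hc hlen
  have hcy : P.rk cur y = fst cur := hy ▸ hP.rk_ent hc hlen
  have hle : ∀ v, Function.update lim y (P.rk y cur + 1) v ≤ lim v := by
    intro v
    rcases eq_or_ne v y with rfl | hv
    · rw [Function.update_self]; exact hr.le
    · rw [Function.update_of_ne hv]
  -- the entry `cur` of `y` is live, so the cursor of `y` has not passed it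
  have hact : ∀ v, fst v < lim v → fst v < Function.update lim y (P.rk y cur + 1) v := by
    intro v hv
    rcases eq_or_ne v y with rfl | hne
    · rw [Function.update_self]
      by_contra! hlt
      have := h.dead_before hyn (Nat.lt_of_succ_le hlt) (by omega)
      rw [Prefs.Dead, hyc, hcy] at this
      omega
    · rwa [Function.update_of_ne hne]
  refine ⟨fun hu => (hle _).trans (h.lim_le hu),
    fun hu hi hl => (hle _).trans (h.dead_before hu hi hl), fun {v} hv => ?_,
    fun {u} hu hn hne hf' => ?_, fun _ => h.cur_lt hc, fun hl => ?_⟩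
  · rcases eq_or_ne v y with rfl | hne
    · right
      have : P.last (Function.update lim v (P.rk v cur + 1)) v = cur := by
        rw [Prefs.last, Function.update_self]
        exact hyc
      rw [this, Function.update_self]
      exact ⟨Nat.succ_pos _, hact cur hf, hy.symm⟩
    · have : P.last (Function.update lim y (P.rk y cur + 1)) v = P.last lim v := by
        rw [Prefs.last, Function.update_of_ne hne]
      rw [this, Function.update_of_ne hne]
      exact (h.held hv).imp_right fun h' => ⟨h'.1, hact _ h'.2.1, h'.2.2⟩
  · have hf₀ := hf'.trans_le (hle u)
    rcases eq_or_ne u cur with rfl | hu'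
    · rw [← hy, Function.update_self]
    · have h₁ := h.settled hu hn hu' hf₀
      rcases eq_or_ne (P.first fst u) y with he | he
      · refine absurd ?_ hne
        rw [he] at h₁
        rw [Prefs.last, ← h₁, Nat.add_sub_cancel, ← he]
        exact (hP.ent_rk hu (hf₀.trans_le (h.lim_le hu))).symm
      · rwa [Function.update_of_ne he]
  · exact absurd (hP.ent_lt hyn (by omega : lim y - 1 < P.len y)) (not_lt.2 hl)

theorem isTable (h : P.ProposalInv fst lim cur nx) (hP : P.Valid) (hc : P.n ≤ cur) :
    P.IsTable fst lim where
  lim_le := h.lim_le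
  dead_before := h.dead_before
  settled {u} hu := by
    have hs := h.settled hu (hu.trans_le (h.le_of_cur hc)) (by omega)
    by_cases hf : fst u < lim u
    · exact Or.inr ⟨hf, hs hf⟩
    · refine Or.inl ⟨not_lt.1 hf, (h.held hu).resolve_right ?_⟩
      rintro ⟨h₁, h₂, h₃⟩
      -- an agent who holds a proposal has a live last entry, which the cursor cannot have passed
      have hlt : lim u - 1 < P.len u := by have := h.lim_le hu; omega
      have h₄ := h.dead_before hu (by omega : lim u - 1 < fst u) hlt
      have h₅ : P.last lim u < P.n := hP.ent_lt hu hlt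
      have h₆ := hP.rk_ent h₅ (h₂.trans_le (h.lim_le h₅))
      change P.rk _ (P.first fst _) = _ at h₆
      rw [h₃] at h₆
      change lim (P.last lim u) ≤ P.rk (P.last lim u) u at h₄
      omega

/-- Every step of the proposal phase decreases this potential. -/
def potential (P : Prefs) (fst lim : ℕ → ℕ) (nx : ℕ) : ℕ :=
  ∑ u ∈ range P.n, lim u + ∑ u ∈ range P.n, (P.n - fst u) + (P.n + 1 - nx)

end Prefs.ProposalInv

theorem sum_update_lt {n u a : ℕ} (f : ℕ → ℕ) (hu : u < n) (h : a < f u) :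
    ∑ v ∈ range n, Function.update f u a v + 1 ≤ ∑ v ∈ range n, f v := by
  refine Nat.succ_le_of_lt (sum_lt_sum (fun v _ => ?_) ⟨u, mem_range.2 hu, by simpa using h⟩)
  rcases eq_or_ne v u with rfl | hv
  · simpa using h.le
  · rw [Function.update_of_ne hv]

/-- Moving a cursor forward lowers the sum of the remaining lengths. -/
theorem sum_sub_update_lt {n u a : ℕ} (f : ℕ → ℕ) (hu : u < n) (h : f u < a) (h' : f u < n) :
    ∑ v ∈ range n, (n - Function.update f u a v) + 1 ≤ ∑ v ∈ range n, (n - f v) := by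
  refine Nat.succ_le_of_lt (sum_lt_sum (fun v _ => ?_) ⟨u, mem_range.2 hu, ?_⟩)
  · rcases eq_or_ne v u with rfl | hv
    · rw [Function.update_self]; omega
    · rw [Function.update_of_ne hv]
  · rw [Function.update_self]; omega

/-! ### Rotations -/

/-- The second entry of the list of `x`, at which the cursor `sec` points. -/
abbrev Prefs.second (P : Prefs) (sec : ℕ → ℕ) (x : ℕ) : ℕ := P.ent x (sec x)

/-- The successor of `x` in the search for a rotation: the last entry of the second entry. -/
abbrev Prefs.succ (P : Prefs) (lim sec : ℕ → ℕ) (x : ℕ) : ℕ := P.last lim (P.second sec x)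

/-- The cursor `sec` points at a live entry after the first one. -/
structure Prefs.HasSecond (P : Prefs) (fst lim sec : ℕ → ℕ) (x : ℕ) : Prop where
  fst_lt : fst x < sec x
  lt_lim : sec x < lim x
  live : ¬ P.Dead lim x (sec x)

/-- All entries strictly between the two cursors are dead. -/
def Prefs.SecOK (P : Prefs) (fst lim sec : ℕ → ℕ) : Prop :=
  ∀ {x i}, x < P.n → fst x < i → i < sec x → i < lim x → P.Dead lim x i

theorem Prefs.HasSecond.active {fst lim sec : ℕ → ℕ} {x : ℕ} (h : P.HasSecond fst lim sec x) :
    fst x < lim x :=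
  h.fst_lt.trans h.lt_lim

namespace Prefs.IsTable

variable {fst lim sec : ℕ → ℕ}

theorem second_lt (hT : P.IsTable fst lim) (hP : P.Valid) {x : ℕ} (hx : x < P.n)
    (h : P.HasSecond fst lim sec x) : P.second sec x < P.n :=
  hP.ent_lt hx (hT.lt_len hx h.lt_lim)

theorem second_active (hT : P.IsTable fst lim) (hP : P.Valid) {x : ℕ} (hx : x < P.n)
    (h : P.HasSecond fst lim sec x) : fst (P.second sec x) < lim (P.second sec x) :=
  (hT.fst_le_rk hP hx h.lt_lim).trans_lt (not_le.1 h.live)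

theorem ent_second_rk (hT : P.IsTable fst lim) (hP : P.Valid) {x : ℕ} (hx : x < P.n)
    (h : P.HasSecond fst lim sec x) :
    P.ent (P.second sec x) (P.rk (P.second sec x) x) = x :=
  hP.ent_rk hx (hT.lt_len hx h.lt_lim)

/-- The successor has again at least two live entries. -/
theorem succ_spec (hT : P.IsTable fst lim) (hP : P.Valid) {x : ℕ} (hx : x < P.n)
    (h : P.HasSecond fst lim sec x) :
    P.succ lim sec x < P.n ∧ fst (P.succ lim sec x) + 1 < lim (P.succ lim sec x) ∧
      P.first fst (P.succ lim sec x) = P.second sec x := by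
  have hy := hT.second_lt hP hx h
  obtain ⟨h₁, h₂, h₃⟩ := hT.last_spec hP hy (hT.second_active hP hx h)
  refine ⟨h₁, ?_, h₃⟩
  by_contra hlim
  set y := P.second sec x with hydef
  set w := P.last lim y with hwdef
  have hlim' : lim w ≤ fst w + 1 := not_lt.1 hlim
  -- otherwise `w` and `y` are each other's only live entries, but `x` is live for `y`
  have h₄ : P.last lim w = y := by
    rw [Prefs.last, show lim w - 1 = fst w by omega]
    exact h₃
  obtain ⟨-, h₅, h₆⟩ := hT.last_spec hP h₁ h₂
  rw [h₄] at h₅ h₆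
  have h₇ : P.rk y w = fst y := h₆ ▸ hP.rk_ent hy (hT.lt_len hy h₅)
  have h₈ : P.rk y w = lim y - 1 := hP.rk_ent hy (hT.lt_len hy (by omega))
  have h₉ := hT.fst_le_rk hP hx h.lt_lim
  have h₁₀ := not_le.1 h.live
  change fst y ≤ P.rk y x at h₉
  change P.rk y x < lim y at h₁₀
  have h₁₁ : P.rk y x = fst y := by omega
  have h₁₂ := hT.ent_second_rk hP hx h
  rw [← hydef, h₁₁] at h₁₂
  change P.first fst y = x at h₁₂
  have h₁₃ : w = x := by rw [← h₁₂]; exact h₆.symm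
  rw [h₁₃] at h₃
  have := hP.ent_inj hx (hT.lt_len hx h.active) (hT.lt_len hx h.lt_lim) h₃
  have := h.fst_lt
  omega

/-- Two live entries are enough for the scan for the second one to stop in time. -/
theorem sec_lt_lim (hT : P.IsTable fst lim) (hP : P.Valid) (hS : P.SecOK fst lim sec) {x : ℕ}
    (hx : x < P.n) (h : fst x + 1 < lim x) : sec x < lim x := by
  by_contra! h'
  exact hT.not_dead_last hP hx (by omega) (hS hx (by omega) (by omega) (by omega))

end Prefs.IsTable

/-- The path `stk 0, …, stk (m - 1)`, along which each agent is followed by her successor, closes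
up with the successor `stk i` of its end. Its first agent has at least three live entries. -/
structure Prefs.Lasso (P : Prefs) (fst lim sec stk : ℕ → ℕ) (i m : ℕ) : Prop where
  table : P.IsTable fst lim
  secOK : P.SecOK fst lim sec
  lt : i < m
  mem : ∀ {j}, j < m → stk j < P.n
  inj : ∀ {j k}, j < m → k < m → stk j = stk k → j = k
  hasSecond : ∀ {j}, j < m → P.HasSecond fst lim sec (stk j)
  link : ∀ {j}, j + 1 < m → stk (j + 1) = P.succ lim sec (stk j)
  close : P.succ lim sec (stk (m - 1)) = stk i
  long : sec (stk 0) + 1 < lim (stk 0)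

namespace Prefs.Lasso

variable {fst lim sec stk : ℕ → ℕ} {i m : ℕ}

/-- The walk along the path and then round and round the cycle. -/
def walk (P : Prefs) (lim sec : ℕ → ℕ) (x : ℕ) (t : ℕ) : ℕ := (P.succ lim sec)^[t] x

theorem walk_succ (x t : ℕ) :
    walk P lim sec x (t + 1) = P.succ lim sec (walk P lim sec x t) :=
  Function.iterate_succ_apply' _ _ _

theorem walk_eq (h : P.Lasso fst lim sec stk i m) {j : ℕ} (hj : j < m) :
    walk P lim sec (stk 0) j = stk j := by
  induction j with
  | zero => rfl
  | succ j ih => rw [walk_succ, ih (by omega), h.link hj]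

theorem walk_mem (h : P.Lasso fst lim sec stk i m) (t : ℕ) :
    ∃ j < m, walk P lim sec (stk 0) t = stk j := by
  induction t with
  | zero => exact ⟨0, by have := h.lt; omega, rfl⟩
  | succ t ih =>
    obtain ⟨j, hj, he⟩ := ih
    rw [walk_succ, he]
    rcases Nat.lt_or_ge (j + 1) m with h' | h'
    · exact ⟨j + 1, h', (h.link h').symm⟩
    · obtain rfl : j = m - 1 := by omega
      exact ⟨i, h.lt, h.close⟩

theorem walk_periodic (h : P.Lasso fst lim sec stk i m) {t : ℕ} (ht : i ≤ t) :
    walk P lim sec (stk 0) (t + (m - i)) = walk P lim sec (stk 0) t := by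
  have hlt := h.lt
  induction t, ht using Nat.le_induction with
  | base =>
    rw [show i + (m - i) = m - 1 + 1 by omega, walk_succ, h.walk_eq (by omega), h.close,
      h.walk_eq hlt]
  | succ t _ ih => rw [show t + 1 + (m - i) = t + (m - i) + 1 by omega, walk_succ, ih, walk_succ]

/-- The agents on the cycle are visited arbitrarily late. -/
theorem exists_late (h : P.Lasso fst lim sec stk i m) {j : ℕ} (hi : i ≤ j) (hj : j < m) (T : ℕ) :
    ∃ t, T ≤ t ∧ walk P lim sec (stk 0) t = stk j := by
  have hper : ∀ c, walk P lim sec (stk 0) (j + c * (m - i)) = stk j := by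
    intro c
    induction c with
    | zero => rw [Nat.zero_mul, Nat.add_zero, h.walk_eq hj]
    | succ c ih =>
      rw [Nat.succ_mul, ← Nat.add_assoc, h.walk_periodic (hi.trans (Nat.le_add_right _ _)), ih]
  have : 1 ≤ m - i := by have := h.lt; omega
  exact ⟨j + T * (m - i), by nlinarith [Nat.zero_le j], hper T⟩

theorem walk_spec (h : P.Lasso fst lim sec stk i m) (hP : P.Valid) (t : ℕ) :
    walk P lim sec (stk 0) t < P.n ∧ P.HasSecond fst lim sec (walk P lim sec (stk 0) t) ∧
      P.first fst (walk P lim sec (stk 0) (t + 1)) =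
        P.second sec (walk P lim sec (stk 0) t) := by
  obtain ⟨j, hj, he⟩ := h.walk_mem t
  rw [walk_succ, he]
  exact ⟨h.mem hj, h.hasSecond hj, (h.table.succ_spec hP (h.mem hj) (h.hasSecond hj)).2.2⟩

/-- Whenever two agents of the walk are the second and the first entry of each other's lists, the
list of the one consists of two entries only, and the same pattern occurs one step earlier. -/
theorem crossing_step (h : P.Lasso fst lim sec stk i m) (hP : P.Valid) {a b : ℕ}
    (h₁ : P.second sec (walk P lim sec (stk 0) b) = walk P lim sec (stk 0) (a + 1))
    (h₂ : P.first fst (walk P lim sec (stk 0) (a + 1)) = walk P lim sec (stk 0) b) :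
    sec (walk P lim sec (stk 0) b) + 1 = lim (walk P lim sec (stk 0) b) ∧
      P.second sec (walk P lim sec (stk 0) a) = walk P lim sec (stk 0) b ∧
      P.first fst (walk P lim sec (stk 0) b) = walk P lim sec (stk 0) a := by
  obtain ⟨hb, hsb, -⟩ := h.walk_spec hP b
  obtain ⟨ha, hsa, hfa⟩ := h.walk_spec hP a
  have hne : walk P lim sec (stk 0) (a + 1) ≠ walk P lim sec (stk 0) a := by
    intro he
    rw [he] at hfa
    have := hP.ent_inj ha (h.table.lt_len ha hsa.active) (h.table.lt_len ha hsa.lt_lim) hfa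
    have := hsa.fst_lt
    omega
  have hsucc := walk_succ (P := P) (lim := lim) (sec := sec) (stk 0) a
  generalize walk P lim sec (stk 0) (a + 1) = x' at *
  generalize walk P lim sec (stk 0) a = x at *
  generalize walk P lim sec (stk 0) b = y at *
  have hs : P.second sec x = y := hfa.symm.trans h₂
  have hlast : P.last lim y = P.second sec y := by
    rw [h₁, hsucc, ← hs]
  have hpos : sec y + 1 = lim y := by
    have hl := hsb.lt_lim
    have := hP.ent_inj hb (h.table.lt_len hb (by omega : lim y - 1 < lim y))
      (h.table.lt_len hb hl) hlast
    omega
  refine ⟨hpos, hs, ?_⟩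
  have hx := h.table.ent_second_rk hP ha hsa
  have hge := h.table.fst_le_rk hP ha hsa.lt_lim
  have hlt := not_le.1 hsa.live
  change fst (P.second sec x) ≤ P.rk (P.second sec x) x at hge
  change P.rk (P.second sec x) x < lim (P.second sec x) at hlt
  rw [hs] at hx hge hlt
  rcases hge.eq_or_lt with he | hgt
  · rw [← he] at hx
    exact hx
  rcases Nat.lt_or_ge (P.rk y x) (sec y) with hlt' | hge'
  · have hd := h.secOK hb hgt hlt' hlt
    rw [Prefs.Dead, hx, ← hs, hP.rk_ent ha (h.table.lt_len ha hsa.lt_lim)] at hd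
    have := hsa.lt_lim
    omega
  · have : P.rk y x = sec y := by omega
    rw [this] at hx
    exact absurd (h₁.symm.trans hx) hne

/-- A crossing of the walk leads back to its start, whose list then has two entries only. -/
theorem no_crossing (h : P.Lasso fst lim sec stk i m) (hP : P.Valid) {a b : ℕ} (hab : a < b)
    (h₁ : P.second sec (walk P lim sec (stk 0) b) = walk P lim sec (stk 0) (a + 1))
    (h₂ : P.first fst (walk P lim sec (stk 0) (a + 1)) = walk P lim sec (stk 0) b) : False := by
  induction a generalizing b with
  | zero =>
    obtain ⟨b, rfl⟩ := Nat.exists_eq_succ_of_ne_zero (by omega : b ≠ 0)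
    obtain ⟨-, h₃, h₄⟩ := h.crossing_step hP h₁ h₂
    have := (h.crossing_step hP h₃ h₄).1
    have := h.long
    simp only [walk, Function.iterate_zero, id] at *
    omega
  | succ a ih =>
    obtain ⟨b, rfl⟩ := Nat.exists_eq_succ_of_ne_zero (by omega : b ≠ 0)
    obtain ⟨-, h₃, h₄⟩ := h.crossing_step hP h₁ h₂
    obtain ⟨-, h₅, h₆⟩ := h.crossing_step hP h₃ h₄
    exact ih (by omega) h₅ h₆

/-- On the cycle, different agents have different second entries; off the cycle, only the agent
just before it can share her second entry with one on the cycle. -/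
theorem second_ne (h : P.Lasso fst lim sec stk i m) {j k : ℕ} (hj : j < m) (hk : k < m)
    (hi : i ≤ k) (hjk : j ≠ k) (hji : j + 1 ≠ i) :
    P.second sec (stk j) ≠ P.second sec (stk k) := by
  intro he
  have hs : P.succ lim sec (stk j) = P.succ lim sec (stk k) := by rw [Prefs.succ, he]
  have hlt := h.lt
  -- the successor of the entry `l` is the entry `l + 1`, or `i` at the end
  have key : ∀ l < m, ∃ l' < m, P.succ lim sec (stk l) = stk l' ∧
      ((l + 1 < m ∧ l' = l + 1) ∨ (l + 1 = m ∧ l' = i)) := by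
    intro l hl
    rcases Nat.lt_or_ge (l + 1) m with h' | h'
    · exact ⟨l + 1, h', (h.link h').symm, Or.inl ⟨h', rfl⟩⟩
    · obtain rfl : l = m - 1 := by omega
      exact ⟨i, hlt, h.close, Or.inr ⟨by omega, rfl⟩⟩
  obtain ⟨j', hj', ej, cj⟩ := key j hj
  obtain ⟨k', hk', ek, ck⟩ := key k hk
  have := h.inj hj' hk' (ej ▸ ek ▸ hs)
  omega

end Prefs.Lasso

/-- The result `fst`, `lim` of moving the cursors of the agents `stk j`, `a ≤ j < b`, from their
first to their second entries and cutting off the lists of these second entries accordingly. -/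
structure Prefs.Eliminated (P : Prefs) (sec stk : ℕ → ℕ) (a b : ℕ)
    (fst₀ lim₀ fst lim : ℕ → ℕ) : Prop where
  fst_eq : ∀ {j}, a ≤ j → j < b → fst (stk j) = sec (stk j)
  fst_ne : ∀ {x}, (∀ j, a ≤ j → j < b → stk j ≠ x) → fst x = fst₀ x
  lim_eq : ∀ {j}, a ≤ j → j < b →
    lim (P.second sec (stk j)) = P.rk (P.second sec (stk j)) (stk j) + 1
  lim_ne : ∀ {y}, (∀ j, a ≤ j → j < b → P.second sec (stk j) ≠ y) → lim y = lim₀ y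

namespace Prefs.Eliminated

variable {fst₀ lim₀ fst lim sec stk : ℕ → ℕ} {i a m : ℕ}

theorem refl : P.Eliminated sec stk m m fst₀ lim₀ fst₀ lim₀ where
  fst_eq h h' := absurd h (not_le.2 h')
  fst_ne _ := rfl
  lim_eq h h' := absurd h (not_le.2 h')
  lim_ne _ := rfl

theorem step (h : P.Eliminated sec stk (a + 1) m fst₀ lim₀ fst lim)
    (hL : P.Lasso fst₀ lim₀ sec stk i m) (hia : i ≤ a) (ham : a < m) :
    P.Eliminated sec stk a m fst₀ lim₀ (Function.update fst (stk a) (sec (stk a)))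
      (Function.update lim (P.second sec (stk a)) (P.rk (P.second sec (stk a)) (stk a) + 1)) where
  fst_eq {j} hj hjm := by
    rcases hj.eq_or_lt with rfl | hj
    · rw [Function.update_self]
    · rw [Function.update_of_ne fun he => absurd (hL.inj hjm ham he) (by omega)]
      exact h.fst_eq hj hjm
  fst_ne {x} hx := by
    rw [Function.update_of_ne (hx a le_rfl ham).symm]
    exact h.fst_ne fun j hj hjm => hx j (by omega) hjm
  lim_eq {j} hj hjm := by
    rcases hj.eq_or_lt with rfl | hj
    · rw [Function.update_self]
    · rw [Function.update_of_ne (hL.second_ne hjm ham hia (by omega) (by omega))]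
      exact h.lim_eq hj hjm
  lim_ne {y} hy := by
    rw [Function.update_of_ne (hy a le_rfl ham).symm]
    exact h.lim_ne fun j hj hjm => hy j (by omega) hjm

variable (h : P.Eliminated sec stk i m fst₀ lim₀ fst lim) (hL : P.Lasso fst₀ lim₀ sec stk i m)

include h hL

theorem lim_le_of_mem {j : ℕ} (hj : j < m) (hi : i ≤ j) :
    lim (P.second sec (stk j)) ≤ lim₀ (P.second sec (stk j)) := by
  have := not_le.1 (hL.hasSecond hj).live
  rw [h.lim_eq hi hj]
  exact this

theorem lim_le (y : ℕ) : lim y ≤ lim₀ y := by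
  by_cases hy : ∃ j, i ≤ j ∧ j < m ∧ P.second sec (stk j) = y
  · obtain ⟨j, hi, hj, rfl⟩ := hy
    exact h.lim_le_of_mem hL hj hi
  · push Not at hy
    exact (h.lim_ne hy).le

/-- The elimination leaves the pair of `stk j` and her second entry alive, for all agents on
the cycle and all agents on the path to it but its start. -/
theorem sec_lt (hP : P.Valid) {j : ℕ} (hj : j < m) (hj' : 0 < j ∨ i ≤ j) :
    sec (stk j) < lim (stk j) := by
  by_contra! hk
  have hT := hL.table
  have hsj := hL.hasSecond hj
  have hjn := hL.mem hj
  -- the list of `stk j` has been cut off on behalf of some `stk k` on the cycle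
  obtain ⟨k, hik, hkm, he⟩ : ∃ k, i ≤ k ∧ k < m ∧ P.second sec (stk k) = stk j := by
    by_contra! hne
    have := h.lim_ne hne
    have := hsj.lt_lim
    omega
  have hkn := hL.mem hkm
  have hsk := hL.hasSecond hkm
  have hle := h.lim_eq hik hkm
  have hge := hT.fst_le_rk hP hkn hsk.lt_lim
  have hx := hT.ent_second_rk hP hkn hsk
  have hlt := not_le.1 hsk.live
  change fst₀ (P.second sec (stk k)) ≤ P.rk (P.second sec (stk k)) (stk k) at hge
  change P.rk (P.second sec (stk k)) (stk k) < lim₀ (P.second sec (stk k)) at hlt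
  have hrk := hP.rk_ent hkn (hT.lt_len hkn hsk.lt_lim)
  change P.rk (stk k) (P.second sec (stk k)) = _ at hrk
  rw [he] at hle hge hx hlt hrk
  -- so `stk k` is her first entry
  have hfirst : P.first fst₀ (stk j) = stk k := by
    rcases hge.eq_or_lt with he' | hgt
    · rw [Prefs.first, he', hx]
    · have hd := hL.secOK hjn hgt (by omega) hlt
      rw [Prefs.Dead, hx, hrk] at hd
      exact absurd hsk.lt_lim (not_lt.2 hd)
  -- this is a crossing of the walk
  obtain ⟨t, ht₁, ht₂⟩ : ∃ t, Lasso.walk P lim₀ sec (stk 0) (t + 1) = stk j ∧ t ≤ j + m := by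
    rcases hj' with hpos | hij
    · exact ⟨j - 1, by rw [Nat.sub_add_cancel hpos, hL.walk_eq hj], by omega⟩
    · have := hL.lt
      refine ⟨j + (m - i) - 1, ?_, by omega⟩
      rw [show j + (m - i) - 1 + 1 = j + (m - i) by omega, hL.walk_periodic hij, hL.walk_eq hj]
  obtain ⟨b, hb, hwb⟩ := hL.exists_late hik hkm (j + m + 1)
  refine hL.no_crossing hP (a := t) (b := b) (by omega) ?_ ?_
  · rw [hwb, ht₁, he]
  · rw [hwb, ht₁, hfirst]

theorem dead_mono {u q : ℕ} (hd : P.Dead lim₀ u q) : P.Dead lim u q :=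
  (h.lim_le hL _).trans hd

theorem isTable (hP : P.Valid) : P.IsTable fst lim where
  lim_le hu := (h.lim_le hL _).trans (hL.table.lim_le hu)
  dead_before {u q} hu hq hl := by
    by_cases hx : ∃ j, i ≤ j ∧ j < m ∧ stk j = u
    · obtain ⟨j, hij, hj, rfl⟩ := hx
      rw [h.fst_eq hij hj] at hq
      rcases lt_trichotomy q (fst₀ (stk j)) with hlt | rfl | hgt
      · exact h.dead_mono hL (hL.table.dead_before hu hlt hl)
      · -- the old first entry is the second entry of the predecessor on the cycle
        have hj₀ := hL.hasSecond hj
        obtain ⟨k, hik, hk, hkj⟩ : ∃ k, i ≤ k ∧ k < m ∧ P.succ lim₀ sec (stk k) = stk j := by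
          rcases hij.eq_or_lt with rfl | hlt
          · exact ⟨m - 1, by omega, by omega, hL.close⟩
          · refine ⟨j - 1, by omega, by omega, ?_⟩
            rw [← hL.link (by omega), Nat.sub_add_cancel (by omega)]
        obtain ⟨-, -, hf⟩ := hL.table.succ_spec hP (hL.mem hk) (hL.hasSecond hk)
        rw [hkj] at hf
        have h₁ := hL.table.rk_first hu hj₀.active
        have h₂ := h.lim_eq hik hk
        have h₃ := not_le.1 (hL.hasSecond hk).live
        change P.rk (P.second sec (stk k)) (stk k) < lim₀ (P.second sec (stk k)) at h₃
        change lim (P.first fst₀ (stk j)) ≤ P.rk (P.first fst₀ (stk j)) (stk j)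
        rw [hf] at h₁ ⊢
        have h₄ : P.rk (P.second sec (stk k)) (stk k) ≠ P.rk (P.second sec (stk k)) (stk j) := by
          intro he
          have h₅ := hL.table.ent_second_rk hP (hL.mem hk) (hL.hasSecond hk)
          have h₆ := hP.ent_rk hu (hL.table.lt_len hu hj₀.active)
          change P.ent (P.first fst₀ (stk j)) (P.rk (P.first fst₀ (stk j)) (stk j)) = _ at h₆
          rw [hf, ← he, h₅] at h₆
          -- the predecessor would be `stk j` herself
          rw [h₆] at hf
          have := hP.ent_inj hu (hL.table.lt_len hu hj₀.active)
            (hL.table.lt_len hu hj₀.lt_lim) hf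
          have := hj₀.fst_lt
          omega
        omega
      · exact h.dead_mono hL (hL.secOK hu hgt hq (by have := (hL.hasSecond hj).lt_lim; omega))
    · push Not at hx
      rw [h.fst_ne hx] at hq
      exact h.dead_mono hL (hL.table.dead_before hu hq hl)
  settled {u} hu := by
    by_cases hx : ∃ j, i ≤ j ∧ j < m ∧ stk j = u
    · obtain ⟨j, hij, hj, rfl⟩ := hx
      rw [Prefs.first, h.fst_eq hij hj]
      exact Or.inr ⟨h.sec_lt hL hP hj (Or.inr hij), (h.lim_eq hij hj).symm⟩
    · push Not at hx
      rw [Prefs.first, h.fst_ne hx]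
      rcases hL.table.settled hu with ⟨h₁, h₂⟩ | ⟨h₁, h₂⟩
      · refine Or.inl ⟨(h.lim_le hL u).trans h₁, (h.lim_ne fun k hik hk he => ?_).trans h₂⟩
        have := hL.table.second_active hP (hL.mem hk) (hL.hasSecond hk)
        rw [he] at this
        omega
      · right
        constructor
        · by_cases hy : ∃ k, i ≤ k ∧ k < m ∧ P.second sec (stk k) = u
          · obtain ⟨k, hik, hk, rfl⟩ := hy
            rw [h.lim_eq hik hk]
            exact Nat.lt_succ_of_le (hL.table.fst_le_rk hP (hL.mem hk) (hL.hasSecond hk).lt_lim)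
          · push Not at hy
            rwa [h.lim_ne hy]
        · rw [h.lim_ne fun k hik hk he => ?_]
          · exact h₂
          · -- the second entries on the cycle are the first entries of agents on the cycle
            obtain ⟨h₃, h₄, h₅⟩ := hL.table.succ_spec hP (hL.mem hk) (hL.hasSecond hk)
            have h₆ := hL.table.first_inj hP h₃ hu (by omega) h₁ (h₅.trans he)
            rcases Nat.lt_or_ge (k + 1) m with h' | h'
            · exact hx (k + 1) (by omega) h' ((hL.link h').trans h₆)
            · obtain rfl : k = m - 1 := by omega
              exact hx i le_rfl hL.lt (hL.close.symm.trans h₆)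

theorem secOK : P.SecOK fst lim sec := by
  intro x q hx hq hq' hl
  by_cases hy : ∃ j, i ≤ j ∧ j < m ∧ stk j = x
  · obtain ⟨j, hij, hj, rfl⟩ := hy
    rw [h.fst_eq hij hj] at hq
    omega
  · push Not at hy
    rw [h.fst_ne hy] at hq
    exact h.dead_mono hL (hL.secOK hx hq hq' (hl.trans_le (h.lim_le hL x)))

theorem fst_of_lt {j : ℕ} (hj : j < i) : fst (stk j) = fst₀ (stk j) :=
  h.fst_ne fun k hik hk he => by
    have := hL.inj hk (by have := hL.lt; omega) he
    omega

/-- The path to the cycle, without its end, keeps its links. -/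
theorem hasSecond_of_lt (hP : P.Valid) {j : ℕ} (hj : j + 1 < i)
    (hlong : sec (stk 0) < lim (stk 0)) :
    P.HasSecond fst lim sec (stk j) ∧ stk (j + 1) = P.succ lim sec (stk j) := by
  have hlt := hL.lt
  have hjm : j < m := by omega
  have hy : lim (P.second sec (stk j)) = lim₀ (P.second sec (stk j)) :=
    h.lim_ne fun k hik hk he => hL.second_ne hjm hk hik (by omega) (by omega) he.symm
  have hs := hL.hasSecond hjm
  refine ⟨⟨?_, ?_, ?_⟩, ?_⟩
  · rw [h.fst_of_lt hL (by omega)]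
    exact hs.fst_lt
  · rcases Nat.eq_zero_or_pos j with rfl | hpos
    · exact hlong
    · exact h.sec_lt hL hP hjm (Or.inl hpos)
  · have := hs.live
    rw [Prefs.Dead] at this ⊢
    rwa [hy]
  · rw [hL.link (by omega), Prefs.succ, Prefs.succ, Prefs.last, Prefs.last, hy]

end Prefs.Eliminated

/-! ### The search for rotations -/

/-- The state of the search: the agent `o` whose list is being shortened, a stack
`stk 0, …, stk (sp - 1)` with the inverse map `pos` (shifted by one, `0` for agents that are not on
the stack), the cursors and the cut-offs. The elimination of a rotation goes on as long as `z` is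
on the stack. -/
structure SearchState where
  o : ℕ
  z : ℕ
  sp : ℕ
  fst : ℕ → ℕ
  lim : ℕ → ℕ
  sec : ℕ → ℕ
  stk : ℕ → ℕ
  pos : ℕ → ℕ

namespace SearchState

variable {P : Prefs} {S : SearchState}

/-- The agent whose second entry is looked for. -/
abbrev top (S : SearchState) : ℕ := if S.sp = 0 then S.o else S.stk (S.sp - 1)

/-- Takes the top agent from the stack, as a member of the cycle: her cursor moves to her second
entry, whose list is cut off after her. -/
abbrev pop (P : Prefs) (S : SearchState) : SearchState :=
  let x := S.stk (S.sp - 1)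
  { S with
    sp := S.sp - 1
    pos := Function.update S.pos x 0
    fst := Function.update S.fst x (S.sec x)
    lim := Function.update S.lim (P.second S.sec x) (P.rk (P.second S.sec x) x + 1) }

/-- Takes the top agent from the stack without changing her list. -/
abbrev discard (S : SearchState) : SearchState :=
  { S with sp := S.sp - 1, pos := Function.update S.pos (S.stk (S.sp - 1)) 0 }

/-- Moves the second cursor of the top agent to `a`. -/
abbrev setSec (S : SearchState) (a : ℕ) : SearchState :=
  { S with sec := Function.update S.sec S.top a }

/-- Puts `w` on the stack; `z` is set to a value that is never on it. -/
abbrev push (P : Prefs) (S : SearchState) (w : ℕ) : SearchState :=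
  { S with
    sp := S.sp + 1
    stk := Function.update S.stk S.sp w
    pos := Function.update S.pos w (S.sp + 1)
    z := P.n }

/-- One step of the search. As long as the list of `o` has three live entries, a path of agents is
built in which each is followed by her successor; when it closes up to a cycle, the cycle is
eliminated. When the list of `o` has become short, the stack is emptied, and it is the turn of the
next agent. -/
def step (P : Prefs) (S : SearchState) : SearchState :=
  if 0 < S.pos S.z then S.pop P
  else if 0 < S.sp ∧ S.stk 0 < S.o then S.discard
  else if S.lim S.o ≤ S.fst S.o ∨ (S.fst S.o < S.sec S.o ∧ S.lim S.o ≤ S.sec S.o + 1) then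
    { S with o := S.o + 1 }
  else if S.sec S.top ≤ S.fst S.top then S.setSec (S.fst S.top + 1)
  else if P.Dead S.lim S.top (S.sec S.top) then S.setSec (S.sec S.top + 1)
  else if 0 < S.pos (if S.sp = 0 then S.o else P.succ S.lim S.sec S.top) then
    { S with z := if S.sp = 0 then S.o else P.succ S.lim S.sec S.top }
  else S.push P (if S.sp = 0 then S.o else P.succ S.lim S.sec S.top)

/-- The stack has no repetitions, and `pos` is its inverse. -/
structure StackOK (n sp : ℕ) (stk pos : ℕ → ℕ) : Prop where
  lt : ∀ {j}, j < sp → stk j < n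
  pos_stk : ∀ {j}, j < sp → pos (stk j) = j + 1
  stk_pos : ∀ {x}, 0 < pos x → pos x ≤ sp ∧ stk (pos x - 1) = x

namespace StackOK

variable {n sp : ℕ} {stk pos : ℕ → ℕ}

theorem inj (h : StackOK n sp stk pos) {j k : ℕ} (hj : j < sp) (hk : k < sp)
    (he : stk j = stk k) : j = k := by
  have h₁ := h.pos_stk hj
  have h₂ := h.pos_stk hk
  rw [he] at h₁
  omega

theorem sp_le (h : StackOK n sp stk pos) : sp ≤ n := by
  have : (range sp).card ≤ (range n).card :=
    card_le_card_of_injOn stk (fun j hj => by simpa using h.lt (by simpa using hj))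
      fun j hj k hk he => h.inj (by simpa using hj) (by simpa using hk) he
  simpa using this

theorem pos_n (h : StackOK n sp stk pos) : pos n = 0 := by
  by_contra h'
  obtain ⟨h₁, h₂⟩ := h.stk_pos (Nat.pos_of_ne_zero h')
  have := h.lt (by omega : pos n - 1 < sp)
  omega

theorem pop (h : StackOK n sp stk pos) (hsp : 0 < sp) :
    StackOK n (sp - 1) stk (Function.update pos (stk (sp - 1)) 0) where
  lt hj := h.lt (by omega)
  pos_stk {j} hj := by
    rw [Function.update_of_ne fun he => absurd (h.inj (by omega) (by omega) he) (by omega)]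
    exact h.pos_stk (by omega)
  stk_pos {x} hx := by
    rcases eq_or_ne x (stk (sp - 1)) with rfl | hne
    · simp at hx
    · rw [Function.update_of_ne hne] at hx ⊢
      obtain ⟨h₁, h₂⟩ := h.stk_pos hx
      refine ⟨?_, h₂⟩
      by_contra! h₃
      exact hne (by rw [← h₂]; congr 1; omega)

theorem push (h : StackOK n sp stk pos) {w : ℕ} (hw : w < n) (hpos : pos w = 0) :
    StackOK n (sp + 1) (Function.update stk sp w) (Function.update pos w (sp + 1)) where
  lt {j} hj := by
    rcases eq_or_ne j sp with rfl | hne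
    · rwa [Function.update_self]
    · rw [Function.update_of_ne hne]
      exact h.lt (by omega)
  pos_stk {j} hj := by
    rcases eq_or_ne j sp with rfl | hne
    · rw [Function.update_self, Function.update_self]
    · have h₁ := h.pos_stk (by omega : j < sp)
      rw [Function.update_of_ne hne, Function.update_of_ne fun he => ?_]
      · exact h₁
      · rw [he] at h₁
        omega
  stk_pos {x} hx := by
    rcases eq_or_ne x w with rfl | hne
    · simp
    · rw [Function.update_of_ne hne] at hx ⊢
      obtain ⟨h₁, h₂⟩ := h.stk_pos hx
      refine ⟨by omega, ?_⟩
      rw [Function.update_of_ne (by omega)]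
      exact h₂

end StackOK

/-- The list of `x` has at most two live entries. -/
def Short (P : Prefs) (lim : ℕ → ℕ) (x : ℕ) : Prop :=
  ∀ ⦃i j k⦄, i < j → j < k → k < lim x → ¬ P.Dead lim x i → ¬ P.Dead lim x j → P.Dead lim x k

theorem Short.mono {lim lim' : ℕ → ℕ} {x : ℕ} (h : Short P lim x) (hle : ∀ y, lim' y ≤ lim y) :
    Short P lim' x := fun _ _ _ h₁ h₂ h₃ h₄ h₅ =>
  (hle _).trans (h h₁ h₂ (h₃.trans_le (hle _)) (fun h' => h₄ ((hle _).trans h'))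
    fun h' => h₅ ((hle _).trans h'))

/-- The invariant while a path is built. The links of the path matter only as long as its start
`o` has at least three live entries. -/
structure Exploring (P : Prefs) (S : SearchState) : Prop where
  table : P.IsTable S.fst S.lim
  secOK : P.SecOK S.fst S.lim S.sec
  done : ∀ {x}, x < P.n → x < S.o → Short P S.lim x
  stack : StackOK P.n S.sp S.stk S.pos
  bottom_le : 0 < S.sp → S.stk 0 ≤ S.o
  pos_z : S.pos S.z = 0
  bottom : 0 < S.sp → S.stk 0 = S.o → S.fst S.o < S.sec S.o
  path : 0 < S.sp → S.stk 0 = S.o → S.sec S.o + 1 < S.lim S.o →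
    (∀ j, j + 1 < S.sp → P.HasSecond S.fst S.lim S.sec (S.stk j) ∧
      S.stk (j + 1) = P.succ S.lim S.sec (S.stk j)) ∧
    S.fst (S.stk (S.sp - 1)) + 1 < S.lim (S.stk (S.sp - 1))

/-- The invariant while a cycle `stk i, …, stk (m - 1)` with `stk i = z` is eliminated, from its end
on; `fst₀` and `lim₀` describe the table before the elimination. -/
structure Eliminating (P : Prefs) (S : SearchState) (fst₀ lim₀ : ℕ → ℕ) (i m : ℕ) : Prop where
  lasso : P.Lasso fst₀ lim₀ S.sec S.stk i m
  elim : P.Eliminated S.sec S.stk S.sp m fst₀ lim₀ S.fst S.lim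
  lt_sp : i < S.sp
  sp_le : S.sp ≤ m
  bottom : S.stk 0 = S.o
  z_eq : S.z = S.stk i
  done : ∀ {x}, x < P.n → x < S.o → Short P lim₀ x
  stack : StackOK P.n S.sp S.stk S.pos

/-- The invariant of the search. -/
def Inv (P : Prefs) (S : SearchState) : Prop :=
  Exploring P S ∨ ∃ fst₀ lim₀ i m, Eliminating P S fst₀ lim₀ i m

theorem Exploring.init {fst lim stk sec pos : ℕ → ℕ} (h : P.IsTable fst lim)
    (hsec : ∀ x, sec x = 0) (hpos : ∀ x, pos x = 0) (z : ℕ) :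
    Exploring P ⟨0, z, 0, fst, lim, sec, stk, pos⟩ where
  table := h
  secOK {x i} _ _ h := by simp only [hsec] at h; omega
  done _ h := absurd h (Nat.not_lt_zero _)
  stack := ⟨fun h => absurd h (Nat.not_lt_zero _), fun h => absurd h (Nat.not_lt_zero _),
    fun {x} h => absurd (hpos x) (Nat.ne_of_gt h)⟩
  bottom_le h := absurd h (Nat.not_lt_zero _)
  pos_z := hpos z
  bottom h := absurd h (Nat.not_lt_zero _)
  path h := absurd h (Nat.not_lt_zero _)

theorem Eliminating.pop_inv {fst₀ lim₀ : ℕ → ℕ} {i m : ℕ} (h : Eliminating P S fst₀ lim₀ i m)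
    (hP : P.Valid) : Inv P (S.pop P) := by
  have hlt := h.lt_sp
  have hle := h.sp_le
  obtain ⟨a, ha⟩ : ∃ a, S.sp = a + 1 := ⟨S.sp - 1, by omega⟩
  have hsp : S.sp - 1 = a := by omega
  have helim := (ha ▸ h.elim : P.Eliminated S.sec S.stk (a + 1) m fst₀ lim₀ S.fst S.lim).step
    h.lasso (by omega) (by omega)
  have hstack := h.stack.pop (by omega)
  rw [hsp] at hstack
  simp only [pop, hsp]
  rcases Nat.lt_or_ge i a with hia | hia
  · exact Or.inr ⟨fst₀, lim₀, i, m, h.lasso, helim, hia, by simp only; omega, h.bottom, h.z_eq,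
      h.done, hstack⟩
  · obtain rfl : i = a := by omega
    have hL := h.lasso
    refine Or.inl ⟨helim.isTable hL hP, helim.secOK hL, fun hx hx' =>
      (h.done hx hx').mono (helim.lim_le hL), hstack, fun _ => h.bottom.le, ?_,
      fun h₀ h₁ => ?_, fun h₀ h₁ h₂ => ⟨fun j hj => ?_, ?_⟩⟩
    · simp only [h.z_eq, Function.update_self]
    · have := helim.fst_of_lt hL h₀
      simp only at h₀ this ⊢
      rw [h.bottom] at this
      rw [this, ← h.bottom]
      exact (hL.hasSecond (by omega)).fst_lt
    · simp only at h₂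
      rw [← h.bottom] at h₂
      exact helim.hasSecond_of_lt hL hP hj (by omega)
    · -- the new end of the path keeps her second entry, or is the start of the path
      have h₃ := helim.fst_of_lt hL (j := i - 1) (by simp only at h₀; omega)
      have h₄ := (hL.hasSecond (j := i - 1) (by omega)).fst_lt
      simp only at h₀ h₂ ⊢
      rw [h₃]
      rcases Nat.eq_zero_or_pos (i - 1) with h₅ | h₅
      · rw [h₅] at h₄ ⊢
        rw [h.bottom] at h₄ ⊢
        omega
      · have := helim.sec_lt hL hP (j := i - 1) (by omega) (Or.inl h₅)
        omega

theorem Exploring.discard_inv (h : Exploring P S) (h₁ : 0 < S.sp) (h₂ : S.stk 0 < S.o) :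
    Exploring P S.discard where
  table := h.table
  secOK := h.secOK
  done := h.done
  stack := h.stack.pop h₁
  bottom_le _ := h₂.le
  pos_z := by
    simp only [discard]
    by_cases hz : S.z = S.stk (S.sp - 1)
    · rw [hz, Function.update_self]
    · rw [Function.update_of_ne hz, h.pos_z]
  bottom _ h' := absurd h' h₂.ne
  path _ h' := absurd h' h₂.ne

theorem Exploring.next_inv (h : Exploring P S)
    (h₂ : S.lim S.o ≤ S.fst S.o ∨ (S.fst S.o < S.sec S.o ∧ S.lim S.o ≤ S.sec S.o + 1)) :
    Exploring P { S with o := S.o + 1 } where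
  table := h.table
  secOK := h.secOK
  done {x} hx hx' := by
    rcases Nat.lt_succ_iff_lt_or_eq.1 hx' with hx' | rfl
    · exact h.done hx hx'
    · intro i j k hij hjk hk hi hj
      change k < S.lim S.o at hk
      by_contra hk'
      have h₃ := h.table.fst_le hx (by omega) hi
      rcases h₂ with h₂ | h₂
      · omega
      · exact hj (h.secOK hx (by omega) (by omega) (by omega))
  stack := h.stack
  bottom_le h' := (h.bottom_le h').trans (Nat.le_succ _)
  pos_z := h.pos_z
  bottom h' h'' := absurd (h.bottom_le h') (not_le.2 (h'' ▸ Nat.lt_succ_self S.o))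
  path h' h'' := absurd (h.bottom_le h') (not_le.2 (h'' ▸ Nat.lt_succ_self S.o))

theorem Exploring.long (h : Exploring P S) (hsp : 0 < S.sp) (h₁ : ¬ (0 < S.sp ∧ S.stk 0 < S.o))
    (h₂ : ¬ (S.lim S.o ≤ S.fst S.o ∨ (S.fst S.o < S.sec S.o ∧ S.lim S.o ≤ S.sec S.o + 1))) :
    S.stk 0 = S.o ∧ S.sec S.o + 1 < S.lim S.o := by
  have h₃ := h.bottom_le hsp
  have h₄ : S.stk 0 = S.o := by omega
  have := h.bottom hsp h₄
  exact ⟨h₄, by omega⟩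

/-- While the list of `o` is not known to be short, the list of the top agent has a second
entry, at or after the cursor `sec`. -/
theorem Exploring.top_spec (h : Exploring P S) (hP : P.Valid) (ho : S.o < P.n)
    (h₁ : ¬ (0 < S.sp ∧ S.stk 0 < S.o))
    (h₂ : ¬ (S.lim S.o ≤ S.fst S.o ∨ (S.fst S.o < S.sec S.o ∧ S.lim S.o ≤ S.sec S.o + 1))) :
    S.top < P.n ∧ S.fst S.top < S.lim S.top ∧
      (S.fst S.top < S.sec S.top → S.sec S.top < S.lim S.top) := by
  by_cases hsp : S.sp = 0
  · simp only [top, if_pos hsp]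
    exact ⟨ho, by omega, by omega⟩
  · obtain ⟨h₃, h₄⟩ := h.long (by omega) h₁ h₂
    have h₅ := (h.path (by omega) h₃ h₄).2
    have h₆ := h.stack.lt (by omega : S.sp - 1 < S.sp)
    simp only [top, if_neg hsp]
    exact ⟨h₆, by omega, fun _ => h.table.sec_lt_lim hP h.secOK h₆ h₅⟩

theorem Exploring.setSec_inv (h : Exploring P S) {a : ℕ} (hle : S.sec S.top ≤ a)
    (hdead : ∀ i, S.fst S.top < i → i < a → i < S.lim S.top → P.Dead S.lim S.top i) :
    Exploring P (S.setSec a) where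
  table := h.table
  secOK {x i} hx h₁ h₂ h₃ := by
    rcases eq_or_ne x S.top with rfl | hne
    · simp only [Function.update_self] at h₂
      exact hdead i h₁ h₂ h₃
    · simp only [Function.update_of_ne hne] at h₂
      exact h.secOK hx h₁ h₂ h₃
  done := h.done
  stack := h.stack
  bottom_le := h.bottom_le
  pos_z := h.pos_z
  bottom h₁ h₂ := by
    have h₃ := h.bottom h₁ h₂
    simp only
    by_cases hne : S.o = S.top
    · rw [hne] at h₃
      rw [← hne] at hle ⊢
      rw [Function.update_self]
      rw [← hne] at h₃
      omega
    · rwa [Function.update_of_ne hne]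
  path h₁ h₂ h₃ := by
    have htop : S.top = S.stk (S.sp - 1) := if_neg (by simp only at h₁; omega)
    have hne : ∀ j, j + 1 < S.sp → S.stk j ≠ S.top := fun j hj he => by
      rw [htop] at he
      have := h.stack.inj (by omega) (by omega) he
      omega
    have h₄ : S.sec S.o + 1 < S.lim S.o := by
      simp only at h₃
      by_cases ho : S.o = S.top
      · rw [← ho, Function.update_self] at h₃
        rw [← ho] at hle
        omega
      · rwa [Function.update_of_ne ho] at h₃
    obtain ⟨h₅, h₆⟩ := h.path h₁ h₂ h₄
    refine ⟨fun j hj => ?_, h₆⟩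
    obtain ⟨h₇, h₈⟩ := h₅ j hj
    simp only
    refine ⟨⟨?_, ?_, ?_⟩, ?_⟩
    · rw [Function.update_of_ne (hne j hj)]
      exact h₇.fst_lt
    · rw [Function.update_of_ne (hne j hj)]
      exact h₇.lt_lim
    · rw [Function.update_of_ne (hne j hj)]
      exact h₇.live
    · rw [Prefs.succ, Prefs.second, Function.update_of_ne (hne j hj)]
      exact h₈

theorem Exploring.push_first_inv (h : Exploring P S) (ho : S.o < P.n) (hsp : S.sp = 0)
    (h₁ : S.fst S.o < S.sec S.o) (h₂ : S.sec S.o + 1 < S.lim S.o) (hpos : S.pos S.o = 0) :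
    Exploring P (S.push P S.o) where
  table := h.table
  secOK := h.secOK
  done := h.done
  stack := h.stack.push ho hpos
  bottom_le _ := by simp only [hsp, Function.update_self, le_refl]
  pos_z := (h.stack.push ho hpos).pos_n
  bottom _ _ := h₁
  path _ _ _ := by
    simp only [hsp]
    refine ⟨fun j hj => absurd hj (by omega), ?_⟩
    simp only [Nat.zero_add, Nat.sub_self, Function.update_self]
    omega

theorem Exploring.push_inv (h : Exploring P S) (hP : P.Valid) (hsp : 0 < S.sp)
    (h₁ : S.stk 0 = S.o) (h₂ : S.sec S.o + 1 < S.lim S.o)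
    (hs : P.HasSecond S.fst S.lim S.sec (S.stk (S.sp - 1)))
    (hpos : S.pos (P.succ S.lim S.sec (S.stk (S.sp - 1))) = 0) :
    Exploring P (S.push P (P.succ S.lim S.sec (S.stk (S.sp - 1)))) := by
  have htop := h.stack.lt (by omega : S.sp - 1 < S.sp)
  obtain ⟨hw₁, hw₂, -⟩ := h.table.succ_spec hP htop hs
  refine ⟨h.table, h.secOK, h.done, h.stack.push hw₁ hpos, fun _ => ?_,
    (h.stack.push hw₁ hpos).pos_n, fun _ _ => h.bottom hsp h₁, fun _ _ _ => ⟨fun j hj => ?_, ?_⟩⟩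
  · simp only
    rw [Function.update_of_ne (by omega), h₁]
  · simp only at hj ⊢
    rw [Function.update_of_ne (by omega : j ≠ S.sp)]
    rcases Nat.lt_or_ge (j + 1) S.sp with hlt | hge
    · rw [Function.update_of_ne (by omega : j + 1 ≠ S.sp)]
      exact (h.path hsp h₁ h₂).1 j hlt
    · obtain rfl : j = S.sp - 1 := by omega
      rw [show S.sp - 1 + 1 = S.sp by omega, Function.update_self]
      exact ⟨hs, rfl⟩
  · simp only [Nat.add_sub_cancel, Function.update_self]
    exact hw₂

theorem Exploring.close_inv (h : Exploring P S) (hsp : 0 < S.sp)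
    (h₁ : S.stk 0 = S.o) (h₂ : S.sec S.o + 1 < S.lim S.o)
    (hs : P.HasSecond S.fst S.lim S.sec (S.stk (S.sp - 1)))
    (hpos : 0 < S.pos (P.succ S.lim S.sec (S.stk (S.sp - 1)))) :
    Inv P { S with z := P.succ S.lim S.sec (S.stk (S.sp - 1)) } := by
  obtain ⟨h₃, h₄⟩ := h.stack.stk_pos hpos
  have hpath := (h.path hsp h₁ h₂).1
  refine Or.inr ⟨S.fst, S.lim, S.pos (P.succ S.lim S.sec (S.stk (S.sp - 1))) - 1, S.sp,
    ⟨h.table, h.secOK, by omega, h.stack.lt, h.stack.inj, fun {j} hj => ?_,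
      fun {j} hj => (hpath j hj).2, h₄.symm, by rw [h₁]; exact h₂⟩,
    .refl, by simp only; omega, le_rfl, h₁, h₄.symm, h.done, h.stack⟩
  rcases Nat.lt_or_ge (j + 1) S.sp with hlt | hge
  · exact (hpath j hlt).1
  · obtain rfl : j = S.sp - 1 := by omega
    exact hs

/-- Every step of the search decreases this potential. Moving a first cursor, with weight `4`, pays
for taking the agent from the stack, which raises the last line by at most `3`; the end of the turn
of `o`, with weight `3 * P.n + 5`, pays for emptying the stack. -/
def potential (P : Prefs) (S : SearchState) : ℕ :=
  4 * ∑ u ∈ range P.n, (P.n - S.fst u) + ∑ u ∈ range P.n, (P.n - S.sec u) +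
    (P.n - S.o) * (3 * P.n + 5) +
    if 0 < S.sp ∧ S.stk 0 < S.o then 2 * P.n + 3 + S.sp
    else 2 * (P.n - S.sp) + if S.pos S.z = 0 then 1 else 0

theorem Inv.step (h : Inv P S) (hP : P.Valid) (ho : S.o < P.n) :
    Inv P (S.step P) ∧ potential P (S.step P) < potential P S := by
  rcases h with h | ⟨fst₀, lim₀, i, m, h⟩
  · rw [SearchState.step, if_neg (by rw [h.pos_z]; omega)]
    have hsp_le := h.stack.sp_le
    by_cases h₁ : 0 < S.sp ∧ S.stk 0 < S.o
    · rw [if_pos h₁]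
      refine ⟨Or.inl (h.discard_inv h₁.1 h₁.2), ?_⟩
      simp only [potential, if_pos h₁]
      split_ifs <;> omega
    rw [if_neg h₁]
    by_cases h₂ : S.lim S.o ≤ S.fst S.o ∨ (S.fst S.o < S.sec S.o ∧ S.lim S.o ≤ S.sec S.o + 1)
    · rw [if_pos h₂]
      refine ⟨Or.inl (h.next_inv h₂), ?_⟩
      have : (P.n - S.o) * (3 * P.n + 5) =
          (P.n - (S.o + 1)) * (3 * P.n + 5) + (3 * P.n + 5) := by
        rw [show P.n - S.o = P.n - (S.o + 1) + 1 by omega, Nat.succ_mul]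
      simp only [potential, if_neg h₁]
      split_ifs <;> omega
    rw [if_neg h₂]
    obtain ⟨ht₁, ht₂, ht₃⟩ := h.top_spec hP ho h₁ h₂
    have hle_n : S.lim S.top ≤ P.n := (h.table.lim_le ht₁).trans (hP.len_le ht₁)
    by_cases h₃ : S.sec S.top ≤ S.fst S.top
    · rw [if_pos h₃]
      refine ⟨Or.inl (h.setSec_inv (by omega) fun i _ _ => by omega), ?_⟩
      have := sum_sub_update_lt S.sec ht₁ (by omega : S.sec S.top < S.fst S.top + 1) (by omega)
      simp only [potential]
      omega
    rw [if_neg h₃]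
    have h₄ := ht₃ (not_le.1 h₃)
    by_cases h₅ : P.Dead S.lim S.top (S.sec S.top)
    · rw [if_pos h₅]
      refine ⟨Or.inl (h.setSec_inv (by omega) fun i hi hi' hl => ?_), ?_⟩
      · rcases Nat.lt_succ_iff_lt_or_eq.1 hi' with hi' | rfl
        · exact h.secOK ht₁ hi hi' hl
        · exact h₅
      · have := sum_sub_update_lt S.sec ht₁ (by omega : S.sec S.top < S.sec S.top + 1) (by omega)
        simp only [potential]
        omega
    rw [if_neg h₅]
    have hs : P.HasSecond S.fst S.lim S.sec S.top := ⟨not_le.1 h₃, h₄, h₅⟩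
    by_cases hsp : S.sp = 0
    · have hpos : S.pos S.o = 0 := by
        by_contra h'
        have := h.stack.stk_pos (Nat.pos_of_ne_zero h')
        omega
      have htop : S.top = S.o := if_pos hsp
      rw [htop] at h₃
      rw [if_pos hsp, if_neg (by omega)]
      have hinv := h.push_first_inv ho hsp (by omega) (by omega) hpos
      have := hinv.stack.sp_le
      refine ⟨Or.inl hinv, ?_⟩
      have hpn : Function.update S.pos S.o (S.sp + 1) P.n = 0 := hinv.stack.pos_n
      have hstk : ¬ (0 < S.sp + 1 ∧ Function.update S.stk S.sp S.o 0 < S.o) := by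
        rw [hsp, Function.update_self]
        omega
      simp only [potential, if_neg h₁, if_neg hstk, h.pos_z, hpn, if_true] at this ⊢
      omega
    · have htop : S.top = S.stk (S.sp - 1) := if_neg hsp
      rw [if_neg hsp]
      rw [htop] at hs
      rw [show P.succ S.lim S.sec S.top = P.succ S.lim S.sec (S.stk (S.sp - 1)) by rw [htop]]
      obtain ⟨h₆, h₇⟩ := h.long (by omega) h₁ h₂
      by_cases h₈ : 0 < S.pos (P.succ S.lim S.sec (S.stk (S.sp - 1)))
      · rw [if_pos h₈]
        refine ⟨h.close_inv (by omega) h₆ h₇ hs h₈, ?_⟩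
        simp only [potential, if_neg h₁, h.pos_z, if_neg h₈.ne', if_true]
        omega
      · rw [if_neg h₈]
        have hinv := h.push_inv hP (by omega) h₆ h₇ hs (by omega)
        have := hinv.stack.sp_le
        have hpn :
            Function.update S.pos (P.succ S.lim S.sec (S.stk (S.sp - 1))) (S.sp + 1) P.n = 0 :=
          hinv.stack.pos_n
        refine ⟨Or.inl hinv, ?_⟩
        simp only [potential, if_neg h₁, h.pos_z, hpn, if_true] at this ⊢
        rw [Function.update_of_ne (by omega : 0 ≠ S.sp), h₆]
        simp only [lt_irrefl, and_false, if_false]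
        omega
  · have hpos : S.pos S.z = i + 1 := by rw [h.z_eq, h.stack.pos_stk h.lt_sp]
    rw [SearchState.step, if_pos (by omega)]
    refine ⟨h.pop_inv hP, ?_⟩
    have hlt := h.lt_sp
    have hm := h.sp_le
    have hsp_le := h.stack.sp_le
    have hx := h.lasso.mem (by omega : S.sp - 1 < m)
    have hs := h.lasso.hasSecond (by omega : S.sp - 1 < m)
    have hfst : S.fst (S.stk (S.sp - 1)) = fst₀ (S.stk (S.sp - 1)) :=
      h.elim.fst_ne fun j hj hjm he => by
        have := h.lasso.inj hjm (by omega) he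
        omega
    have hlen := (h.lasso.table.lim_le hx).trans (hP.len_le hx)
    have := sum_sub_update_lt S.fst hx (hfst ▸ hs.fst_lt)
      (by rw [hfst]; have := hs.active; omega)
    simp only [potential, h.bottom, lt_irrefl, and_false, if_false]
    split_ifs <;> omega

end SearchState

end Tables

/-! ### The program for stable partitions -/

@[simp] theorem WordTerm.slow_const {c : ℕ} : (WordTerm.const c).Slow ↔ c ≤ 1 := Iff.rfl

@[simp] theorem WordTerm.slow_reg (r : ℕ) : (WordTerm.reg r).Slow := trivial

@[simp] theorem WordTerm.slow_read (a : ℕ) (i : WordTerm) : (WordTerm.read a i).Slow := trivial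

@[simp] theorem WordTerm.slow_reg_add (r c : ℕ) : (reg r + const c).Slow ↔ c ≤ 1 := Iff.rfl

@[simp] theorem WordTerm.slow_read_add (a : ℕ) (i : WordTerm) (c : ℕ) :
    (read a i + const c).Slow ↔ c ≤ 1 := Iff.rfl

@[simp] theorem WordTerm.slow_sub (e f : WordTerm) : (e - f).Slow ↔ e.Slow := Iff.rfl

@[simp] theorem WordTerm.slow_div (e f : WordTerm) : (e / f).Slow ↔ e.Slow := Iff.rfl

theorem Program.eval_ifLt_of_lt {e f : WordTerm} {p q : Program} {s : Mem}
    (h : e.eval s < f.eval s) : (Program.ifLt e f p q).eval s = p.eval s := if_pos h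

theorem Program.eval_ifLt_of_not_lt {e f : WordTerm} {p q : Program} {s : Mem}
    (h : ¬ e.eval s < f.eval s) : (Program.ifLt e f p q).eval s = q.eval s := if_neg h

theorem Program.eval_seq (p q : Program) (s : Mem) :
    (Program.seq p q).eval s = q.eval (p.eval s) := rfl

/-- The preference lists in memory: register `0` holds `n`, array `3` the entries and array `5` the
positions. -/
def Mem.prefs (len : ℕ → ℕ) (s : Mem) : Prefs :=
  ⟨s.reg 0, len, fun u i => s.arr 3 (u * s.reg 0 + i), fun u v => s.arr 5 (u * s.reg 0 + v)⟩

/-- One step of the proposal phase, with `cur` in register `1`, `nx` in register `2`, `lim` in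
array `4` and `fst` in array `6`. -/
def proposalBody : Program :=
  .ifLt (.read 6 (.reg 1)) (.read 4 (.reg 1))
    (.seq (.set 5 (.read 3 (.reg 1 * .reg 0 + .read 6 (.reg 1))))
      (.ifLt (.read 5 (.reg 5 * .reg 0 + .reg 1)) (.read 4 (.reg 5))
        (.ifLt (.read 5 (.reg 5 * .reg 0 + .reg 1) + .const 1) (.read 4 (.reg 5))
          (.seq (.set 6 (.read 5 (.reg 5 * .reg 0 + .reg 1) + .const 1))
            (.seq (.set 1 (.read 3 (.reg 5 * .reg 0 + (.read 4 (.reg 5) - .const 1))))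
              (.write 4 (.reg 5) (.reg 6))))
          (.seq (.set 1 (.reg 2)) (.set 2 (.reg 2 + .const 1))))
        (.write 6 (.reg 1) (.read 6 (.reg 1) + .const 1))))
    (.seq (.set 1 (.reg 2)) (.set 2 (.reg 2 + .const 1)))

theorem proposalBody_loopFree : proposalBody.LoopFree := by
  simp [proposalBody, Program.LoopFree]

theorem proposalBody_step {P : Prefs} (hP : P.Valid) {s : Mem} (hs : s.prefs P.len = P)
    (h : P.ProposalInv (s.arr 6) (s.arr 4) (s.reg 1) (s.reg 2)) (hc : s.reg 1 < s.reg 0) :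
    ((proposalBody.eval s).prefs P.len = P ∧
      P.ProposalInv ((proposalBody.eval s).arr 6) ((proposalBody.eval s).arr 4)
        ((proposalBody.eval s).reg 1) ((proposalBody.eval s).reg 2)) ∧
      Prefs.ProposalInv.potential P ((proposalBody.eval s).arr 6) ((proposalBody.eval s).arr 4)
        ((proposalBody.eval s).reg 2) <
      Prefs.ProposalInv.potential P (s.arr 6) (s.arr 4) (s.reg 2) := by
  have hn : s.reg 0 = P.n := congrArg Prefs.n hs
  have hent : ∀ u i, s.arr 3 (u * P.n + i) = P.ent u i := fun u i => by rw [← hs]; rfl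
  have hrk : ∀ u i, s.arr 5 (u * P.n + i) = P.rk u i := fun u i => by rw [← hs]; rfl
  rw [hn] at hc
  have hnx := h.cur_lt hc
  have hs' : (⟨P.n, P.len, fun u i => s.arr 3 (u * P.n + i), fun u i => s.arr 5 (u * P.n + i)⟩ :
      Prefs) = P := by
    rw [← hn]
    exact hs
  have hnext : P.ProposalInv (s.arr 6) (s.arr 4) (s.reg 2) (s.reg 2 + 1) →
      P.ProposalInv (s.arr 6) (s.arr 4) (s.reg 2) (s.reg 2 + 1) ∧
      Prefs.ProposalInv.potential P (s.arr 6) (s.arr 4) (s.reg 2 + 1) <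
        Prefs.ProposalInv.potential P (s.arr 6) (s.arr 4) (s.reg 2) := fun h' => by
    refine ⟨h', ?_⟩
    simp only [Prefs.ProposalInv.potential]
    omega
  by_cases h₁ : s.arr 6 (s.reg 1) < s.arr 4 (s.reg 1)
  · by_cases h₂ : P.rk (P.first (s.arr 6) (s.reg 1)) (s.reg 1) <
        s.arr 4 (P.first (s.arr 6) (s.reg 1))
    · by_cases h₃ : P.rk (P.first (s.arr 6) (s.reg 1)) (s.reg 1) + 1 <
          s.arr 4 (P.first (s.arr 6) (s.reg 1))
      · have hy : P.first (s.arr 6) (s.reg 1) < P.n := hP.ent_lt hc (h₁.trans_le (h.lim_le hc))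
        have := sum_update_lt (s.arr 4) hy h₃
        simp only [Prefs.first] at this
        simp [proposalBody, Program.eval, hn, hent, hrk, h₁, h₂, h₃, Mem.prefs]
        refine ⟨h.accept hP hc h₁ h₃, ?_⟩
        simp only [Prefs.ProposalInv.potential]
        omega
      · simp [proposalBody, Program.eval, hn, hent, hrk, h₁, h₂, h₃, Mem.prefs]
        exact hnext (h.next hc fun _ => by omega)
    · have hl : s.arr 4 (s.reg 1) ≤ P.n := (h.lim_le hc).trans (hP.len_le hc)
      have := sum_sub_update_lt (s.arr 6) hc
        (Nat.lt_add_one (s.arr 6 (s.reg 1))) (h₁.trans_le hl)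
      simp [proposalBody, Program.eval, hn, hent, hrk, h₁, h₂, Mem.prefs]
      refine ⟨h.reject hP hc h₁ (not_lt.1 h₂), ?_⟩
      simp only [Prefs.ProposalInv.potential]
      omega
  · simp [proposalBody, Program.eval, hn, hent, hrk, h₁, Mem.prefs]
    exact hnext (h.next hc fun h' => absurd h' h₁)

/-- One step of the search for rotations, with `o`, `z`, `sp` in the registers `1`, `2`, `3` and
`lim`, `fst`, `sec`, `stk`, `pos` in the arrays `4`, `6`, `7`, `8`, `9`. -/
def searchBody : Program :=
  .ifLt (.const 0) (.read 9 (.reg 2))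
    (.seq (.set 3 (.reg 3 - .const 1))
      (.seq (.set 4 (.read 8 (.reg 3)))
        (.seq (.set 5 (.read 3 (.reg 4 * .reg 0 + .read 7 (.reg 4))))
          (.seq (.write 9 (.reg 4) (.const 0))
            (.seq (.write 6 (.reg 4) (.read 7 (.reg 4)))
              (.write 4 (.reg 5) (.read 5 (.reg 5 * .reg 0 + .reg 4) + .const 1)))))))
    (.ifLt (.const 0) (.reg 3 * (.reg 1 - .read 8 (.const 0)))
      (.seq (.set 3 (.reg 3 - .const 1)) (.write 9 (.read 8 (.reg 3)) (.const 0)))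
      (.ifLt (.const 0) ((.read 6 (.reg 1) + .const 1 - .read 4 (.reg 1)) +
          (.read 7 (.reg 1) - .read 6 (.reg 1)) * (.read 7 (.reg 1) + .const 2 - .read 4 (.reg 1)))
        (.set 1 (.reg 1 + .const 1))
        (.seq (.ifLt (.const 0) (.reg 3) (.set 4 (.read 8 (.reg 3 - .const 1))) (.set 4 (.reg 1)))
          (.ifLt (.read 6 (.reg 4)) (.read 7 (.reg 4))
            (.seq (.set 5 (.read 3 (.reg 4 * .reg 0 + .read 7 (.reg 4))))
              (.ifLt (.read 5 (.reg 5 * .reg 0 + .reg 4)) (.read 4 (.reg 5))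
                (.seq (.ifLt (.const 0) (.reg 3)
                    (.set 6 (.read 3 (.reg 5 * .reg 0 + (.read 4 (.reg 5) - .const 1))))
                    (.set 6 (.reg 1)))
                  (.ifLt (.const 0) (.read 9 (.reg 6))
                    (.set 2 (.reg 6))
                    (.seq (.write 8 (.reg 3) (.reg 6))
                      (.seq (.set 3 (.reg 3 + .const 1))
                        (.seq (.write 9 (.reg 6) (.reg 3)) (.set 2 (.reg 0)))))))
                (.write 7 (.reg 4) (.read 7 (.reg 4) + .const 1))))
            (.write 7 (.reg 4) (.read 6 (.reg 4) + .const 1))))))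

theorem searchBody_loopFree : searchBody.LoopFree := by
  simp [searchBody, Program.LoopFree]

/-- The state of the search in memory. -/
def Mem.search (s : Mem) : SearchState :=
  ⟨s.reg 1, s.reg 2, s.reg 3, s.arr 6, s.arr 4, s.arr 7, s.arr 8, s.arr 9⟩

theorem searchBody_eval {P : Prefs} {s : Mem} (hs : s.prefs P.len = P) :
    (searchBody.eval s).prefs P.len = P ∧ (searchBody.eval s).search = s.search.step P := by
  have hn : s.reg 0 = P.n := congrArg Prefs.n hs
  have hent : ∀ u i, s.arr 3 (u * P.n + i) = P.ent u i := fun u i => by rw [← hs]; rfl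
  have hrk : ∀ u i, s.arr 5 (u * P.n + i) = P.rk u i := fun u i => by rw [← hs]; rfl
  have hs' : (⟨P.n, P.len, fun u i => s.arr 3 (u * P.n + i), fun u i => s.arr 5 (u * P.n + i)⟩ :
      Prefs) = P := by
    rw [← hn]
    exact hs
  -- the tests of conjunctions and disjunctions by products and sums of differences
  have c₂ : 0 < s.reg 3 * (s.reg 1 - s.arr 8 0) ↔ 0 < s.reg 3 ∧ s.arr 8 0 < s.reg 1 := by
    rw [Nat.pos_iff_ne_zero, mul_ne_zero_iff]
    omega
  have c₃ : 0 < s.arr 6 (s.reg 1) + 1 - s.arr 4 (s.reg 1) +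
      (s.arr 7 (s.reg 1) - s.arr 6 (s.reg 1)) * (s.arr 7 (s.reg 1) + 2 - s.arr 4 (s.reg 1)) ↔
      s.arr 4 (s.reg 1) ≤ s.arr 6 (s.reg 1) ∨
        (s.arr 6 (s.reg 1) < s.arr 7 (s.reg 1) ∧
          s.arr 4 (s.reg 1) ≤ s.arr 7 (s.reg 1) + 1) := by
    rw [Nat.add_pos_iff_pos_or_pos, Nat.pos_iff_ne_zero (n := _ * _), mul_ne_zero_iff]
    omega
  rw [searchBody]
  by_cases h₁ : 0 < s.search.pos s.search.z
  · rw [Program.eval_ifLt_of_lt]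
    swap
    · exact h₁
    rw [SearchState.step, if_pos h₁]
    simp [Program.eval, hn, hent, hrk, Mem.prefs, Mem.search]
  rw [Program.eval_ifLt_of_not_lt]
  swap
  · exact h₁
  rw [SearchState.step, if_neg h₁]
  by_cases h₂ : 0 < s.search.sp ∧ s.search.stk 0 < s.search.o
  · rw [Program.eval_ifLt_of_lt]
    swap
    · exact c₂.2 h₂
    rw [if_pos h₂]
    simp [Program.eval, hn, Mem.prefs, hs', Mem.search]
  rw [Program.eval_ifLt_of_not_lt]
  swap
  · exact mt c₂.1 h₂
  rw [if_neg h₂]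
  by_cases h₃ : s.search.lim s.search.o ≤ s.search.fst s.search.o ∨
      (s.search.fst s.search.o < s.search.sec s.search.o ∧
        s.search.lim s.search.o ≤ s.search.sec s.search.o + 1)
  · rw [Program.eval_ifLt_of_lt]
    swap
    · exact c₃.2 h₃
    rw [if_pos h₃]
    simp [Program.eval, hn, Mem.prefs, hs', Mem.search]
  rw [Program.eval_ifLt_of_not_lt]
  swap
  · exact mt c₃.1 h₃
  rw [if_neg h₃, Program.eval_seq]
  have htop : (Program.ifLt (.const 0) (.reg 3) (.set 4 (.read 8 (.reg 3 - .const 1)))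
      (.set 4 (.reg 1))).eval s = ⟨Function.update s.reg 4 s.search.top, s.arr⟩ := by
    by_cases hsp : s.reg 3 = 0
    · simp [Program.eval, SearchState.top, Mem.search, hsp]
    · simp [Program.eval, SearchState.top, Mem.search, hsp, Nat.pos_of_ne_zero hsp]
  rw [htop]
  have c₅ : ∀ x, (WordTerm.read 5 (.reg 5 * .reg 0 + .reg 4)).eval
        ((Program.set 5 (.read 3 (.reg 4 * .reg 0 + .read 7 (.reg 4)))).eval
          ⟨Function.update s.reg 4 x, s.arr⟩) <
      (WordTerm.read 4 (.reg 5)).eval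
        ((Program.set 5 (.read 3 (.reg 4 * .reg 0 + .read 7 (.reg 4)))).eval
          ⟨Function.update s.reg 4 x, s.arr⟩) ↔ ¬ P.Dead (s.arr 4) x (s.arr 7 x) := by
    intro x
    simp [Program.eval, hn, hent, hrk]
  by_cases h₄ : s.search.sec s.search.top ≤ s.search.fst s.search.top
  · rw [Program.eval_ifLt_of_not_lt]
    swap
    · exact not_lt.2 h₄
    rw [if_pos h₄]
    simp [Program.eval, hn, Mem.prefs, hs', Mem.search]
  rw [Program.eval_ifLt_of_lt]
  swap
  · exact not_le.1 h₄
  rw [if_neg h₄, Program.eval_seq]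
  by_cases h₅ : P.Dead s.search.lim s.search.top (s.search.sec s.search.top)
  · rw [Program.eval_ifLt_of_not_lt]
    swap
    · exact mt (c₅ _).1 (not_not.2 h₅)
    rw [if_pos h₅]
    simp [Program.eval, hn, Mem.prefs, hs', Mem.search]
  rw [Program.eval_ifLt_of_lt]
  swap
  · exact (c₅ _).2 h₅
  rw [if_neg h₅, Program.eval_seq]
  generalize hx : s.search.top = x
  by_cases hsp : s.reg 3 = 0
  · have hsp' : s.search.sp = 0 := hsp
    by_cases h₆ : s.arr 9 (s.reg 1) = 0
    · simp [Program.eval, hn, Mem.prefs, hs', Mem.search, hsp, h₆]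
    · simp [Program.eval, hn, Mem.prefs, hs', Mem.search, hsp, Nat.pos_of_ne_zero h₆]
  · have hsp' : 0 < s.reg 3 := by omega
    by_cases h₆ : s.arr 9 (P.succ (s.arr 4) (s.arr 7) x) = 0
    · simp [Program.eval, hn, Mem.prefs, Mem.search, hsp, h₆, hsp', hent, hrk]
    · simp [Program.eval, hn, Mem.prefs, Mem.search, hsp, hsp', hent, hrk,
        Nat.pos_of_ne_zero h₆]

/-- Adds one to the doubled weights of the pair of agent `x`, from register `1`, and her first
entry, in both cells of array `2` that belong to the pair. -/
def outputBody : Program :=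
  .seq (.ifLt (.read 6 (.reg 1)) (.read 4 (.reg 1))
      (.seq (.set 5 (.read 3 (.reg 1 * .reg 0 + .read 6 (.reg 1))))
        (.seq (.write 2 (.reg 1 * .reg 0 + .reg 5)
            (.read 2 (.reg 1 * .reg 0 + .reg 5) + .const 1))
          (.write 2 (.reg 5 * .reg 0 + .reg 1)
            (.read 2 (.reg 5 * .reg 0 + .reg 1) + .const 1))))
      .skip)
    (.set 1 (.reg 1 + .const 1))

theorem outputBody_loopFree : outputBody.LoopFree := by
  simp [outputBody, Program.LoopFree]

/-- Cells of a matrix with `n` columns, stored row by row, are determined by row and column. -/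
theorem cell_inj {n u v x y : ℕ} (hv : v < n) (hy : y < n) (h : u * n + v = x * n + y) :
    u = x ∧ v = y := by
  have hn : 0 < n := by omega
  have h₁ : (u * n + v) / n = (x * n + y) / n := by rw [h]
  rw [Nat.add_comm, Nat.add_mul_div_right _ _ hn, Nat.div_eq_of_lt hv, Nat.add_comm (x * n),
    Nat.add_mul_div_right _ _ hn, Nat.div_eq_of_lt hy] at h₁
  obtain rfl : u = x := by omega
  exact ⟨rfl, by omega⟩

/-- `x` points at `y` in the final table. -/
def Prefs.Points (P : Prefs) (fst lim : ℕ → ℕ) (x y : ℕ) : Prop :=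
  fst x < lim x ∧ P.first fst x = y

open scoped Classical in
/-- The doubled weights contributed by the agents below `i`. -/
noncomputable def Prefs.doubled (P : Prefs) (fst lim : ℕ → ℕ) (i u v : ℕ) : ℕ :=
  (if u < i ∧ P.Points fst lim u v then 1 else 0) +
    if v < i ∧ P.Points fst lim v u then 1 else 0

theorem outputBody_step {P : Prefs} (hP : P.Valid) {fst lim : ℕ → ℕ} (hT : P.IsTable fst lim)
    {s : Mem} (hs : s.prefs P.len = P) (hfst : s.arr 6 = fst) (hlim : s.arr 4 = lim)
    (hout : ∀ u v, u < P.n → v < P.n → s.arr 2 (u * P.n + v) = P.doubled fst lim (s.reg 1) u v)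
    (hc : s.reg 1 < s.reg 0) :
    (outputBody.eval s).reg 1 = s.reg 1 + 1 ∧
      ∀ u v, u < P.n → v < P.n →
        (outputBody.eval s).arr 2 (u * P.n + v) = P.doubled fst lim (s.reg 1 + 1) u v := by
  classical
  have hn : s.reg 0 = P.n := congrArg Prefs.n hs
  have hent : ∀ u i, s.arr 3 (u * P.n + i) = P.ent u i := fun u i => by rw [← hs]; rfl
  rw [hn] at hc
  generalize hx : s.reg 1 = x at *
  by_cases h : fst x < lim x
  · have hy := hT.first_lt hP hc h
    simp only [Prefs.first] at hy
    constructor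
    · simp [outputBody, Program.eval, hx, hfst, hlim, h]
    · intro u v hu hv
      have h₁ := hout u v hu hv
      have c₁ : u * P.n + v = x * P.n + P.ent x (fst x) ↔ u = x ∧ v = P.ent x (fst x) :=
        ⟨cell_inj hv hy, fun ⟨h, h'⟩ => by rw [h, h']⟩
      have c₂ : u * P.n + v = P.ent x (fst x) * P.n + x ↔ u = P.ent x (fst x) ∧ v = x :=
        ⟨cell_inj hv hc, fun ⟨h, h'⟩ => by rw [h, h']⟩
      have c₃ : P.ent x (fst x) * P.n + x = x * P.n + P.ent x (fst x) ↔ x = P.ent x (fst x) :=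
        ⟨fun h => (cell_inj hc hy h).2, fun h => by rw [← h]⟩
      simp only [outputBody, Program.eval, WordTerm.eval_read, WordTerm.eval_reg, hx, hfst, hlim,
        if_pos h, WordTerm.eval_add, WordTerm.eval_mul, WordTerm.eval_const]
      simp [hx, hn, hent]
      simp only [Function.update_apply, c₁, c₂, c₃, h₁, Prefs.doubled]
      have hpx : ∀ w, (x < x + 1 ∧ P.Points fst lim x w) ↔ w = P.ent x (fst x) := fun w =>
        ⟨fun h' => h'.2.2.symm, fun h' => ⟨Nat.lt_succ_self x, h, h'.symm⟩⟩
      have hpw : ∀ u w, u ≠ x → ((u < x + 1 ∧ P.Points fst lim u w) ↔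
          (u < x ∧ P.Points fst lim u w)) := fun u w hne =>
        and_congr_left fun _ => by omega
      have a₁ := hout x (P.ent x (fst x)) hc hy
      have a₂ := hout (P.ent x (fst x)) x hy hc
      simp only [Prefs.doubled, lt_irrefl, false_and, if_false, Nat.zero_add, Nat.add_zero]
        at a₁ a₂
      rw [a₁, a₂]
      clear h₁ c₁ c₂ c₃ a₁ a₂
      generalize P.ent x (fst x) = y at *
      rcases eq_or_ne u x with rfl | hu'
      · simp only [hpx v]
        rcases eq_or_ne v u with rfl | hv'
        · simp only [hpx v]
          rcases eq_or_ne v y with rfl | hvy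
          · simp
          · simp [hvy]
        · simp only [hpw v u hv']
          rcases eq_or_ne v y with rfl | hvy
          · simp [hv', hv'.symm, Nat.add_comm]
          · simp [hv', hvy]
      · simp only [hpw u v hu']
        rcases eq_or_ne v x with rfl | hv'
        · simp only [hpx u]
          rcases eq_or_ne u y with rfl | huy
          · simp [hu'.symm]
          · simp [hu', huy]
        · simp only [hpw v u hv']
          simp [hu', hv']
  · constructor
    · simp [outputBody, Program.eval, hx, hfst, hlim, h]
    · intro u v hu hv
      simp [outputBody, Program.eval, hx, hfst, hlim, h]
      rw [hout u v hu hv, Prefs.doubled, Prefs.doubled]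
      have : ∀ u v, (u < x + 1 ∧ P.Points fst lim u v) ↔ (u < x ∧ P.Points fst lim u v) := by
        intro u v
        constructor
        · rintro ⟨h₁, h₂⟩
          refine ⟨?_, h₂⟩
          rcases Nat.lt_succ_iff_lt_or_eq.1 h₁ with h₁ | rfl
          · exact h₁
          · exact absurd h₂.1 h
        · exact fun h => ⟨by omega, h.2⟩
      simp only [this]

/-- Computes the doubled matching of a stable partition in array `2`, from the preference lists in
the arrays `3` and `5` and their lengths in array `4`. -/
def partitionProgram : Program :=
  .seq (.seq (.set 1 (.const 0)) (.set 2 (.const 1)))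
    (.seq (.whileLt (.reg 1) (.reg 0) proposalBody)
      (.seq (.seq (.set 1 (.const 0)) (.seq (.set 2 (.reg 0)) (.set 3 (.const 0))))
        (.seq (.whileLt (.reg 1) (.reg 0) searchBody)
          (.seq (.set 1 (.const 0)) (.whileLt (.reg 1) (.reg 0) outputBody)))))

theorem partitionProgram_slow : partitionProgram.Slow := by
  simp [partitionProgram, proposalBody, searchBody, outputBody, Program.Slow]

/-- The factor in the time bound for `partitionProgram`. -/
def partitionFactor : ℕ :=
  10 * (100 + proposalBody.maxCost + searchBody.maxCost + outputBody.maxCost)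

/-- What `partitionProgram` leaves in memory: the doubled matching that belongs to a table in
which no list has more than two live entries. -/
def HoldsTable (P : Prefs) (s : Mem) : Prop :=
  ∃ fst lim, P.IsTable fst lim ∧ (∀ x < P.n, SearchState.Short P lim x) ∧
    ∀ u v, u < P.n → v < P.n → s.arr 2 (u * P.n + v) = P.doubled fst lim P.n u v

theorem sum_range_le {n b : ℕ} {f : ℕ → ℕ} (h : ∀ u < n, f u ≤ b) :
    ∑ u ∈ range n, f u ≤ n * b := by
  simpa using sum_le_card_nsmul (range n) f b fun u hu => h u (mem_range.1 hu)

theorem partitionProgram_reaches {P : Prefs} (hP : P.Valid) {s : Mem} (hs : s.prefs P.len = P)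
    (hlen : s.arr 4 = P.len) (hzero : ∀ a ∈ [2, 6, 7, 9], s.arr a = fun _ => 0) :
    Reaches partitionProgram s (partitionFactor * (P.n + 1) ^ 2) (HoldsTable P) := by
  have hn : s.reg 0 = P.n := congrArg Prefs.n hs
  have hsum : ∀ f : ℕ → ℕ, ∑ u ∈ range P.n, (P.n - f u) ≤ P.n * P.n := fun f =>
    sum_range_le fun u _ => Nat.sub_le _ _
  have hprefs : ∀ {t : Mem}, t.reg 0 = P.n → t.arr 3 = s.arr 3 → t.arr 5 = s.arr 5 →
      t.prefs P.len = P := by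
    intro t h₀ h₃ h₅
    rw [← hs]
    simp only [Mem.prefs, h₀, hn, h₃, h₅]
  -- proposals
  have l₁ : ∀ t : Mem, (t.prefs P.len = P ∧ t.arr 4 = P.len ∧ (∀ x, t.arr 6 x = 0) ∧
      t.reg 1 = 0 ∧ t.reg 2 = 1) →
      Reaches (.whileLt (.reg 1) (.reg 0) proposalBody) t
        ((P.n * P.n + P.n * P.n + P.n + 1) * (3 + proposalBody.maxCost))
        (fun t' => t'.prefs P.len = P ∧ P.IsTable (t'.arr 6) (t'.arr 4)) := by
    rintro t ⟨h₁, h₂, h₃, h₄, h₅⟩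
    have hinv : t.prefs P.len = P ∧ P.ProposalInv (t.arr 6) (t.arr 4) (t.reg 1) (t.reg 2) := by
      refine ⟨h₁, ?_⟩
      rw [h₂, h₄, h₅, funext h₃]
      exact .init
    have h := Reaches.whileLt (e := .reg 1) (f := .reg 0) proposalBody_loopFree
      (fun t => t.prefs P.len = P ∧ P.ProposalInv (t.arr 6) (t.arr 4) (t.reg 1) (t.reg 2))
      (fun t => Prefs.ProposalInv.potential P (t.arr 6) (t.arr 4) (t.reg 2))
      (fun t ht hc => proposalBody_step hP ht.1 ht.2 hc) hinv
    refine h.mono ?_ fun t' ⟨⟨h₆, h₇⟩, h₈⟩ => ⟨h₆, h₇.isTable hP ?_⟩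
    · refine Nat.mul_le_mul ?_ le_rfl
      have h₆ := hsum (t.arr 6)
      have h₇ : ∑ u ∈ range P.n, t.arr 4 u ≤ P.n * P.n := sum_range_le fun u hu => by
        rw [h₂]
        exact hP.len_le hu
      simp only [Prefs.ProposalInv.potential, h₅]
      omega
    · have : t'.reg 0 = P.n := congrArg Prefs.n h₆
      rw [← this]
      exact not_lt.1 h₈
  -- rotations
  have l₂ : ∀ t : Mem, (t.prefs P.len = P ∧ P.IsTable (t.arr 6) (t.arr 4) ∧
      (∀ x, t.arr 7 x = 0) ∧ (∀ x, t.arr 9 x = 0) ∧ t.reg 1 = 0 ∧ t.reg 3 = 0) →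
      Reaches (.whileLt (.reg 1) (.reg 0) searchBody) t
        ((4 * (P.n * P.n) + P.n * P.n + P.n * (3 * P.n + 5) + 2 * P.n + 2) *
          (3 + searchBody.maxCost))
        (fun t' => t'.prefs P.len = P ∧ P.IsTable (t'.arr 6) (t'.arr 4) ∧
          ∀ x < P.n, SearchState.Short P (t'.arr 4) x) := by
    rintro t ⟨h₁, h₂, h₃, h₄, h₅, h₆⟩
    have hinv : t.prefs P.len = P ∧ t.search.Inv P := by
      refine ⟨h₁, Or.inl ?_⟩
      rw [Mem.search, h₅, h₆]
      exact .init h₂ h₃ h₄ _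
    have h := Reaches.whileLt (e := .reg 1) (f := .reg 0) searchBody_loopFree
      (fun t => t.prefs P.len = P ∧ t.search.Inv P)
      (fun t => t.search.potential P)
      (fun t ht hc => by
        obtain ⟨e₁, e₂⟩ := searchBody_eval ht.1
        have hc' : t.search.o < P.n := by
          rw [← (congrArg Prefs.n ht.1 : t.reg 0 = P.n)]
          exact hc
        rw [e₂]
        exact ⟨⟨e₁, (ht.2.step hP hc').1⟩, (ht.2.step hP hc').2⟩) hinv
    refine h.mono ?_ fun t' ⟨⟨h₇, h₈⟩, h₉⟩ => ⟨h₇, ?_⟩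
    · refine Nat.mul_le_mul ?_ le_rfl
      have h₇ := hsum (t.arr 6)
      have h₈ := hsum (t.arr 7)
      simp only [SearchState.potential, Mem.search, h₅, h₆, lt_irrefl, false_and, if_false, h₄,
        if_true, Nat.sub_zero]
      omega
    · have hn' : t'.reg 0 = P.n := congrArg Prefs.n h₇
      have h₁₀ : P.n ≤ t'.search.o := by
        rw [← hn']
        exact not_lt.1 h₉
      rcases h₈ with h₈ | ⟨fst₀, lim₀, i, m, h₈⟩
      · exact ⟨h₈.table, fun x hx => h₈.done hx (by omega)⟩
      · have := h₈.stack.lt (Nat.zero_lt_of_lt h₈.lt_sp)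
        rw [h₈.bottom] at this
        omega
  -- output
  have l₃ : ∀ t : Mem, (t.prefs P.len = P ∧ P.IsTable (t.arr 6) (t.arr 4) ∧
      (∀ x < P.n, SearchState.Short P (t.arr 4) x) ∧ (∀ x, t.arr 2 x = 0) ∧ t.reg 1 = 0) →
      Reaches (.whileLt (.reg 1) (.reg 0) outputBody) t
        ((P.n + 1) * (3 + outputBody.maxCost)) (HoldsTable P) := by
    rintro t ⟨h₁, h₂, h₃, h₄, h₅⟩
    have hn' : t.reg 0 = P.n := congrArg Prefs.n h₁
    have h := Reaches.whileLt (e := .reg 1) (f := .reg 0) outputBody_loopFree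
      (fun t' => t'.prefs P.len = P ∧ t'.arr 6 = t.arr 6 ∧ t'.arr 4 = t.arr 4 ∧ t'.reg 1 ≤ P.n ∧
        ∀ u v, u < P.n → v < P.n →
          t'.arr 2 (u * P.n + v) = P.doubled (t.arr 6) (t.arr 4) (t'.reg 1) u v)
      (fun t' => P.n - t'.reg 1)
      (fun t' ⟨g₁, g₂, g₃, g₄, g₅⟩ hc => by
        obtain ⟨e₁, e₂⟩ := outputBody_step hP h₂ g₁ g₂ g₃ g₅ hc
        have g₀ : t'.reg 0 = P.n := congrArg Prefs.n g₁
        have hc' : t'.reg 1 < P.n := g₀ ▸ hc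
        obtain ⟨c, -, he⟩ := FreeExec.of_loopFree outputBody_loopFree t'
        have f₀ := he.reg_eq (r := 0) (by simp [outputBody, Program.SetsReg])
        have f₃ := he.arr_eq (a := 3) (by simp [outputBody, Program.WritesArr])
        have f₄ := he.arr_eq (a := 4) (by simp [outputBody, Program.WritesArr])
        have f₅ := he.arr_eq (a := 5) (by simp [outputBody, Program.WritesArr])
        have f₆ := he.arr_eq (a := 6) (by simp [outputBody, Program.WritesArr])
        refine ⟨⟨?_, f₆.trans g₂, f₄.trans g₃, by omega, by rw [e₁]; exact e₂⟩, by omega⟩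
        rw [← g₁]
        simp only [Mem.prefs, f₀, f₃, f₅])
      (s := t) ⟨h₁, rfl, rfl, by omega, fun u v _ _ => by
        rw [h₄, h₅]
        simp [Prefs.doubled]⟩
    refine h.mono ?_ fun t' ⟨⟨g₁, g₂, g₃, g₄, g₅⟩, g₆⟩ => ⟨_, _, h₂, h₃, ?_⟩
    · refine Nat.mul_le_mul ?_ le_rfl
      omega
    · have g₀ : t'.reg 0 = P.n := congrArg Prefs.n g₁
      rcases g₄.eq_or_lt with heq | hlt
      · rwa [heq] at g₅
      · rw [← g₀] at hlt
        exact absurd hlt g₆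
  have k₁ : Reaches (.seq (.set 1 (.const 0)) (.set 2 (.const 1))) s 4
      (fun t => t.arr = s.arr ∧ t.reg 0 = P.n ∧ t.reg 1 = 0 ∧ t.reg 2 = 1) :=
    (Reaches.of_loopFree (by simp [Program.LoopFree]) (by simp [Program.eval, hn])).mono
      le_rfl fun _ h => h
  have k₂ : ∀ t : Mem, Reaches (.seq (.set 1 (.const 0)) (.seq (.set 2 (.reg 0))
      (.set 3 (.const 0)))) t 6
      (fun t' => t'.arr = t.arr ∧ t'.reg 0 = t.reg 0 ∧ t'.reg 1 = 0 ∧ t'.reg 3 = 0) := fun t =>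
    (Reaches.of_loopFree (by simp [Program.LoopFree]) (by simp [Program.eval])).mono
      le_rfl fun _ h => h
  have k₃ : ∀ t : Mem, Reaches (.set 1 (.const 0)) t 2
      (fun t' => t'.arr = t.arr ∧ t'.reg 0 = t.reg 0 ∧ t'.reg 1 = 0) := fun t =>
    (Reaches.of_loopFree (by simp [Program.LoopFree]) (by simp [Program.eval])).mono
      le_rfl fun _ h => h
  have main : Reaches partitionProgram s (4 +
      ((P.n * P.n + P.n * P.n + P.n + 1) * (3 + proposalBody.maxCost) + (6 +
      ((4 * (P.n * P.n) + P.n * P.n + P.n * (3 * P.n + 5) + 2 * P.n + 2) *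
        (3 + searchBody.maxCost) + (2 + (P.n + 1) * (3 + outputBody.maxCost))))))
      (HoldsTable P) := by
    refine k₁.seq fun t₁ ⟨a₁, b₀, b₁, b₂⟩ => ?_
    refine ((l₁ t₁ ⟨hprefs b₀ (by rw [a₁]) (by rw [a₁]), by rw [a₁, hlen],
      fun x => by rw [a₁, hzero 6 (by simp)], b₁, b₂⟩).frame).seq fun t₂ ⟨⟨c₁, c₂⟩, c₃, c₄⟩ => ?_
    refine (k₂ t₂).seq fun t₃ ⟨a₃, d₀, d₁, d₂⟩ => ?_
    have e₂ : t₂.reg 0 = P.n := congrArg Prefs.n c₁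
    have z₂ : ∀ a ∈ [2, 7, 9], t₂.arr a = fun _ => 0 := fun a ha => by
      rw [c₃ a (by
        simp only [List.mem_cons, List.not_mem_nil, or_false] at ha
        rcases ha with rfl | rfl | rfl <;> simp [proposalBody, Program.WritesArr]), a₁]
      exact hzero a (by
        simp only [List.mem_cons, List.not_mem_nil, or_false] at ha ⊢
        omega)
    have p₃ : t₃.prefs P.len = P := by
      rw [← c₁]
      simp only [Mem.prefs, a₃, d₀]
    refine ((l₂ t₃ ⟨p₃, by rw [a₃]; exact c₂, fun x => by rw [a₃, z₂ 7 (by simp)],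
      fun x => by rw [a₃, z₂ 9 (by simp)], d₁, d₂⟩).frame).seq fun t₄ ⟨⟨f₁, f₂, f₃⟩, f₄, f₅⟩ => ?_
    refine (k₃ t₄).seq fun t₅ ⟨a₅, g₀, g₁⟩ => ?_
    refine l₃ t₅ ⟨?_, by rw [a₅]; exact f₂, by rw [a₅]; exact f₃, fun x => ?_, g₁⟩
    · rw [← f₁]
      simp only [Mem.prefs, a₅, g₀]
    · rw [a₅, f₄ 2 (by simp [searchBody, Program.WritesArr]), a₃, z₂ 2 (by simp)]
  refine main.mono ?_ fun _ h => h
  simp only [partitionFactor]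
  generalize proposalBody.maxCost = a
  generalize searchBody.maxCost = b
  generalize outputBody.maxCost = c
  nlinarith [Nat.zero_le (a * P.n), Nat.zero_le (b * P.n), Nat.zero_le (c * P.n),
    Nat.zero_le (a * P.n ^ 2), Nat.zero_le (b * P.n ^ 2), Nat.zero_le (c * P.n ^ 2)]

/-! ### From short tables to stable partitions -/

open scoped Classical in
/-- The satisfaction function given by preference lists: the number of entries of the list of `u`
from `v` on, and `0` if `v` is not in the list. -/
noncomputable def listSat {V : Type*} (L : V → List V) (u v : V) : ℝ :=
  (((L u).length - (L u).idxOf v : ℕ) : ℝ)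

open scoped Classical in
theorem listSat_lt_iff {V : Type*} {L : V → List V} {u v w : V} (hv : v ∈ L u) :
    listSat L u w < listSat L u v ↔ (L u).idxOf v < (L u).idxOf w := by
  have h₁ := List.idxOf_lt_length_iff.2 hv
  have h₂ := List.idxOf_le_length (a := w) (l := L u)
  rw [listSat, listSat, Nat.cast_lt]
  omega

/-- The numbers in `P` describe the preference lists `L`. -/
structure Prefs.Represents (P : Prefs) {n : ℕ} (L : Fin n → List (Fin n)) : Prop where
  n_eq : P.n = n
  len_eq : ∀ u : Fin n, P.len u = (L u).length
  ent_eq : ∀ (u : Fin n) (i : ℕ) (h : i < (L u).length), P.ent u i = ((L u)[i] : Fin n)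
  rk_eq : ∀ (u : Fin n) (i : ℕ) (h : i < (L u).length), P.rk u ((L u)[i] : Fin n) = i

/-- The lists `L` contain the neighbours in `G`, each once. -/
structure IsAdjacencyLists {V : Type*} (G : SimpleGraph V) (L : V → List V) : Prop where
  nodup : ∀ u, (L u).Nodup
  mem_iff : ∀ u v, v ∈ L u ↔ G.Adj u v

namespace Prefs.Represents

variable {P : Prefs} {n : ℕ} {L : Fin n → List (Fin n)} {G : SimpleGraph (Fin n)}

theorem rk_lt_of_adj (h : P.Represents L) (hL : IsAdjacencyLists G L) {u v : Fin n}
    (huv : G.Adj u v) : P.rk u v < P.len u ∧ P.ent u (P.rk u v) = v := by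
  obtain ⟨i, hi, rfl⟩ := List.getElem_of_mem ((hL.mem_iff u v).2 huv)
  rw [h.rk_eq u i hi, h.len_eq]
  exact ⟨hi, h.ent_eq u i hi⟩

theorem rk_eq_idxOf (h : P.Represents L) (hL : IsAdjacencyLists G L) {u v : Fin n}
    (huv : G.Adj u v) [DecidableEq (Fin n)] : P.rk u v = (L u).idxOf v := by
  obtain ⟨i, hi, rfl⟩ := List.getElem_of_mem ((hL.mem_iff u v).2 huv)
  rw [h.rk_eq u i hi, (hL.nodup u).idxOf_getElem]

theorem exists_adj (h : P.Represents L) (hL : IsAdjacencyLists G L) {u : Fin n} {i : ℕ}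
    (hi : i < P.len u) : ∃ v : Fin n, P.ent u i = v ∧ G.Adj u v ∧ P.rk u v = i := by
  rw [h.len_eq] at hi
  exact ⟨_, h.ent_eq u i hi, (hL.mem_iff _ _).1 (List.getElem_mem hi), h.rk_eq u i hi⟩

theorem valid (h : P.Represents L) (hL : IsAdjacencyLists G L) : P.Valid := by
  have key : ∀ {u i}, u < P.n → i < P.len u → P.ent u i < P.n ∧ P.rk u (P.ent u i) = i ∧
      P.rk (P.ent u i) u < P.len (P.ent u i) ∧ P.ent (P.ent u i) (P.rk (P.ent u i) u) = u := by
    intro u i hu hi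
    rw [h.n_eq] at hu ⊢
    lift u to Fin n using hu
    obtain ⟨v, h₁, h₂, h₃⟩ := h.exists_adj hL hi
    rw [h₁]
    exact ⟨v.2, h₃, h.rk_lt_of_adj hL h₂.symm⟩
  refine ⟨fun hu hi => (key hu hi).1, fun {u} hu => ?_, fun hu hi => (key hu hi).2.1,
    fun hu hi => (key hu hi).2.2.1, fun hu hi => (key hu hi).2.2.2⟩
  rw [h.n_eq] at hu ⊢
  lift u to Fin n using hu
  rw [h.len_eq]
  simpa using (hL.nodup u).length_le_card

/-- In a table with at most two live entries per list, mapping each agent to her first entry is a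
stable partition; the inverse maps each agent to her last entry. -/
theorem exists_stablePartition (h : P.Represents L) (hL : IsAdjacencyLists G L)
    {fst lim : ℕ → ℕ} (hT : P.IsTable fst lim) (hS : ∀ x < P.n, SearchState.Short P lim x) :
    ∃ π : Equiv.Perm (Fin n), IsStablePartition G (listSat L) π ∧
      ∀ u v : Fin n, P.Points fst lim u v ↔ π u = v ∧ u ≠ v := by
  classical
  have hP := h.valid hL
  have hlt : ∀ u : Fin n, (u : ℕ) < P.n := fun u => h.n_eq ▸ u.2
  -- the first entry of an active agent
  have hfirst : ∀ u : Fin n, fst u < lim u → ∃ v : Fin n, P.first fst u = v ∧ G.Adj u v ∧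
      P.rk u v = fst u := fun u hu => h.exists_adj hL (hT.lt_len (hlt u) hu)
  let f : Fin n → Fin n := fun u =>
    if hu : fst u < lim u then (hfirst u hu).choose else u
  have hf : ∀ u : Fin n, fst u < lim u → P.first fst u = f u ∧ G.Adj u (f u) ∧
      P.rk u (f u) = fst u := fun u hu => by
    simp only [f, dif_pos hu]
    exact (hfirst u hu).choose_spec
  have hf' : ∀ u : Fin n, ¬ fst u < lim u → f u = u := fun u hu => dif_neg hu
  have hact : ∀ u : Fin n, fst u < lim u ↔ fst (f u) < lim (f u) := by
    intro u
    by_cases hu : fst u < lim u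
    · refine iff_of_true hu ?_
      rw [← (hf u hu).1]
      exact hT.first_active hP (hlt u) hu
    · rw [hf' u hu]
  have hinj : Function.Injective f := by
    intro u v huv
    have h₁ := hact u
    rw [huv, ← hact v] at h₁
    by_cases hu : fst u < lim u
    · have hv := h₁.1 hu
      exact Fin.ext (hT.first_inj hP (hlt u) (hlt v) hu hv
        (by rw [(hf u hu).1, (hf v hv).1, huv]))
    · rwa [hf' u hu, hf' v (mt h₁.2 hu)] at huv
  let π : Equiv.Perm (Fin n) := Equiv.ofBijective f (Finite.injective_iff_bijective.1 hinj)
  have hπ : ∀ u, π u = f u := fun u => rfl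
  have hinv : ∀ v : Fin n, fst v < lim v → G.Adj v (π⁻¹ v) ∧ P.rk v (π⁻¹ v) = lim v - 1 := by
    intro v hv
    obtain ⟨u, rfl⟩ := (Finite.injective_iff_bijective.1 hinj).2 v
    have hu := (hact u).2 hv
    have h₁ : π⁻¹ (f u) = u := π.symm_apply_apply u
    have h₂ := hT.rk_first (hlt u) hu
    rw [(hf u hu).1] at h₂
    rw [h₁]
    exact ⟨(hf u hu).2.1.symm, by omega⟩
  have hinv' : ∀ v : Fin n, ¬ fst v < lim v → π⁻¹ v = v := fun v hv =>
    (Equiv.symm_apply_eq π).2 (hf' v hv).symm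
  have hsat : ∀ {u v w : Fin n}, G.Adj u v → G.Adj u w →
      (listSat L u w < listSat L u v ↔ P.rk u v < P.rk u w) := by
    intro u v w hv hw
    rw [h.rk_eq_idxOf hL hv, h.rk_eq_idxOf hL hw]
    convert listSat_lt_iff ((hL.mem_iff u v).2 hv)
  refine ⟨π, ⟨fun v hv => ?_, fun v hv => ?_, fun u v huv hne hu => ?_⟩, fun u v => ?_⟩
  · have : fst v < lim v := by
      by_contra h'
      exact hv (hf' v h')
    exact (hf v this).2.1
  · have hact' : fst v < lim v := by
      by_contra h'
      exact hv (by rw [hinv' v h', hπ, hf' v h'])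
    obtain ⟨h₁, h₂⟩ := hinv v hact'
    obtain ⟨-, h₃, h₄⟩ := hf v hact'
    rw [hπ, hsat h₃ h₁, h₂, h₄]
    refine lt_of_le_of_ne (by omega) fun he => hv ?_
    have e₁ := (h.rk_lt_of_adj hL h₁).2
    have e₂ := (h.rk_lt_of_adj hL h₃).2
    rw [h₂, ← he] at e₁
    rw [h₄] at e₂
    exact Fin.ext (e₂.symm.trans e₁)
  · -- the pair of `u` and `v` is dead, since it would be a third live entry of `u`
    obtain ⟨hrl, hre⟩ := h.rk_lt_of_adj hL huv
    have hdead : lim v ≤ P.rk v u := by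
      have hdead_of_lt : P.rk u v < fst u → lim v ≤ P.rk v u := fun h' => by
        have := hT.dead_before (hlt u) h' hrl
        rwa [Prefs.Dead, hre] at this
      by_cases hu' : fst u < lim u
      · obtain ⟨h₁, h₂⟩ := hinv u hu'
        obtain ⟨-, h₃, h₄⟩ := hf u hu'
        have h₅ : P.rk u v < P.rk u (π⁻¹ u) := by
          rcases hu with hu | hu
          · exact absurd hu fun he => h₃.ne (by rw [← hπ, he])
          · rwa [hsat huv h₁] at hu
        rw [h₂] at h₅
        rcases lt_trichotomy (P.rk u v) (fst u) with h₆ | h₆ | h₆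
        · exact hdead_of_lt h₆
        · refine absurd ?_ hne
          have e₁ := (h.rk_lt_of_adj hL h₃).2
          rw [h₄, ← h₆, hre] at e₁
          exact Fin.ext e₁
        · by_contra h₇
          have h₈ : ¬ P.Dead lim u (P.rk u v) := by rwa [Prefs.Dead, hre]
          exact hT.not_dead_last hP (hlt u) hu' (hS u (hlt u) h₆ h₅ (by omega)
            (hT.not_dead_first (hlt u) hu') h₈)
      · have hlim := ((hT.settled (hlt u)).resolve_right fun h' => hu' h'.1)
        exact hdead_of_lt (by omega)
    have hv : fst v < lim v := by
      by_contra h'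
      have := ((hT.settled (hlt v)).resolve_right fun h'' => h' h''.1).2
      have := (h.rk_lt_of_adj hL huv.symm).1
      omega
    obtain ⟨h₁, h₂⟩ := hinv v hv
    rw [hsat h₁ huv.symm, h₂]
    omega
  · rw [hπ, Prefs.Points]
    constructor
    · rintro ⟨h₁, h₂⟩
      obtain ⟨e₁, e₂, -⟩ := hf u h₁
      have : f u = v := Fin.ext (e₁.symm.trans h₂)
      exact ⟨this, this ▸ e₂.ne⟩
    · rintro ⟨rfl, hne⟩
      have h₁ : fst u < lim u := by
        by_contra h'
        exact hne (hf' u h').symm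
      exact ⟨h₁, (hf u h₁).1⟩

theorem exists_of_holdsTable (h : P.Represents L) (hL : IsAdjacencyLists G L) {s : Mem}
    (hs : HoldsTable P s) : ∃ π : Equiv.Perm (Fin n), IsStablePartition G (listSat L) π ∧
      HoldsMatching n s (partitionMatching π) := by
  classical
  obtain ⟨fst, lim, hT, hS, hout⟩ := hs
  obtain ⟨π, hπ, hpt⟩ := h.exists_stablePartition hL hT hS
  refine ⟨π, hπ, fun u v => ?_⟩
  have hlt : ∀ u : Fin n, (u : ℕ) < P.n := fun u => h.n_eq ▸ u.2
  have h₁ := hout u v (hlt u) (hlt v)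
  rw [h.n_eq] at h₁
  rw [h₁, Prefs.doubled, partitionMatching]
  simp only [hpt, u.2, v.2, true_and]
  by_cases huv : u = v
  · simp [huv]
  · have hvu : v ≠ u := Ne.symm huv
    by_cases h₂ : π u = v <;> by_cases h₃ : π v = u <;> norm_num [huv, hvu, h₂, h₃]

end Prefs.Represents

/-! ### Tie-breaking -/

section TieBreaking

variable {V : Type*} {G : SimpleGraph V} {sat sat' : V → V → ℝ} {L : V → List V}

theorem IsPreferenceLists.isAdjacencyLists (hL : IsPreferenceLists G sat L) :
    IsAdjacencyLists G L :=
  ⟨hL.nodup, hL.mem_iff⟩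

theorem listSat_pos_iff {u v : V} : 0 < listSat L u v ↔ v ∈ L u := by
  classical
  rw [← List.idxOf_lt_length_iff, listSat, Nat.cast_pos]
  convert Nat.sub_pos_iff_lt

theorem IsAdjacencyLists.isSatisfaction (hL : IsAdjacencyLists G L) :
    IsSatisfaction G (listSat L) where
  nonneg u v := Nat.cast_nonneg _
  self u := by
    refine le_antisymm (not_lt.1 fun h => ?_) (Nat.cast_nonneg _)
    exact G.irrefl ((hL.mem_iff u u).1 (listSat_pos_iff.1 h))
  adj_iff u v := by
    rw [listSat_pos_iff, listSat_pos_iff, hL.mem_iff, hL.mem_iff, G.adj_comm v u, or_self]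

theorem IsAdjacencyLists.isStrict (hL : IsAdjacencyLists G L) : IsStrict G (listSat L) := by
  classical
  intro v x y hx hy hne he
  rw [← hL.mem_iff] at hx hy
  have h₁ := mt (listSat_lt_iff (w := y) hx).2 he.not_gt
  have h₂ := mt (listSat_lt_iff (w := x) hy).2 he.not_lt
  have h₃ : (L v).idxOf x = (L v).idxOf y := le_antisymm (not_lt.1 h₂) (not_lt.1 h₁)
  exact hne ((List.idxOf_inj hx).1 h₃)

theorem IsAdjacencyLists.pairwise_listSat (hL : IsAdjacencyLists G L) (u : V) :
    (L u).Pairwise (fun v w => listSat L u w < listSat L u v) := by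
  classical
  rw [List.pairwise_iff_getElem]
  intro i j hi hj hij
  rw [listSat_lt_iff (List.getElem_mem hi), (hL.nodup u).idxOf_getElem,
    (hL.nodup u).idxOf_getElem]
  exact hij

/-- Preference lists break the ties. -/
theorem IsPreferenceLists.isTieBreaking (hL : IsPreferenceLists G sat L) :
    IsTieBreaking G sat (listSat L) where
  isSatisfaction := hL.isAdjacencyLists.isSatisfaction
  strict := hL.isAdjacencyLists.isStrict
  keeps x y z hy hz hlt := by
    classical
    rw [← hL.mem_iff] at hy hz
    obtain ⟨i, hi, rfl⟩ := List.getElem_of_mem hy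
    obtain ⟨j, hj, rfl⟩ := List.getElem_of_mem hz
    rw [listSat_lt_iff hy, (hL.nodup x).idxOf_getElem, (hL.nodup x).idxOf_getElem]
    by_contra! hji
    rcases hji.eq_or_lt with rfl | hji
    · exact lt_irrefl _ hlt
    · exact hlt.not_ge (List.pairwise_iff_getElem.1 (hL.sorted x) j i hj hi hji)

theorem exists_isPreferenceLists [Fintype V] (G : SimpleGraph V) (sat : V → V → ℝ) :
    ∃ L, IsPreferenceLists G sat L := by
  classical
  refine ⟨fun u => (nbrs G u).toList.insertionSort (fun v w => sat u w ≤ sat u v),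
    fun u => ?_, fun u v => ?_, fun u => ?_⟩
  · exact (List.perm_insertionSort _ _).nodup_iff.2 (nodup_toList _)
  · rw [(List.perm_insertionSort _ _).mem_iff, mem_toList, nbrs, mem_filter]
    simp
  · have : Std.Total (fun v w => sat u w ≤ sat u v) := ⟨fun v w => le_total _ _⟩
    have : IsTrans V (fun v w => sat u w ≤ sat u v) := ⟨fun _ _ _ h h' => h'.trans h⟩
    exact List.pairwise_insertionSort _ _

theorem IsTieBreaking.lt_of_lt (h : IsTieBreaking G sat sat') (hs : IsStrict G sat) {x y z : V}
    (hy : G.Adj x y) (hz : G.Adj x z) (hlt : sat' x z < sat' x y) : sat x z < sat x y := by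
  have hne : z ≠ y := fun he => (he ▸ hlt).false
  refine lt_of_le_of_ne (not_lt.1 fun h' => ?_) (hs x z y hz hy hne)
  exact (h.keeps x z y hz hy h').not_gt hlt

theorem IsStablePartition.adj_inv {π : Equiv.Perm V} (h : IsStablePartition G sat π) {v : V}
    (hv : π⁻¹ v ≠ v) : G.Adj v (π⁻¹ v) := by
  have h₀ : π (π⁻¹ v) = v := π.apply_symm_apply v
  have := h.edge (π⁻¹ v) (by rw [h₀]; exact hv.symm)
  rw [h₀] at this
  exact this.symm

theorem inv_ne_iff {π : Equiv.Perm V} {v : V} : π⁻¹ v ≠ v ↔ π v ≠ v := by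
  rw [ne_eq, ne_eq, Equiv.Perm.inv_eq_iff_eq, eq_comm]

/-- Stable partitions depend only on the preferences between neighbours. -/
theorem IsStablePartition.of_tieBreaking {π : Equiv.Perm V} (h : IsStablePartition G sat' π)
    (ht : IsTieBreaking G sat sat') (hs : IsStrict G sat) : IsStablePartition G sat π where
  edge := h.edge
  prefers v hv := by
    have hv' : π v ≠ v := fun he => hv (by rw [Equiv.Perm.eq_inv_iff_eq, he, he])
    exact ht.lt_of_lt hs (h.edge v hv') (h.adj_inv (inv_ne_iff.2 hv')) (h.prefers v hv)
  stable u v huv hne hu := by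
    have h₁ : sat' v u < sat' v (π⁻¹ v) := by
      refine h.stable u v huv hne ?_
      by_cases hfix : π u = u
      · exact Or.inl hfix
      · have hu' := hu.resolve_left hfix
        exact Or.inr (ht.keeps u v _ huv (h.adj_inv (inv_ne_iff.2 hfix)) hu')
    have h₂ : π⁻¹ v ≠ v := fun he => by
      rw [he, ht.isSatisfaction.self] at h₁
      exact h₁.not_ge (ht.isSatisfaction.nonneg v u)
    exact ht.lt_of_lt hs (h.adj_inv h₂) huv.symm h₁

end TieBreaking

/-! ### The matching of a stable partition -/

section Matching

variable {V : Type*} {G : SimpleGraph V} {sat sat' : V → V → ℝ} {π : Equiv.Perm V}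

/-- Half of the weight of an agent is on her successor, half on her predecessor. -/
theorem partitionMatching_eq [DecidableEq V] {u v : V} (huv : u ≠ v) :
    partitionMatching π u v = (if π u = v then 1 / 2 else 0) + if π⁻¹ u = v then 1 / 2 else 0 := by
  have : (π⁻¹ u = v) ↔ π v = u := by rw [Equiv.Perm.inv_eq_iff_eq, eq_comm]
  rw [partitionMatching, if_neg huv]
  simp only [this]
  by_cases h₁ : π u = v <;> by_cases h₂ : π v = u <;> norm_num [h₁, h₂]

theorem partitionMatching_comm (u v : V) : partitionMatching π u v = partitionMatching π v u := by
  rcases eq_or_ne u v with rfl | huv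
  · rfl
  · rw [partitionMatching, partitionMatching, if_neg huv, if_neg huv.symm]
    by_cases h₁ : π u = v <;> by_cases h₂ : π v = u <;> simp [h₁, h₂]

theorem partitionMatching_nonneg (u v : V) : 0 ≤ partitionMatching π u v := by
  rw [partitionMatching]
  split_ifs <;> norm_num

theorem mem_nbrs [Fintype V] {u v : V} : v ∈ nbrs G u ↔ G.Adj u v := by
  simp [nbrs]

/-- Weighted sums over a set of neighbours that contains both partners. -/
theorem sum_mul_partitionMatching {s : Finset V} {g : V → ℝ} {u : V} (hs : u ∉ s)
    (h₁ : π u ∈ s) (h₂ : π⁻¹ u ∈ s) :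
    ∑ v ∈ s, g v * partitionMatching π u v = (g (π u) + g (π⁻¹ u)) / 2 := by
  classical
  have : ∀ v ∈ s, g v * partitionMatching π u v =
      (if π u = v then g v / 2 else 0) + if π⁻¹ u = v then g v / 2 else 0 := by
    intro v hv
    rw [partitionMatching_eq fun h => hs (by rw [h]; exact hv)]
    split_ifs <;> ring
  rw [sum_congr rfl this, sum_add_distrib, sum_ite_eq, sum_ite_eq, if_pos h₁, if_pos h₂]
  ring

theorem sum_partitionMatching {s : Finset V} {u : V} (hs : u ∉ s) (h₁ : π u ∈ s)
    (h₂ : π⁻¹ u ∈ s) : ∑ v ∈ s, partitionMatching π u v = 1 := by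
  have := sum_mul_partitionMatching (g := fun _ => 1) hs h₁ h₂
  simp only [one_mul] at this
  rw [this]
  norm_num

namespace IsStablePartition

variable (h : IsStablePartition G sat' π)

include h

theorem partitionMatching_off_edge {u v : V} (huv : ¬ G.Adj u v) :
    partitionMatching π u v = 0 := by
  rw [partitionMatching]
  split_ifs with h₁ h₂ h₃
  · rfl
  · exact absurd (h₂.1 ▸ h.edge u (by rw [h₂.1]; exact Ne.symm h₁)) huv
  · rcases h₃ with h₃ | h₃
    · exact absurd (h₃ ▸ h.edge u (by rw [h₃]; exact Ne.symm h₁)) huv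
    · exact absurd (h₃ ▸ h.edge v (by rw [h₃]; exact h₁)).symm huv
  · rfl

variable [Fintype V]

theorem mem_nbrs_of_ne {u : V} (hu : π u ≠ u) : π u ∈ nbrs G u ∧ π⁻¹ u ∈ nbrs G u :=
  ⟨mem_nbrs.2 (h.edge u hu), mem_nbrs.2 (h.adj_inv (inv_ne_iff.2 hu))⟩

theorem sum_eq_one {u : V} (hu : π u ≠ u) : ∑ v ∈ nbrs G u, partitionMatching π u v = 1 :=
  sum_partitionMatching (fun h' => G.irrefl (mem_nbrs.1 h')) (h.mem_nbrs_of_ne hu).1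
    (h.mem_nbrs_of_ne hu).2

omit h in
theorem sum_eq_zero {u : V} (hu : π u = u) : ∑ v ∈ nbrs G u, partitionMatching π u v = 0 := by
  classical
  refine Finset.sum_eq_zero fun v hv => ?_
  have hne := (mem_nbrs.1 hv).ne
  have hu' : π⁻¹ u = u := by
    by_contra h'
    exact inv_ne_iff.1 h' hu
  rw [partitionMatching_eq hne, hu, hu']
  simp [hne]

/-- An agent who weakly prefers both partners to `v` does not take part in blocking. -/
theorem not_blocking {u v : V} (hu : π u ≠ u) (h₁ : sat u v ≤ sat u (π u))
    (h₂ : sat u v ≤ sat u (π⁻¹ u)) :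
    ¬ weightAtLeast G sat (partitionMatching π) u v < 1 ∧
      ¬ utility G sat (partitionMatching π) u < sat u v := by
  classical
  obtain ⟨m₁, m₂⟩ := h.mem_nbrs_of_ne hu
  have hirr : u ∉ nbrs G u := fun h' => G.irrefl (mem_nbrs.1 h')
  constructor
  · rw [weightAtLeast, sum_partitionMatching (fun h' => hirr (mem_filter.1 h').1)
      (mem_filter.2 ⟨m₁, h₁⟩) (mem_filter.2 ⟨m₂, h₂⟩)]
    exact lt_irrefl 1
  · rw [utility, sum_mul_partitionMatching hirr m₁ m₂, not_lt]
    linarith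

omit [Fintype V] in
/-- At every edge one of the two agents is matched and weakly prefers both partners. -/
theorem exists_content (ht : IsTieBreaking G sat sat') {u v : V} (huv : G.Adj u v) :
    (π u ≠ u ∧ sat u v ≤ sat u (π u) ∧ sat u v ≤ sat u (π⁻¹ u)) ∨
      (π v ≠ v ∧ sat v u ≤ sat v (π v) ∧ sat v u ≤ sat v (π⁻¹ v)) := by
  -- weak preferences of the tie-breaking are weak preferences
  have hle : ∀ {x y z}, G.Adj x y → G.Adj x z → sat' x z ≤ sat' x y → sat x z ≤ sat x y :=
    fun hy hz hle => not_lt.1 fun h' => (ht.keeps _ _ _ hz hy h').not_ge hle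
  have hpred : ∀ {x y}, G.Adj x y → π x ≠ x → sat' x y ≤ sat' x (π⁻¹ x) →
      sat x y ≤ sat x (π x) ∧ sat x y ≤ sat x (π⁻¹ x) := by
    intro x y hxy hx hy
    have hi := h.adj_inv (inv_ne_iff.2 hx)
    refine ⟨hle (h.edge x hx) hxy (hy.trans ?_), hle hi hxy hy⟩
    by_cases he : π x = π⁻¹ x
    · rw [he]
    · exact (h.prefers x he).le
  by_cases hv : v = π u
  · have hu' : π⁻¹ v = u := by rw [hv]; exact π.symm_apply_apply u
    have hne : π v ≠ v := inv_ne_iff.1 (by rw [hu']; exact huv.ne)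
    exact Or.inr ⟨hne, hpred huv.symm hne (by rw [hu'])⟩
  · by_cases hu : π u = u ∨ sat' u (π⁻¹ u) < sat' u v
    · have h₁ := h.stable u v huv hv hu
      have hne : π v ≠ v := inv_ne_iff.1 fun he => by
        rw [he, ht.isSatisfaction.self] at h₁
        exact h₁.not_ge (ht.isSatisfaction.nonneg v u)
      exact Or.inr ⟨hne, hpred huv.symm hne h₁.le⟩
    · push Not at hu
      exact Or.inl ⟨hu.1, hpred huv hu.1 hu.2⟩

theorem isHalfIntegralStable (ht : IsTieBreaking G sat sat') :
    IsHalfIntegralStable G sat (partitionMatching π) where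
  matching :=
    { symm := partitionMatching_comm
      off_edge := fun _ _ => h.partitionMatching_off_edge
      nonneg := partitionMatching_nonneg
      sum_le_one := fun v => by
        by_cases hv : π v = v
        · rw [sum_eq_zero hv]; exact zero_le_one
        · rw [h.sum_eq_one hv] }
  ordinallyStable u v huv := by
    rcases h.exists_content ht huv with ⟨h₁, h₂, h₃⟩ | ⟨h₁, h₂, h₃⟩
    · exact fun h' => (h.not_blocking h₁ h₂ h₃).1 h'.1
    · exact fun h' => (h.not_blocking h₁ h₂ h₃).1 h'.2
  cardinallyStable u v huv := by
    rcases h.exists_content ht huv with ⟨h₁, h₂, h₃⟩ | ⟨h₁, h₂, h₃⟩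
    · exact fun h' => (h.not_blocking h₁ h₂ h₃).2 h'.1
    · exact fun h' => (h.not_blocking h₁ h₂ h₃).2 h'.2
  halfIntegral u v _ := by
    rw [partitionMatching]
    split_ifs <;> simp
  full v hv := by
    by_cases hv' : π v = v
    · rw [IsMatched, sum_eq_zero hv'] at hv
      exact absurd hv (lt_irrefl 0)
    · exact h.sum_eq_one hv'

end IsStablePartition

end Matching

/-! ### Input by preference lists -/

/-- The preference lists `L` are in the memory as `partitionProgram` expects them. -/
structure Mem.Ready {n : ℕ} (L : Fin n → List (Fin n)) (s : Mem) : Prop where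
  represents : (s.prefs (s.arr 4)).Represents L
  zero : ∀ a ∈ [2, 6, 7, 9], s.arr a = fun _ => 0

theorem Mem.Ready.reaches {n : ℕ} {L : Fin n → List (Fin n)} {G : SimpleGraph (Fin n)} {s : Mem}
    (hs : s.Ready L) (hL : IsAdjacencyLists G L) :
    Reaches partitionProgram s (partitionFactor * (n + 1) ^ 2) (fun s' =>
      ∃ π : Equiv.Perm (Fin n), IsStablePartition G (listSat L) π ∧
        HoldsMatching n s' (partitionMatching π)) := by
  have h := partitionProgram_reaches (hs.represents.valid hL) (s := s) rfl rfl hs.zero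
  rw [hs.represents.n_eq] at h
  exact h.mono le_rfl fun s' h' => hs.represents.exists_of_holdsTable hL h'

theorem cell_div {n u i : ℕ} (hi : i < n) : (u * n + i) / n = u := by
  rw [Nat.add_comm, Nat.add_mul_div_right _ _ (by omega), Nat.div_eq_of_lt hi, Nat.zero_add]

theorem cell_lt {n u i : ℕ} (hu : u < n) (hi : i < n) : u * n + i < n * n := by
  have : (u + 1) * n ≤ n * n := Nat.mul_le_mul_right n hu
  rw [Nat.add_mul] at this
  omega

/-- Copies cell `k` of the list entries and of the lengths, `k` in register `1`, and records the
position of the entry. -/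
def listBody : Program :=
  .seq (.ifLt (.reg 1 - .reg 1 / .reg 0 * .reg 0) (.read 1 (.reg 1 / .reg 0))
      (.write 5 (.reg 1 / .reg 0 * .reg 0 + .read 0 (.reg 1)) (.reg 1 - .reg 1 / .reg 0 * .reg 0))
      .skip)
    (.seq (.write 3 (.reg 1) (.read 0 (.reg 1)))
      (.seq (.write 4 (.reg 1) (.read 1 (.reg 1)))
        (.set 1 (.reg 1 + .const 1))))

theorem listBody_loopFree : listBody.LoopFree := by
  simp [listBody, Program.LoopFree]

/-- Copies the preference lists and inverts them. -/
def listLoop : Program := .whileLt (.reg 1) (.reg 0 * .reg 0) listBody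

/-- Cells outside the lists are copied as well; `Prefs.Represents` does not constrain them. -/
theorem listLoop_reaches {n : ℕ} {L : Fin n → List (Fin n)} (hnd : ∀ u, (L u).Nodup) {s : Mem}
    (h₀ : s.reg 0 = n) (h₁ : s.reg 1 = 0)
    (hent : ∀ (u : Fin n) (i : ℕ) (h : i < (L u).length), s.arr 0 (u * n + i) = ((L u)[i] : Fin n))
    (hlen : ∀ u : Fin n, s.arr 1 u = (L u).length)
    (hzero : ∀ a ∈ [2, 6, 7, 9], s.arr a = fun _ => 0) :
    Reaches listLoop s ((n * n + 1) * (5 + listBody.maxCost)) (fun s' => s'.Ready L) := by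
  have hle : ∀ u, (L u).length ≤ n := fun u => by simpa using (hnd u).length_le_card
  have h := Reaches.whileLt (e := .reg 1) (f := .reg 0 * .reg 0) listBody_loopFree
    (fun t => t.reg 0 = n ∧ t.reg 1 ≤ n * n ∧ t.arr 0 = s.arr 0 ∧ t.arr 1 = s.arr 1 ∧
      (∀ k < t.reg 1, t.arr 3 k = s.arr 0 k) ∧ (∀ k < t.reg 1, t.arr 4 k = s.arr 1 k) ∧
      ∀ (u : Fin n) (i : ℕ) (h : i < (L u).length), u * n + i < t.reg 1 →
        t.arr 5 (u * n + ((L u)[i] : Fin n)) = i)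
    (fun t => n * n - t.reg 1) ?_ (s := s)
    ⟨h₀, by omega, rfl, rfl, fun k hk => by omega, fun k hk => by omega,
      fun u i _ hk => by omega⟩
  · refine ((h.frame).mono ?_ ?_)
    · simp only [h₁, Nat.sub_zero, WordTerm.cost]
      rfl
    · rintro t ⟨⟨⟨a₀, a₁, a₂, a₃, a₄, a₅, a₆⟩, a₇⟩, a₈, -⟩
      have a₁ : t.reg 1 = n * n := by
        simp only [WordTerm.eval_reg, WordTerm.eval_mul, a₀] at a₇
        omega
      rw [a₁] at a₄ a₅ a₆
      refine ⟨⟨a₀, fun u => ?_, fun u i hi => ?_, fun u i hi => ?_⟩, fun a ha => ?_⟩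
      · rw [← hlen u]
        exact a₅ u (u.2.trans_le (Nat.le_mul_self n))
      · simp only [Mem.prefs, a₀]
        rw [← hent u i hi]
        exact a₄ _ (cell_lt u.2 (hi.trans_le (hle u)))
      · simp only [Mem.prefs, a₀]
        exact a₆ u i hi (cell_lt u.2 (hi.trans_le (hle u)))
      · rw [a₈ a, hzero a ha]
        simp only [List.mem_cons, List.not_mem_nil, or_false] at ha
        rcases ha with rfl | rfl | rfl | rfl <;> simp [listBody, Program.WritesArr]
  · rintro t ⟨a₀, a₁, a₂, a₃, a₄, a₅, a₆⟩ hlt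
    simp only [WordTerm.eval_reg, WordTerm.eval_mul, a₀] at hlt
    have hn : 0 < n := Nat.pos_of_mul_pos_right (Nat.zero_lt_of_lt hlt)
    obtain ⟨u, i, hu, hi, he⟩ : ∃ u i, u < n ∧ i < n ∧ t.reg 1 = u * n + i :=
      ⟨t.reg 1 / n, t.reg 1 % n, Nat.div_lt_of_lt_mul hlt, Nat.mod_lt _ hn,
        (Nat.div_add_mod' _ _).symm⟩
    lift u to Fin n using hu
    have hdiv : (↑u * n + i) / n = u := cell_div hi
    have hmod : ↑u * n + i - ↑u * n = i := by omega
    have upd : ∀ (f g : ℕ → ℕ), (∀ k < t.reg 1, f k = g k) →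
        ∀ k ≤ t.reg 1, Function.update f (t.reg 1) (g (t.reg 1)) k = g k := by
      intro f g hfg k hk
      rcases hk.lt_or_eq with hk | rfl
      · rw [Function.update_of_ne hk.ne, hfg k hk]
      · rw [Function.update_self]
    have u₃ := upd _ _ a₄
    have u₄ := upd _ _ a₅
    rw [he] at u₃ u₄ hlt
    by_cases hi' : i < (L u).length
    · simp only [listBody, Program.eval, WordTerm.eval_sub, WordTerm.eval_reg, WordTerm.eval_div,
        WordTerm.eval_mul, WordTerm.eval_read, a₀, he, hdiv, hmod, a₃, hlen, if_pos hi']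
      simp [a₀, a₂, a₃, he, hdiv]
      refine ⟨⟨hlt, u₃, u₄, ?_⟩, by omega⟩
      intro v j hj hlt'
      have hn' := hj.trans_le (hle v)
      rw [hent u i hi']
      by_cases huv : (v : ℕ) * n + j = u * n + i
      · obtain ⟨h₁, rfl⟩ := cell_inj hn' hi huv
        obtain rfl := Fin.ext h₁
        rw [Function.update_self]
      · rw [Function.update_of_ne, a₆ v j hj (by omega)]
        intro hc
        obtain ⟨h₁, h₂⟩ := cell_inj (Fin.is_lt _) (Fin.is_lt _) hc
        obtain rfl := Fin.ext h₁
        exact huv (by rw [(hnd v).getElem_inj_iff.1 (Fin.ext h₂)])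
    · simp only [listBody, Program.eval, WordTerm.eval_sub, WordTerm.eval_reg, WordTerm.eval_div,
        WordTerm.eval_mul, WordTerm.eval_read, a₀, he, hdiv, hmod, a₃, hlen, if_neg hi']
      simp [a₀, a₂, a₃, he]
      refine ⟨⟨hlt, u₃, u₄, ?_⟩, by omega⟩
      intro v j hj hlt'
      refine a₆ v j hj (lt_of_le_of_ne (by omega) fun hc => hi' ?_)
      rw [he] at hc
      obtain ⟨h₁, rfl⟩ := cell_inj (hj.trans_le (hle v)) hi hc
      obtain rfl := Fin.ext h₁
      exact hj

/-- Computes the doubled matching of a stable partition from preference lists. -/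
def listProgram : Program := .seq listLoop partitionProgram

theorem listProgram_slow : listProgram.Slow :=
  ⟨by simp [listLoop, listBody, Program.Slow], partitionProgram_slow⟩

theorem matrixArray_cell {n : ℕ} (A : Fin n → Fin n → ℕ) (u v : Fin n) :
    matrixArray n A (u * n + v) = A u v := by
  rw [matrixArray, dif_pos (cell_lt u.2 v.2)]
  have h₁ : (u * n + v : ℕ) / n = u := cell_div v.2
  have h₂ : (u * n + v : ℕ) % n = v := by
    rw [Nat.mul_add_mod_self_right, Nat.mod_eq_of_lt v.2]
  congr 1
  · congr 1
  · exact Fin.ext h₂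

theorem listProgram_reaches {n : ℕ} {L : Fin n → List (Fin n)} {G : SimpleGraph (Fin n)}
    (hL : IsAdjacencyLists G L) :
    Reaches listProgram (listInput n L)
      ((n * n + 1) * (5 + listBody.maxCost) + partitionFactor * (n + 1) ^ 2) (fun s =>
        ∃ π : Equiv.Perm (Fin n), IsStablePartition G (listSat L) π ∧
          HoldsMatching n s (partitionMatching π)) := by
  refine (listLoop_reaches hL.nodup rfl rfl (fun u i hi => ?_) (fun u => ?_)
    (fun a ha => ?_)).seq fun s hs => hs.reaches hL
  · have hin : i < n := hi.trans_le (by simpa using (hL.nodup u).length_le_card)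
    have h := matrixArray_cell (fun u i => ((L u).map Fin.val).getD i.val 0) u ⟨i, hin⟩
    simp only [listInput, if_true]
    rw [h, List.getD_eq_getElem _ _ (by simpa using hi), List.getElem_map]
  · simp [listInput]
  · simp only [List.mem_cons, List.not_mem_nil, or_false] at ha
    rcases ha with rfl | rfl | rfl | rfl <;> simp [listInput]

theorem listProgram_exec : ∃ C, ∀ n : ℕ, 0 < n → ∀ (L : Fin n → List (Fin n))
    (G : SimpleGraph (Fin n)), IsAdjacencyLists G L →
    ∃ s t, Exec ((n + 1) ^ C) listProgram (listInput n L) s t ∧ t ≤ C * n ^ 2 ∧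
      ∃ π : Equiv.Perm (Fin n), IsStablePartition G (listSat L) π ∧
        HoldsMatching n s (partitionMatching π) := by
  refine ⟨(1 + (2 * (5 + listBody.maxCost) + 4 * partitionFactor) + 5) * listProgram.deg +
    (2 * (5 + listBody.maxCost) + 4 * partitionFactor), fun n hn L G hL =>
    (listProgram_reaches hL).exists_exec listProgram_slow hn ⟨fun r => ?_, fun a i => ?_⟩ ?_ le_rfl⟩
  · rw [pow_one]
    simp only [listInput]
    split_ifs <;> omega
  · rw [pow_one]
    simp only [listInput]
    split_ifs with h₁ h₂
    · rw [matrixArray]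
      split_ifs with h₃
      · rw [List.getD_eq_getElem?_getD, List.getElem?_map]
        generalize ((L _ : List (Fin n))[(_ : ℕ)]? : Option (Fin n)) = o
        rcases o with - | v
        · simp
        · simp only [Option.map_some, Option.getD_some]
          omega
      · omega
    · dsimp only
      split_ifs with h₃
      · exact (le_trans (by simpa using (hL.nodup ⟨i, h₃⟩).length_le_card) n.le_succ)
      · omega
    · exact Nat.zero_le _
  · generalize 5 + listBody.maxCost = a
    generalize partitionFactor = b
    have h₁ : n * n + 1 ≤ 2 * n ^ 2 := by nlinarith
    have h₂ : (n + 1) ^ 2 ≤ 4 * n ^ 2 := by nlinarith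
    nlinarith [Nat.mul_le_mul_right a h₁, Nat.mul_le_mul_left b h₂]

/-! ### Existence of stable partitions -/

/-- A stable partition exists since the program finds one. -/
theorem exists_isStablePartition {V : Type*} [Fintype V] {G : SimpleGraph V} {sat : V → V → ℝ}
    (hs : IsStrict G sat) : ∃ π : Equiv.Perm V, IsStablePartition G sat π := by
  classical
  let e := Fintype.equivFin V
  let G' : SimpleGraph (Fin (Fintype.card V)) := G.comap e.symm
  let sat' : Fin (Fintype.card V) → Fin (Fintype.card V) → ℝ := fun u v =>
    sat (e.symm u) (e.symm v)
  have hs' : IsStrict G' sat' := fun v x y hx hy hne =>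
    hs _ _ _ hx hy fun he => hne (e.symm.injective he)
  obtain ⟨L, hL⟩ := exists_isPreferenceLists G' sat'
  obtain ⟨-, -, -, -, π, hπ, -⟩ := listProgram_reaches hL.isAdjacencyLists
  have hπ' := hπ.of_tieBreaking hL.isTieBreaking hs'
  have hinv : ∀ v, (e.symm.permCongr π)⁻¹ v = e.symm (π⁻¹ (e v)) := fun v => rfl
  have happ : ∀ v, e.symm.permCongr π v = e.symm (π (e v)) := fun v => rfl
  refine ⟨e.symm.permCongr π, fun v hv => ?_, fun v hv => ?_, fun u v huv hne hu => ?_⟩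
  · rw [happ, ne_eq, Equiv.symm_apply_eq] at hv
    have := hπ'.edge _ hv
    simpa [G', happ] using this
  · rw [happ, hinv, ne_eq, e.symm.apply_eq_iff_eq] at hv
    have := hπ'.prefers _ hv
    simpa [sat', happ, hinv] using this
  · have := hπ'.stable (e u) (e v) (by simpa [G'] using huv)
      (fun he => hne (by rw [happ, ← he, e.symm_apply_apply])) (by
        rw [happ, hinv, Equiv.symm_apply_eq] at hu
        simpa [sat'] using hu)
    simpa [sat', hinv] using this

/-! ### Sorting by keys -/

/-- Powers of terms, multiplied out. -/
def WordTerm.pow (e : WordTerm) : ℕ → WordTerm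
  | 0 => .const 1
  | j + 1 => e.pow j * e

@[simp] theorem WordTerm.eval_pow (s : Mem) (e : WordTerm) (j : ℕ) :
    (e.pow j).eval s = e.eval s ^ j := by
  induction j with
  | zero => rfl
  | succ j ih => rw [WordTerm.pow, WordTerm.eval_mul, ih, pow_succ]

/-- The fraction in cell `e` of the arrays `0` and `1`, scaled and rounded down. -/
def Mem.key (k : ℕ) (s : Mem) (e : ℕ) : ℕ :=
  s.arr 0 e * (s.reg 0 + 1) ^ (2 * k) / s.arr 1 e

/-- Digit `j` of the key, in base `n + 1`. -/
def Mem.digit (k j : ℕ) (s : Mem) (e : ℕ) : ℕ :=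
  s.key k e / (s.reg 0 + 1) ^ j % (s.reg 0 + 1)

theorem Mem.digit_congr {k j : ℕ} {s t : Mem} (h : t.reg 0 = s.reg 0) (h₀ : t.arr 0 = s.arr 0)
    (h₁ : t.arr 1 = s.arr 1) : t.digit k j = s.digit k j := by
  funext e
  simp only [Mem.digit, Mem.key, h, h₀, h₁]

/-- Evaluates to the key of the cell `e`. -/
def keyTerm (k : ℕ) (e : WordTerm) : WordTerm :=
  .read 0 e * (.reg 0 + .const 1 : WordTerm).pow (2 * k) / .read 1 e

/-- Evaluates to digit `j` of the key of the cell `e`. -/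
def digitTerm (k j : ℕ) (e : WordTerm) : WordTerm :=
  keyTerm k e / (.reg 0 + .const 1 : WordTerm).pow j -
    keyTerm k e / (.reg 0 + .const 1 : WordTerm).pow (j + 1) * (.reg 0 + .const 1)

@[simp] theorem digitTerm_eval (k j : ℕ) (e : WordTerm) (s : Mem) :
    (digitTerm k j e).eval s = s.digit k j (e.eval s) := by
  simp only [digitTerm, keyTerm, WordTerm.eval_sub, WordTerm.eval_div, WordTerm.eval_mul,
    WordTerm.eval_read, WordTerm.eval_pow, WordTerm.eval_add, WordTerm.eval_reg,
    WordTerm.eval_const, Mem.digit, Mem.key]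
  generalize s.arr 0 (e.eval s) * (s.reg 0 + 1) ^ (2 * k) / s.arr 1 (e.eval s) = x
  rw [pow_succ, ← Nat.div_div_eq_div_mul]
  generalize x / (s.reg 0 + 1) ^ j = y
  have := Nat.div_add_mod' y (s.reg 0 + 1)
  omega

/-- The first cells of the array `f` contain the list `l`. -/
def Contains (f : ℕ → ℕ) (l : List ℕ) : Prop :=
  ∀ (i : ℕ) (h : i < l.length), f i = l[i]

theorem Contains.snoc {f g : ℕ → ℕ} {l : List ℕ} {x : ℕ} (h : Contains f l)
    (hg : ∀ i < l.length, g i = f i) (hx : g l.length = x) : Contains g (l ++ [x]) := by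
  intro i hi
  rw [List.length_append, List.length_singleton] at hi
  rcases Nat.lt_succ_iff_lt_or_eq.1 hi with hi' | rfl
  · rw [List.getElem_append_left hi', hg i hi', h i hi']
  · rw [hx, List.getElem_concat_length rfl]

/-- The arrays `c` and `b` contain the buckets `B d`, bucket `d` from cell `d * m` on. -/
def Buckets (m : ℕ) (c b : ℕ → ℕ) (B : ℕ → List ℕ) : Prop :=
  ∀ d, c d = (B d).length ∧ Contains (fun i => b (d * m + i)) (B d)

/-- Puts the next entry of array `a` into the bucket of its digit `j`, with the buckets in the
array `a + 1` and their sizes in the array `a + 2`. -/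
def distributeBody (k j a : ℕ) : Program :=
  .seq (.write (a + 1) (digitTerm k j (.read a (.reg 1)) * (.reg 0 * .reg 0) +
      .read (a + 2) (digitTerm k j (.read a (.reg 1)))) (.read a (.reg 1)))
    (.seq (.write (a + 2) (digitTerm k j (.read a (.reg 1)))
        (.read (a + 2) (digitTerm k j (.read a (.reg 1))) + .const 1))
      (.set 1 (.reg 1 + .const 1)))

theorem distributeBody_loopFree (k j a : ℕ) : (distributeBody k j a).LoopFree := by
  simp [distributeBody, Program.LoopFree]

/-- Distribution of a list into buckets keeps the order of the list inside each bucket. -/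
theorem distribute_reaches (k j : ℕ) {a n : ℕ} (ha : 2 ≤ a) {s : Mem} (h₀ : s.reg 0 = n)
    (h₁ : s.reg 1 = 0) {l : List ℕ} (hl : l.length = n * n) (hs : Contains (s.arr a) l)
    (hc : s.arr (a + 2) = fun _ => 0) :
    Reaches (.whileLt (.reg 1) (.reg 0 * .reg 0) (distributeBody k j a)) s
      ((n * n + 1) * (5 + (distributeBody k j a).maxCost))
      (fun t => Buckets (n * n) (t.arr (a + 2)) (t.arr (a + 1))
        fun d => l.filter fun e => s.digit k j e = d) := by
  have h := Reaches.whileLt (e := .reg 1) (f := .reg 0 * .reg 0) (distributeBody_loopFree k j a)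
    (fun t => t.reg 0 = n ∧ t.reg 1 ≤ n * n ∧ t.arr 0 = s.arr 0 ∧ t.arr 1 = s.arr 1 ∧
      t.arr a = s.arr a ∧ Buckets (n * n) (t.arr (a + 2)) (t.arr (a + 1))
        fun d => (l.take (t.reg 1)).filter fun e => s.digit k j e = d)
    (fun t => n * n - t.reg 1) ?_ (s := s)
    ⟨h₀, by omega, rfl, rfl, rfl, fun d => by
      rw [h₁, hc]
      exact ⟨rfl, fun i hi => by simp at hi⟩⟩
  · refine h.mono ?_ ?_
    · simp only [h₁, Nat.sub_zero, WordTerm.cost]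
      rfl
    · rintro t ⟨⟨a₀, a₁, a₂, a₃, a₄, a₅⟩, a₆⟩
      simp only [WordTerm.eval_reg, WordTerm.eval_mul, a₀] at a₆
      rwa [List.take_of_length_le (by omega)] at a₅
  · rintro t ⟨a₀, a₁, a₂, a₃, a₄, a₅⟩ hlt
    simp only [WordTerm.eval_reg, WordTerm.eval_mul, a₀] at hlt
    have hdig : ∀ u : Mem, u.reg 0 = n → u.arr 0 = s.arr 0 → u.arr 1 = s.arr 1 →
        u.digit k j = s.digit k j := fun u e₀ e₁ e₂ => Mem.digit_congr (e₀.trans h₀.symm) e₁ e₂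
    have hi : t.reg 1 < l.length := by omega
    have hx := hs _ hi
    generalize hxe : l[t.reg 1] = x at hx
    have htake : l.take (t.reg 1 + 1) = l.take (t.reg 1) ++ [x] := by
      rw [← List.take_concat_get' l _ hi, hxe]
    simp only [distributeBody, Program.eval, WordTerm.eval_add, WordTerm.eval_mul,
      WordTerm.eval_reg, WordTerm.eval_read, digitTerm_eval, WordTerm.eval_const]
    have hne : ∀ (f : ℕ → ℕ) (b : ℕ), b < 2 →
        Function.update t.arr (a + 1) f b = t.arr b := fun f b hb =>
      Function.update_of_ne (by omega) _ _
    have hdig' : ∀ f, Mem.digit k j ⟨t.reg, Function.update t.arr (a + 1) f⟩ = s.digit k j :=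
      fun f => hdig _ a₀ ((hne f 0 (by omega)).trans a₂) ((hne f 1 (by omega)).trans a₃)
    simp only [hdig t a₀ a₂ a₃, hdig', a₀, a₄, hx]
    simp [a₀, a₂, a₄, htake]
    refine ⟨⟨hlt, (hne _ 1 (by omega)).trans a₃, fun d => ?_⟩, by omega⟩
    obtain ⟨b₁, b₂⟩ := a₅ d
    obtain ⟨c₁, -⟩ := a₅ (s.digit k j x)
    have hlen : ∀ d, ((l.take (t.reg 1)).filter fun e => s.digit k j e = d).length < n * n :=
      fun d => by
        have h₁ := List.length_filter_le (fun e => s.digit k j e = d) (l.take (t.reg 1))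
        rw [List.length_take] at h₁
        omega
    dsimp only at b₁ b₂ c₁ ⊢
    rw [hx]
    by_cases hd : s.digit k j x = d
    · subst hd
      rw [List.filter_singleton]
      simp only [decide_true, cond_true, Function.update_self, List.length_append, b₁]
      refine ⟨rfl, b₂.snoc (fun i hi => ?_) ?_⟩
      · rw [Function.update_of_ne]
        omega
      · rw [Function.update_self]
    · rw [List.filter_singleton]
      simp only [hd, decide_false, Function.update_of_ne (Ne.symm hd), b₁]
      rw [cond_false, List.append_nil]
      refine ⟨rfl, fun i hi => ?_⟩
      have := b₂ i hi
      rw [← this]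
      refine Function.update_of_ne (fun he => ?_) _ _
      refine hd (cell_inj (hi.trans (hlen d)) ?_ he).1.symm
      rw [c₁]
      exact hlen _

/-- Appends the next entry of the buckets to the array `a + 3`, with the bucket in register `1`, the
position in it in register `2`, and the position in the output in register `3`. -/
def gatherBody (a : ℕ) : Program :=
  .ifLt (.reg 2) (.read (a + 2) (.reg 1))
    (.seq (.write (a + 3) (.reg 3) (.read (a + 1) (.reg 1 * (.reg 0 * .reg 0) + .reg 2)))
      (.seq (.set 2 (.reg 2 + .const 1)) (.set 3 (.reg 3 + .const 1))))
    (.seq (.set 1 (.reg 1 + .const 1)) (.set 2 (.const 0)))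

theorem gatherBody_loopFree (a : ℕ) : (gatherBody a).LoopFree := by
  simp [gatherBody, Program.LoopFree]

/-- Collection of the buckets concatenates them in the order of their digits. -/
theorem gather_reaches {a n : ℕ} {s : Mem} (h₀ : s.reg 0 = n) (h₁ : s.reg 1 = 0)
    (h₂ : s.reg 2 = 0) (h₃ : s.reg 3 = 0) {B : ℕ → List ℕ}
    (hB : Buckets (n * n) (s.arr (a + 2)) (s.arr (a + 1)) B)
    (hlen : ((List.range (n + 1)).flatMap B).length = n * n) :
    Reaches (.whileLt (.reg 1) (.reg 0 + .const 1) (gatherBody a)) s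
      ((n * n + n + 2) * (5 + (gatherBody a).maxCost))
      (fun t => Contains (t.arr (a + 3)) ((List.range (n + 1)).flatMap B)) := by
  have hsucc : ∀ d, (List.range (d + 1)).flatMap B = (List.range d).flatMap B ++ B d := fun d => by
    rw [List.range_succ, List.flatMap_append, List.flatMap_singleton]
  have hmono : Monotone fun d => ((List.range d).flatMap B).length :=
    monotone_nat_of_le_succ fun d => by rw [hsucc, List.length_append]; omega
  have h := Reaches.whileLt (e := .reg 1) (f := .reg 0 + .const 1) (gatherBody_loopFree a)
    (fun t => t.reg 0 = n ∧ t.reg 1 ≤ n + 1 ∧ t.reg 2 ≤ (B (t.reg 1)).length ∧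
      (t.reg 1 = n + 1 → t.reg 2 = 0) ∧
      t.reg 3 = ((List.range (t.reg 1)).flatMap B ++ (B (t.reg 1)).take (t.reg 2)).length ∧
      t.arr (a + 2) = s.arr (a + 2) ∧ t.arr (a + 1) = s.arr (a + 1) ∧
      Contains (t.arr (a + 3)) ((List.range (t.reg 1)).flatMap B ++ (B (t.reg 1)).take (t.reg 2)))
    (fun t => (n + 1 - t.reg 1) + (n * n - t.reg 3)) ?_ (s := s)
    ⟨h₀, by omega, by omega, fun _ => h₂, by simp [h₁, h₂, h₃], rfl, rfl, by
      rw [h₁, h₂]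
      exact fun i hi => by simp at hi⟩
  · refine h.mono ?_ ?_
    · refine Nat.mul_le_mul ?_ le_rfl
      omega
    · rintro t ⟨⟨a₀, a₁, a₂, a₃, a₄, a₅, a₆, a₇⟩, a₈⟩
      simp only [WordTerm.eval_reg, WordTerm.eval_add, WordTerm.eval_const, a₀] at a₈
      obtain h₉ : t.reg 1 = n + 1 := by omega
      rwa [a₃ h₉, h₉, List.take_zero, List.append_nil] at a₇
  · rintro t ⟨a₀, a₁, a₂, a₃, a₄, a₅, a₆, a₇⟩ hlt
    simp only [WordTerm.eval_reg, WordTerm.eval_add, WordTerm.eval_const, a₀] at hlt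
    obtain ⟨b₁, b₂⟩ := hB (t.reg 1)
    by_cases hc : t.reg 2 < (B (t.reg 1)).length
    · have hlt' : t.reg 3 < n * n := by
        have h₄ : ((List.range (t.reg 1 + 1)).flatMap B).length ≤ n * n := by
          rw [← hlen]
          exact hmono (Nat.succ_le_of_lt hlt)
        rw [hsucc, List.length_append] at h₄
        rw [List.length_append, List.length_take] at a₄
        omega
      have htake : (B (t.reg 1)).take (t.reg 2 + 1) =
          (B (t.reg 1)).take (t.reg 2) ++ [(B (t.reg 1))[t.reg 2]] :=
        (List.take_concat_get' _ _ hc).symm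
      simp [gatherBody, Program.eval, a₅, b₁, hc, a₀, a₆, hlt.le, hlt.ne]
      rw [htake]
      refine ⟨⟨?_, ?_⟩, by omega⟩
      · rw [a₄, List.length_append]
        simp [min_eq_left hc.le, Nat.add_assoc]
      · rw [← List.append_assoc]
        refine a₇.snoc (fun i hi => ?_) ?_
        · rw [Function.update_of_ne]
          omega
        · rw [← a₄, Function.update_self]
          exact b₂ _ hc
    · have hfull : (B (t.reg 1)).take (t.reg 2) = B (t.reg 1) :=
        List.take_of_length_le (by omega)
      simp only [hfull] at a₄ a₇
      simp [gatherBody, Program.eval, a₅, b₁, hc, a₀, a₆, hsucc]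
      refine ⟨⟨by omega, ?_, a₇⟩, by omega⟩
      rw [a₄, List.length_append]
      simp

/-- `l` lists the numbers below `m` in the order of the function `f`. -/
structure IsSortedRange (m : ℕ) (f : ℕ → ℕ) (l : List ℕ) : Prop where
  nodup : l.Nodup
  mem_iff : ∀ e, e ∈ l ↔ e < m
  sorted : l.Pairwise (fun d e => f d ≤ f e)

theorem IsSortedRange.length_eq {m : ℕ} {f : ℕ → ℕ} {l : List ℕ} (h : IsSortedRange m f l) :
    l.length = m := by
  have : l.Perm (List.range m) := (List.perm_ext_iff_of_nodup h.nodup List.nodup_range).2 fun e =>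
    by rw [h.mem_iff, List.mem_range]
  rw [this.length_eq, List.length_range]

/-- Distribution by the next digit and collection of the buckets extends the sorting by the lower
digits. -/
theorem IsSortedRange.flatMap_filter {m N j : ℕ} {f : ℕ → ℕ} {l : List ℕ} (hN : 0 < N)
    (h : IsSortedRange m (fun e => f e % N ^ j) l) :
    IsSortedRange m (fun e => f e % N ^ (j + 1))
      ((List.range N).flatMap fun d => l.filter fun e => f e / N ^ j % N = d) where
  nodup := by
    rw [List.nodup_flatMap]
    refine ⟨fun d _ => h.nodup.filter _, List.nodup_range.imp fun {d d'} hne e he he' => hne ?_⟩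
    rw [List.mem_filter, decide_eq_true_eq] at he he'
    exact he.2.symm.trans he'.2
  mem_iff e := by
    simp only [List.mem_flatMap, List.mem_range, List.mem_filter, decide_eq_true_eq, h.mem_iff]
    exact ⟨fun ⟨_, _, he, _⟩ => he, fun he => ⟨_, Nat.mod_lt _ hN, he, rfl⟩⟩
  sorted := by
    have hmod : ∀ e, f e % N ^ (j + 1) = f e % N ^ j + N ^ j * (f e / N ^ j % N) := fun e => by
      rw [pow_succ, Nat.mod_mul]
    simp only [hmod]
    rw [List.pairwise_flatMap]
    refine ⟨fun d _ => ?_, List.pairwise_lt_range.imp fun {d d'} hlt e he e' he' => ?_⟩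
    · refine (h.sorted.filter _).imp_of_mem fun {e e'} he he' hle => ?_
      rw [List.mem_filter, decide_eq_true_eq] at he he'
      rw [he.2, he'.2]
      omega
    · rw [List.mem_filter, decide_eq_true_eq] at he he'
      rw [he.2, he'.2]
      have h₁ := Nat.mod_lt (f e) (Nat.pow_pos hN : 0 < N ^ j)
      have h₂ : N ^ j * (d + 1) ≤ N ^ j * d' := Nat.mul_le_mul_left _ hlt
      linarith [Nat.zero_le (f e' % N ^ j)]

/-- One pass of radix sort, from the array `a` to the array `a + 3`. -/
def radixPass (k j a : ℕ) : Program :=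
  .seq (.set 1 (.const 0))
    (.seq (.whileLt (.reg 1) (.reg 0 * .reg 0) (distributeBody k j a))
      (.seq (.seq (.set 1 (.const 0)) (.seq (.set 2 (.const 0)) (.set 3 (.const 0))))
        (.whileLt (.reg 1) (.reg 0 + .const 1) (gatherBody a))))

theorem radixPass_slow (k j a : ℕ) : (radixPass k j a).Slow := by
  simp [radixPass, distributeBody, gatherBody, Program.Slow]

theorem radixPass_not_writesArr {k j a b : ℕ} (h : b ≤ a ∨ a + 3 < b) :
    ¬ (radixPass k j a).WritesArr b := by
  simp [radixPass, distributeBody, gatherBody, Program.WritesArr]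
  omega

theorem radixPass_reaches (k j : ℕ) {a : ℕ} (ha : 2 ≤ a) : ∃ b, ∀ (n : ℕ) (s : Mem) (l : List ℕ),
    s.reg 0 = n → IsSortedRange (n * n) (fun e => s.key k e % (n + 1) ^ j) l →
    Contains (s.arr a) l → (s.arr (a + 2) = fun _ => 0) →
    Reaches (radixPass k j a) s (b * (n + 1) ^ 2) (fun t => ∃ l',
      IsSortedRange (n * n) (fun e => s.key k e % (n + 1) ^ (j + 1)) l' ∧
        Contains (t.arr (a + 3)) l') := by
  refine ⟨8 + 2 * ((5 + (distributeBody k j a).maxCost) + (5 + (gatherBody a).maxCost)),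
    fun n s l h₀ hl hs hc => ?_⟩
  have hl' := hl.flatMap_filter (Nat.succ_pos n)
  have h₁ : Reaches (.set 1 (.const 0)) s 2 (fun t => t.reg 1 = 0 ∧ t.reg 0 = n ∧ t.arr = s.arr) :=
    (Reaches.of_loopFree (by simp [Program.LoopFree]) (by simp [Program.eval, h₀])).mono
      le_rfl fun _ h => h
  have h₃ : ∀ t : Mem, t.reg 0 = n → Reaches (.seq (.set 1 (.const 0)) (.seq (.set 2 (.const 0))
      (.set 3 (.const 0)))) t 6 (fun u => u.reg 0 = n ∧ u.reg 1 = 0 ∧ u.reg 2 = 0 ∧ u.reg 3 = 0 ∧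
        u.arr = t.arr) := fun t ht =>
    (Reaches.of_loopFree (by simp [Program.LoopFree]) (by simp [Program.eval, ht])).mono
      le_rfl fun _ h => h
  have main : Reaches (radixPass k j a) s (2 +
      ((n * n + 1) * (5 + (distributeBody k j a).maxCost) + (6 +
        (n * n + n + 2) * (5 + (gatherBody a).maxCost)))) (fun t => Contains (t.arr (a + 3))
          ((List.range (n + 1)).flatMap fun d =>
            l.filter fun e => s.key k e / (n + 1) ^ j % (n + 1) = d)) := by
    have hdig : ∀ t : Mem, t.reg 0 = n → t.arr = s.arr → t.digit k j = fun e =>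
        s.key k e / (n + 1) ^ j % (n + 1) := fun t e₀ e₁ => by
      rw [Mem.digit_congr (e₀.trans h₀.symm) (by rw [e₁]) (by rw [e₁])]
      funext e
      rw [Mem.digit, h₀]
    refine h₁.seq fun t ⟨b₁, b₀, b₂⟩ => ?_
    refine (distribute_reaches k j ha b₀ b₁ hl.length_eq (by rwa [b₂]) (by rw [b₂, hc])).frame.seq
      fun u ⟨d₁, _, d₂⟩ => ?_
    refine (h₃ u ((d₂ 0 ?_).trans b₀)).seq fun v ⟨e₀, e₁, e₂, e₃, e₄⟩ => ?_
    · simp [distributeBody, Program.SetsReg]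
    · rw [← e₄] at d₁
      simp only [hdig t b₀ b₂] at d₁
      exact gather_reaches e₀ e₁ e₂ e₃ d₁ hl'.length_eq
  refine main.mono ?_ fun t ht => ⟨_, hl', ht⟩
  generalize 5 + (distributeBody k j a).maxCost = x
  generalize 5 + (gatherBody a).maxCost = y
  nlinarith [Nat.zero_le (x * n), Nat.zero_le (y * n), Nat.zero_le (x * (n * n)),
    Nat.zero_le (y * (n * n))]

/-- Writes the next number to array `10`. -/
def enumerateBody : Program :=
  .seq (.write 10 (.reg 1) (.reg 1)) (.set 1 (.reg 1 + .const 1))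

/-- Radix sort of the numbers below `n * n` by the lowest `j` digits of their keys; the result is in
the array `10 + 3 * j`. -/
def radixSort (k : ℕ) : ℕ → Program
  | 0 => .whileLt (.reg 1) (.reg 0 * .reg 0) enumerateBody
  | j + 1 => .seq (radixSort k j) (radixPass k j (10 + 3 * j))

theorem radixSort_slow (k j : ℕ) : (radixSort k j).Slow := by
  induction j with
  | zero => simp [radixSort, enumerateBody, Program.Slow]
  | succ j ih => exact ⟨ih, radixPass_slow _ _ _⟩

theorem radixSort_not_writesArr {k j b : ℕ} (h : b < 10 ∨ 10 + 3 * j < b) :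
    ¬ (radixSort k j).WritesArr b := by
  induction j with
  | zero =>
    simp [radixSort, enumerateBody, Program.WritesArr]
    omega
  | succ j ih =>
    exact not_or.2 ⟨ih (by omega), radixPass_not_writesArr (by omega)⟩

theorem radixSort_not_setsReg (k j : ℕ) : ¬ (radixSort k j).SetsReg 0 := by
  induction j with
  | zero => simp [radixSort, enumerateBody, Program.SetsReg]
  | succ j ih =>
    exact not_or.2 ⟨ih, by simp [radixPass, distributeBody, gatherBody, Program.SetsReg]⟩

theorem radixSort_reaches (k j : ℕ) : ∃ b, ∀ (n : ℕ) (s : Mem), s.reg 0 = n → s.reg 1 = 0 →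
    (∀ a, 10 ≤ a → s.arr a = fun _ => 0) →
    Reaches (radixSort k j) s (b * (n + 1) ^ 2) (fun t => ∃ l,
      IsSortedRange (n * n) (fun e => s.key k e % (n + 1) ^ j) l ∧
        Contains (t.arr (10 + 3 * j)) l) := by
  induction j with
  | zero =>
    refine ⟨5 + enumerateBody.maxCost, fun n s h₀ h₁ _ => ?_⟩
    have h := Reaches.whileLt (e := .reg 1) (f := .reg 0 * .reg 0) (p := enumerateBody)
      (by simp [enumerateBody, Program.LoopFree])
      (fun t => t.reg 0 = n ∧ t.reg 1 ≤ n * n ∧ Contains (t.arr 10) (List.range (t.reg 1)))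
      (fun t => n * n - t.reg 1) ?_ (s := s)
      ⟨h₀, by omega, by rw [h₁]; exact fun i hi => by simp at hi⟩
    · refine h.mono ?_ ?_
      · simp only [h₁, Nat.sub_zero, WordTerm.cost]
        rw [Nat.mul_comm]
        refine Nat.mul_le_mul le_rfl ?_
        nlinarith
      · rintro t ⟨⟨a₀, a₁, a₂⟩, a₃⟩
        simp only [WordTerm.eval_reg, WordTerm.eval_mul, a₀] at a₃
        obtain h₃ : t.reg 1 = n * n := by omega
        rw [h₃] at a₂
        refine ⟨_, ⟨List.nodup_range, fun e => List.mem_range, ?_⟩, a₂⟩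
        simp only [pow_zero, Nat.mod_one, le_rfl]
        exact List.pairwise_of_forall fun _ _ => trivial
    · rintro t ⟨a₀, a₁, a₂⟩ hlt
      simp only [WordTerm.eval_reg, WordTerm.eval_mul, a₀] at hlt
      simp [enumerateBody, Program.eval, a₀]
      refine ⟨⟨hlt, ?_⟩, by omega⟩
      rw [List.range_succ]
      refine a₂.snoc (fun i hi => ?_) ?_
      · rw [List.length_range] at hi
        exact Function.update_of_ne hi.ne _ _
      · rw [List.length_range, Function.update_self]
  | succ j ih =>
    obtain ⟨b, hb⟩ := ih
    obtain ⟨b', hb'⟩ := radixPass_reaches k j (a := 10 + 3 * j) (by omega)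
    refine ⟨b + b', fun n s h₀ h₁ hz => ?_⟩
    rw [Nat.add_mul]
    refine (hb n s h₀ h₁ hz).frame.seq fun t ⟨⟨l, hl, ht⟩, ha, hr⟩ => ?_
    have e₀ := hr 0 (radixSort_not_setsReg k j)
    have hkey : t.key k = s.key k := by
      funext e
      simp only [Mem.key, e₀, ha 0 (radixSort_not_writesArr (by omega)),
        ha 1 (radixSort_not_writesArr (by omega))]
    have h := hb' n t l (e₀.trans h₀) (by rwa [hkey]) ht
      (by rw [ha _ (radixSort_not_writesArr (by omega)), hz _ (by omega)])
    rwa [hkey] at h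

/-- Rounding down the scaled fractions keeps their strict order, when the scale is at least the
product of the denominators. -/
theorem scaled_div_lt {p q p' q' K : ℕ} (hq : 0 < q) (hq' : 0 < q') (hK : q * q' ≤ K)
    (h : p * q' < p' * q) : p * K / q < p' * K / q' := by
  rw [Nat.lt_iff_add_one_le, Nat.le_div_iff_mul_le hq']
  have h₁ : p * K / q * q ≤ p * K := Nat.div_mul_le_self _ _
  refine Nat.le_of_mul_le_mul_left (?_ : q * _ ≤ q * _) hq
  calc q * ((p * K / q + 1) * q') = (p * K / q * q) * q' + q * q' := by ring
    _ ≤ p * K * q' + K := Nat.add_le_add (Nat.mul_le_mul_right _ h₁) hK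
    _ = (p * q' + 1) * K := by ring
    _ ≤ p' * q * K := Nat.mul_le_mul_right _ h
    _ = q * (p' * K) := by ring

/-! ### Preference lists from sorted values -/

/-- Appending an entry to a list in memory. -/
theorem Prefs.Represents.snoc {n : ℕ} {L L' : Fin n → List (Fin n)} {P P' : Prefs} {u v : Fin n}
    (h : P.Represents L) (hnd : ∀ w, (L' w).Nodup) (hL : L' u = L u ++ [v])
    (hL' : ∀ w, w ≠ u → L' w = L w) (hn : P'.n = n)
    (hlen : P'.len = Function.update P.len u (P.len u + 1))
    (hent : ∀ w i : ℕ, i < n →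
      P'.ent w i = if w = u ∧ i = P.len u then (v : ℕ) else P.ent w i)
    (hrk : ∀ w x : ℕ, x < n → P'.rk w x = if w = u ∧ x = v then P.len u else P.rk w x) :
    P'.Represents L' := by
  have hle : ∀ w, (L' w).length ≤ n := fun w => by simpa using (hnd w).length_le_card
  refine ⟨hn, fun w => ?_, fun w i hi => ?_, fun w i hi => ?_⟩
  · rw [hlen]
    rcases eq_or_ne w u with rfl | hw
    · rw [Function.update_self, hL, h.len_eq, List.length_append, List.length_singleton]
    · rw [Function.update_of_ne (Fin.val_ne_of_ne hw), hL' w hw, h.len_eq]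
  · rw [hent w i (hi.trans_le (hle w)), h.len_eq]
    rcases eq_or_ne w u with rfl | hw
    · simp only [hL]
      rw [hL, List.length_append, List.length_singleton] at hi
      rcases Nat.lt_succ_iff_lt_or_eq.1 hi with hi' | rfl
      · rw [if_neg (fun h' => hi'.ne h'.2), List.getElem_append_left hi', h.ent_eq w i hi']
      · rw [if_pos (by simp), List.getElem_concat_length rfl]
    · rw [if_neg (fun h' => hw (Fin.ext h'.1))]
      simp only [hL' w hw]
      exact h.ent_eq w i _
  · rw [hrk w _ (Fin.is_lt _), h.len_eq]
    rcases eq_or_ne w u with rfl | hw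
    · have hnd' := hnd w
      rw [hL, List.nodup_append] at hnd'
      simp only [hL]
      rw [hL, List.length_append, List.length_singleton] at hi
      rcases Nat.lt_succ_iff_lt_or_eq.1 hi with hi' | rfl
      · rw [List.getElem_append_left hi', if_neg, h.rk_eq w i hi']
        exact fun h' => hnd'.2.2 _ (List.getElem_mem hi') v (List.mem_singleton_self v)
          (Fin.ext h'.2)
      · rw [List.getElem_concat_length rfl, if_pos (by simp)]
    · rw [if_neg (fun h' => hw (Fin.ext h'.1))]
      simp only [hL' w hw]
      exact h.rk_eq w i _

/-- The rows of the list `r` of cells, where only those cells are kept in which the matrix `f` or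
its transpose is positive. -/
def rows {n : ℕ} (hn : 0 < n) (f : ℕ → ℕ) (r : List ℕ) (u : Fin n) : List (Fin n) :=
  (r.filter fun e => e / n = u ∧ 0 < f e + f (e % n * n + e / n)).map
    fun e => ⟨e % n, Nat.mod_lt e hn⟩

theorem mem_rows {n : ℕ} {hn : 0 < n} {f : ℕ → ℕ} {r : List ℕ} {u v : Fin n} :
    v ∈ rows hn f r u ↔ u * n + v ∈ r ∧ 0 < f (u * n + v) + f (v * n + u) := by
  simp only [rows, List.mem_map, List.mem_filter, decide_eq_true_eq]
  constructor
  · rintro ⟨e, ⟨h₁, h₂, h₃⟩, rfl⟩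
    rw [h₂] at h₃
    have he : u * n + e % n = e := by rw [← h₂, Nat.div_add_mod']
    dsimp only
    rw [he]
    exact ⟨h₁, h₃⟩
  · rintro ⟨h₁, h₂⟩
    have h₃ : (u * n + v : ℕ) % n = v := by
      rw [Nat.mul_add_mod_self_right, Nat.mod_eq_of_lt v.2]
    refine ⟨_, ⟨h₁, cell_div v.2, ?_⟩, Fin.ext h₃⟩
    rwa [h₃, cell_div v.2]

theorem nodup_rows {n : ℕ} (hn : 0 < n) (f : ℕ → ℕ) {r : List ℕ} (hr : r.Nodup) (u : Fin n) :
    (rows hn f r u).Nodup := by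
  refine (hr.filter _).map_on fun d hd e he h => ?_
  rw [List.mem_filter, decide_eq_true_eq] at hd he
  rw [← Nat.div_add_mod' d n, ← Nat.div_add_mod' e n, hd.2.1, he.2.1, Fin.mk.inj h]

/-- Appends the next cell of the sorted list in array `a`, taken from its end, to the preference
list of its row, if it belongs to an edge. -/
def fillBody (a : ℕ) : Program :=
  .seq (.set 2 (.read a (.reg 0 * .reg 0 - (.reg 1 + .const 1))))
    (.seq (.set 3 (.reg 2 / .reg 0))
      (.seq (.set 4 (.reg 2 - .reg 3 * .reg 0))
        (.seq (.ifLt (.const 0) (.read 0 (.reg 2) + .read 0 (.reg 4 * .reg 0 + .reg 3))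
            (.seq (.write 3 (.reg 3 * .reg 0 + .read 4 (.reg 3)) (.reg 4))
              (.seq (.write 5 (.reg 3 * .reg 0 + .reg 4) (.read 4 (.reg 3)))
                (.write 4 (.reg 3) (.read 4 (.reg 3) + .const 1))))
            .skip)
          (.set 1 (.reg 1 + .const 1)))))

theorem fillBody_loopFree (a : ℕ) : (fillBody a).LoopFree := by
  simp [fillBody, Program.LoopFree]

theorem fill_reaches {n a : ℕ} (hn : 0 < n) (ha : 10 ≤ a) {s : Mem} (h₀ : s.reg 0 = n)
    (h₁ : s.reg 1 = 0) {r : List ℕ} (hnd : r.Nodup) (hlen : r.length = n * n)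
    (hlt : ∀ e ∈ r, e < n * n)
    (hs : ∀ (i : ℕ) (h : i < r.length), s.arr a (n * n - (i + 1)) = r[i])
    (h₄ : s.arr 4 = fun _ => 0) :
    Reaches (.whileLt (.reg 1) (.reg 0 * .reg 0) (fillBody a)) s
      ((n * n + 1) * (5 + (fillBody a).maxCost))
      (fun t => (t.prefs (t.arr 4)).Represents (rows hn (s.arr 0) r)) := by
  have h := Reaches.whileLt (e := .reg 1) (f := .reg 0 * .reg 0) (fillBody_loopFree a)
    (fun t => t.reg 0 = n ∧ t.reg 1 ≤ n * n ∧ t.arr 0 = s.arr 0 ∧ t.arr a = s.arr a ∧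
      (t.prefs (t.arr 4)).Represents (rows hn (s.arr 0) (r.take (t.reg 1))))
    (fun t => n * n - t.reg 1) ?_ (s := s)
    ⟨h₀, by omega, rfl, rfl, by
      rw [h₁, h₄]
      exact ⟨h₀, fun _ => rfl, fun u i hi => by simp [rows] at hi,
        fun u i hi => by simp [rows] at hi⟩⟩
  · refine h.mono ?_ ?_
    · simp only [h₁, Nat.sub_zero, WordTerm.cost]
      rfl
    · rintro t ⟨⟨a₀, a₁, a₂, a₃, a₄⟩, a₅⟩
      simp only [WordTerm.eval_reg, WordTerm.eval_mul, a₀] at a₅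
      rwa [List.take_of_length_le (by omega)] at a₄
  · rintro t ⟨a₀, a₁, a₂, a₃, a₄⟩ hlt'
    simp only [WordTerm.eval_reg, WordTerm.eval_mul, a₀] at hlt'
    have hi : t.reg 1 < r.length := by omega
    have hx := hs _ hi
    have hxm := hlt _ (List.getElem_mem hi)
    have htake := (List.take_concat_get' r _ hi).symm
    have hnd' : (r.take (t.reg 1 + 1)).Nodup := hnd.sublist (List.take_sublist _ _)
    generalize r[t.reg 1] = e at hx hxm htake
    have hu : e / n < n := Nat.div_lt_of_lt_mul hxm
    have hv : e - e / n * n = e % n := by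
      have := Nat.div_add_mod' e n
      omega
    have hcell : e / n * n + e % n = e := Nat.div_add_mod' e n
    have hrow : ∀ w : Fin n, rows hn (s.arr 0) (r.take (t.reg 1 + 1)) w =
        rows hn (s.arr 0) (r.take (t.reg 1)) w ++
          if e / n = w ∧ 0 < s.arr 0 e + s.arr 0 (e % n * n + e / n) then
            [⟨e % n, Nat.mod_lt e hn⟩] else [] := fun w => by
      rw [htake, rows, List.filter_append, List.map_append, List.filter_singleton, rows]
      split_ifs with hc
      · rw [decide_eq_true hc]; rfl
      · rw [decide_eq_false hc]; rfl
    by_cases hc : 0 < s.arr 0 e + s.arr 0 (e % n * n + e / n)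
    · have hlt₄ : t.arr 4 (e / n) < n := by
        have h₂ := (nodup_rows hn (s.arr 0) hnd' ⟨e / n, hu⟩).length_le_card
        rw [hrow, if_pos ⟨rfl, hc⟩, List.length_append, List.length_singleton, ← a₄.len_eq,
          Fintype.card_fin] at h₂
        exact h₂
      simp only [fillBody, Program.eval, WordTerm.eval_add, WordTerm.eval_mul, WordTerm.eval_sub,
        WordTerm.eval_div, WordTerm.eval_reg, WordTerm.eval_read, WordTerm.eval_const]
      simp [a₀, a₂, a₃, hx, hv, hc]
      refine ⟨⟨hlt', ?_, ?_⟩, by omega⟩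
      · rw [Function.update_of_ne (by omega), Function.update_of_ne (by omega),
          Function.update_of_ne (by omega), a₃]
      · refine a₄.snoc (u := ⟨e / n, hu⟩) (v := ⟨e % n, Nat.mod_lt e hn⟩)
          (fun w => nodup_rows hn _ hnd' w) ?_ ?_ ?_ rfl ?_ ?_
        · rw [hrow, if_pos ⟨rfl, hc⟩]
        · intro w hw
          rw [hrow, if_neg fun h' => hw (Fin.ext h'.1.symm), List.append_nil]
        · simp [Mem.prefs, a₀]
        · intro w i hi'
          have : w * n + i = e / n * n + t.arr 4 (e / n) ↔ w = e / n ∧ i = t.arr 4 (e / n) :=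
            ⟨cell_inj hi' hlt₄, fun h' => by rw [h'.1, h'.2]⟩
          simp [Mem.prefs, a₀, Function.update_apply, this]
        · intro w x hx'
          have : w * n + x = e / n * n + e % n ↔ w = e / n ∧ x = e % n :=
            ⟨cell_inj hx' (Nat.mod_lt e hn), fun h' => by rw [h'.1, h'.2]⟩
          simp only [Mem.prefs]
          simp [a₀, Function.update_apply, this]
    · simp only [fillBody, Program.eval, WordTerm.eval_add, WordTerm.eval_mul, WordTerm.eval_sub,
        WordTerm.eval_div, WordTerm.eval_reg, WordTerm.eval_read, WordTerm.eval_const]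
      simp [a₀, a₂, a₃, hx, hv, hc]
      refine ⟨⟨hlt', ?_⟩, by omega⟩
      have hrow' : rows hn (s.arr 0) (r.take (t.reg 1 + 1)) =
          rows hn (s.arr 0) (r.take (t.reg 1)) := funext fun w => by
        rw [hrow, if_neg fun h' => hc h'.2, List.append_nil]
      rw [hrow']
      simpa [Mem.prefs, a₀] using a₄

/-! ### Input by satisfaction values -/

theorem satInput_key {n : ℕ} (p q : Fin n → Fin n → ℕ) (k : ℕ) (u v : Fin n) :
    (satInput n p q).key k (u * n + v) = p u v * (n + 1) ^ (2 * k) / q u v := by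
  have h₀ : (satInput n p q).arr 0 = matrixArray n p := rfl
  have h₁ : (satInput n p q).arr 1 = matrixArray n q := rfl
  have h₂ : (satInput n p q).reg 0 = n := rfl
  rw [Mem.key, h₀, h₁, h₂, matrixArray_cell, matrixArray_cell]

/-- The cells sorted by decreasing keys give preference lists. -/
theorem rows_isPreferenceLists {n k : ℕ} (hn : 0 < n) {G : SimpleGraph (Fin n)}
    {sat : Fin n → Fin n → ℝ} (hsat : IsSatisfaction G sat) {p q : Fin n → Fin n → ℕ}
    (hpq : ∀ u v, 0 < q u v ∧ sat u v = (p u v : ℝ) / (q u v : ℝ) ∧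
      p u v ≤ (n + 1) ^ k ∧ q u v ≤ (n + 1) ^ k) {l : List ℕ}
    (hl : IsSortedRange (n * n) (fun e => (satInput n p q).key k e % (n + 1) ^ (3 * k + 1)) l) :
    IsPreferenceLists G sat (rows hn ((satInput n p q).arr 0) l.reverse) where
  nodup := nodup_rows hn _ (List.nodup_reverse.2 hl.nodup)
  mem_iff u v := by
    have h₀ : (satInput n p q).arr 0 = matrixArray n p := rfl
    have hpos : ∀ u v, 0 < sat u v ↔ 0 < p u v := fun u v => by
      rw [(hpq u v).2.1, div_pos_iff_of_pos_right (Nat.cast_pos.2 (hpq u v).1), Nat.cast_pos]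
    rw [mem_rows, List.mem_reverse, hl.mem_iff, h₀, matrixArray_cell, matrixArray_cell,
      hsat.adj_iff, hpos, hpos]
    have := cell_lt u.2 v.2
    omega
  sorted u := by
    rw [rows, List.pairwise_map]
    refine ((List.pairwise_reverse.2 hl.sorted).filter _).imp_of_mem fun {d e} hd he hle => ?_
    rw [List.mem_filter, decide_eq_true_eq] at hd he
    have hcell : ∀ e, e / n = u → e = u * n + (⟨e % n, Nat.mod_lt e hn⟩ : Fin n) := fun e he => by
      rw [← he]
      exact (Nat.div_add_mod' e n).symm
    have hd' := hcell d hd.2.1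
    have he' := hcell e he.2.1
    generalize (⟨d % n, Nat.mod_lt d hn⟩ : Fin n) = v at hd' ⊢
    generalize (⟨e % n, Nat.mod_lt e hn⟩ : Fin n) = w at he' ⊢
    -- the keys have at most `3 * k + 1` digits
    have hmod : ∀ v : Fin n, (satInput n p q).key k (u * n + v) % (n + 1) ^ (3 * k + 1) =
        p u v * (n + 1) ^ (2 * k) / q u v := fun v => by
      rw [satInput_key, Nat.mod_eq_of_lt]
      calc p u v * (n + 1) ^ (2 * k) / q u v ≤ p u v * (n + 1) ^ (2 * k) := Nat.div_le_self _ _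
        _ ≤ (n + 1) ^ k * (n + 1) ^ (2 * k) := Nat.mul_le_mul_right _ (hpq u v).2.2.1
        _ = (n + 1) ^ (3 * k) := by rw [← pow_add]; congr 1; ring
        _ < (n + 1) ^ (3 * k + 1) := Nat.pow_lt_pow_right (by omega) (by omega)
    rw [hd', he', hmod, hmod] at hle
    by_contra! hlt
    refine hle.not_gt (scaled_div_lt (hpq u v).1 (hpq u w).1 ?_ ?_)
    · rw [two_mul, pow_add]
      exact Nat.mul_le_mul (hpq u v).2.2.2 (hpq u w).2.2.2
    · rw [(hpq u v).2.1, (hpq u w).2.1, div_lt_div_iff₀ (Nat.cast_pos.2 (hpq u v).1)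
        (Nat.cast_pos.2 (hpq u w).1)] at hlt
      exact_mod_cast hlt

/-- Computes the doubled matching of a stable partition from satisfaction values that are fractions
of numbers up to `(n + 1) ^ k`. -/
def satProgram (k : ℕ) : Program :=
  .seq (radixSort k (3 * k + 1))
    (.seq (.set 1 (.const 0))
      (.seq (.whileLt (.reg 1) (.reg 0 * .reg 0) (fillBody (10 + 3 * (3 * k + 1))))
        partitionProgram))

theorem satProgram_slow (k : ℕ) : (satProgram k).Slow :=
  ⟨radixSort_slow _ _, by simp [Program.Slow], by simp [fillBody, Program.Slow],
    partitionProgram_slow⟩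

theorem satProgram_reaches (k : ℕ) : ∃ b, ∀ n : ℕ, 0 < n → ∀ (G : SimpleGraph (Fin n))
    (sat : Fin n → Fin n → ℝ), IsSatisfaction G sat → ∀ p q : Fin n → Fin n → ℕ,
    (∀ u v, 0 < q u v ∧ sat u v = (p u v : ℝ) / (q u v : ℝ) ∧
      p u v ≤ (n + 1) ^ k ∧ q u v ≤ (n + 1) ^ k) →
    Reaches (satProgram k) (satInput n p q) (b * n ^ 2) (fun s => ∃ (L : Fin n → List (Fin n))
      (π : Equiv.Perm (Fin n)), IsPreferenceLists G sat L ∧ IsStablePartition G (listSat L) π ∧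
        HoldsMatching n s (partitionMatching π)) := by
  obtain ⟨b, hb⟩ := radixSort_reaches k (3 * k + 1)
  generalize hA : 10 + 3 * (3 * k + 1) = A at hb
  refine ⟨4 * (b + (2 + ((5 + (fillBody A).maxCost) + partitionFactor))),
    fun n hn G sat hsat p q hpq => ?_⟩
  have hz : ∀ a, 2 ≤ a → (satInput n p q).arr a = fun _ => 0 := fun a ha => by
    simp only [satInput]
    rw [if_neg (by omega), if_neg (by omega)]
  have h₁ : ∀ t : Mem, t.reg 0 = n → Reaches (.set 1 (.const 0)) t 2
      (fun u => u.reg 0 = n ∧ u.reg 1 = 0 ∧ u.arr = t.arr) := fun t ht =>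
    (Reaches.of_loopFree (by simp [Program.LoopFree]) (by simp [Program.eval, ht])).mono
      le_rfl fun _ h => h
  have main : Reaches (satProgram k) (satInput n p q) (b * (n + 1) ^ 2 + (2 +
      ((n * n + 1) * (5 + (fillBody A).maxCost) + partitionFactor * (n + 1) ^ 2))) (fun s =>
      ∃ (L : Fin n → List (Fin n)) (π : Equiv.Perm (Fin n)), IsPreferenceLists G sat L ∧
        IsStablePartition G (listSat L) π ∧ HoldsMatching n s (partitionMatching π)) := by
    rw [satProgram, hA]
    refine (hb n _ rfl rfl fun a ha => hz a (by omega)).frame.seq fun t ⟨⟨l, hl, ht⟩, ha, hr⟩ => ?_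
    have harr : ∀ a < 10, t.arr a = (satInput n p q).arr a := fun a ha' =>
      ha a (radixSort_not_writesArr (Or.inl ha'))
    have hL := rows_isPreferenceLists hn hsat hpq hl
    refine (h₁ t (hr 0 (radixSort_not_setsReg _ _))).seq fun u ⟨b₀, b₁, b₂⟩ => ?_
    refine (fill_reaches hn (by omega) b₀ b₁ (List.nodup_reverse.2 hl.nodup)
      (by rw [List.length_reverse, hl.length_eq])
      (fun e he => (hl.mem_iff e).1 (List.mem_reverse.1 he)) (fun i hi => ?_)
      (by rw [b₂, harr 4 (by omega), hz 4 (by omega)])).frame.seq fun v ⟨hv, hv', _⟩ => ?_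
    · have hlen := hl.length_eq
      rw [List.length_reverse] at hi
      rw [b₂, ht _ (by omega), List.getElem_reverse]
      congr 1
      omega
    · rw [b₂, harr 0 (by omega)] at hv
      have hready : v.Ready (rows hn ((satInput n p q).arr 0) l.reverse) := by
        refine ⟨hv, fun a ha' => ?_⟩
        simp only [List.mem_cons, List.not_mem_nil, or_false] at ha'
        rw [hv' a, b₂, harr a (by omega), hz a (by omega)]
        rcases ha' with rfl | rfl | rfl | rfl <;> simp [fillBody, Program.WritesArr]
      exact (hready.reaches hL.isAdjacencyLists).mono le_rfl
        fun s ⟨π, h₂, h₃⟩ => ⟨_, π, hL, h₂, h₃⟩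
  refine main.mono ?_ fun _ h => h
  generalize 5 + (fillBody A).maxCost = x
  generalize partitionFactor = y
  have e₁ : (n + 1) ^ 2 ≤ 4 * n ^ 2 := by nlinarith
  have e₂ : n * n + 1 ≤ 4 * n ^ 2 := by nlinarith
  have e₃ : 2 ≤ 4 * n ^ 2 * 2 := by nlinarith
  nlinarith [Nat.mul_le_mul_left b e₁, Nat.mul_le_mul_right x e₂, Nat.mul_le_mul_left y e₁]

theorem satInput_bounded {n k : ℕ} {p q : Fin n → Fin n → ℕ}
    (hp : ∀ u v, p u v ≤ (n + 1) ^ k) (hq : ∀ u v, q u v ≤ (n + 1) ^ k) :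
    (satInput n p q).Bounded ((n + 1) ^ (k + 1)) := by
  have h₁ : (n + 1) ^ k ≤ (n + 1) ^ (k + 1) := Nat.pow_le_pow_right (by omega) (by omega)
  have h₂ : n + 1 ≤ (n + 1) ^ (k + 1) := Nat.le_self_pow (by omega) _
  have hm : ∀ (A : Fin n → Fin n → ℕ), (∀ u v, A u v ≤ (n + 1) ^ k) → ∀ i,
      matrixArray n A i ≤ (n + 1) ^ (k + 1) := fun A hA i => by
    rw [matrixArray]
    split_ifs
    · exact (hA _ _).trans h₁
    · exact Nat.zero_le _
  refine ⟨fun r => ?_, fun a i => ?_⟩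
  · simp only [satInput]
    split_ifs <;> omega
  · simp only [satInput]
    split_ifs
    · exact hm p hp i
    · exact hm q hq i
    · exact Nat.zero_le _
end FracRoommates

theorem mainTheorem7 :
    -- existence, for every stable partition of every tie-breaking
    (∀ (V : Type*) [Fintype V] (G : SimpleGraph V) (sat : V → V → ℝ),
      FracRoommates.IsSatisfaction G sat →
        (∃ M : V → V → ℝ, FracRoommates.IsHalfIntegralStable G sat M) ∧
        (∃ sat' : V → V → ℝ, FracRoommates.IsTieBreaking G sat sat') ∧
        ∀ sat' : V → V → ℝ, FracRoommates.IsTieBreaking G sat sat' →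
          (∃ π : Equiv.Perm V, FracRoommates.IsStablePartition G sat' π) ∧
          ∀ π : Equiv.Perm V, FracRoommates.IsStablePartition G sat' π →
            FracRoommates.IsHalfIntegralStable G sat
              (FracRoommates.partitionMatching π)) ∧
    -- quadratic time, input: the satisfaction values, stored as fractions of words
    (∀ k : ℕ, ∃ (P : FracRoommates.Program) (C : ℕ), ∀ n : ℕ, 0 < n →
      ∀ (G : SimpleGraph (Fin n)) (sat : Fin n → Fin n → ℝ),
        FracRoommates.IsSatisfaction G sat →
      ∀ p q : Fin n → Fin n → ℕ,
        (∀ u v, 0 < q u v ∧ sat u v = (p u v : ℝ) / (q u v : ℝ) ∧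
          p u v ≤ (n + 1) ^ k ∧ q u v ≤ (n + 1) ^ k) →
      ∃ (s : FracRoommates.Mem) (t : ℕ),
        FracRoommates.Exec ((n + 1) ^ C) P (FracRoommates.satInput n p q) s t ∧
        t ≤ C * n ^ 2 ∧
        ∃ (sat' : Fin n → Fin n → ℝ) (π : Equiv.Perm (Fin n)),
          FracRoommates.IsTieBreaking G sat sat' ∧
          FracRoommates.IsStablePartition G sat' π ∧
          FracRoommates.IsHalfIntegralStable G sat (FracRoommates.partitionMatching π) ∧
          FracRoommates.HoldsMatching n s (FracRoommates.partitionMatching π)) ∧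
    -- quadratic time, input: the preference lists, whose order breaks the ties
    (∃ (P : FracRoommates.Program) (C : ℕ), ∀ n : ℕ, 0 < n →
      ∀ (G : SimpleGraph (Fin n)) (sat : Fin n → Fin n → ℝ),
        FracRoommates.IsSatisfaction G sat →
      ∀ L : Fin n → List (Fin n), FracRoommates.IsPreferenceLists G sat L →
      ∃ (s : FracRoommates.Mem) (t : ℕ),
        FracRoommates.Exec ((n + 1) ^ C) P (FracRoommates.listInput n L) s t ∧
        t ≤ C * n ^ 2 ∧
        ∃ (sat' : Fin n → Fin n → ℝ) (π : Equiv.Perm (Fin n)),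
          FracRoommates.IsTieBreaking G sat sat' ∧
          (∀ u, (L u).Pairwise (fun v w => sat' u w < sat' u v)) ∧
          FracRoommates.IsStablePartition G sat' π ∧
          FracRoommates.IsHalfIntegralStable G sat (FracRoommates.partitionMatching π) ∧
          FracRoommates.HoldsMatching n s (FracRoommates.partitionMatching π)) := by
  open FracRoommates in
  refine ⟨fun V _ G sat _ => ?_, fun k => ?_, ?_⟩
  · obtain ⟨L, hL⟩ := exists_isPreferenceLists G sat
    obtain ⟨π, hπ⟩ := exists_isStablePartition hL.isTieBreaking.strict
    exact ⟨⟨_, hπ.isHalfIntegralStable hL.isTieBreaking⟩, ⟨_, hL.isTieBreaking⟩, fun sat' h =>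
      ⟨exists_isStablePartition h.strict, fun π' hπ' => hπ'.isHalfIntegralStable h⟩⟩
  · obtain ⟨b, hb⟩ := satProgram_reaches k
    refine ⟨satProgram k, (k + 1 + b + 5) * (satProgram k).deg + b,
      fun n hn G sat hsat p q hpq => ?_⟩
    obtain ⟨s, t, h₁, h₂, L, π, hL, hπ, hM⟩ := (hb n hn G sat hsat p q hpq).exists_exec
      (satProgram_slow k) hn
      (satInput_bounded (fun u v => (hpq u v).2.2.1) fun u v => (hpq u v).2.2.2) le_rfl le_rfl
    exact ⟨s, t, h₁, h₂, listSat L, π, hL.isTieBreaking, hπ,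
      hπ.isHalfIntegralStable hL.isTieBreaking, hM⟩
  · obtain ⟨C, hC⟩ := listProgram_exec
    refine ⟨listProgram, C, fun n hn G sat _ L hL => ?_⟩
    obtain ⟨s, t, h₁, h₂, π, hπ, hM⟩ := hC n hn L G hL.isAdjacencyLists
    exact ⟨s, t, h₁, h₂, listSat L, π, hL.isTieBreaking, hL.isAdjacencyLists.pairwise_listSat, hπ,
      hπ.isHalfIntegralStable hL.isTieBreaking, hM⟩
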